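/- **Theorem (Existence of an optimizer).** Let $T>0$, $\ell>0$, $X=[0,\ell]$ and $p\in[1,\infty)$. Let $v\in C^1([0,T]\times\mathbb R;\mathbb R_{>0})$, let $b,d\in C^1(X;X)$ with $b\le d$, let $0<\lambda_{\min}\le\lambda_{\max}$ and $L\ge 0$, and let $\rho_0,q_0\in L^\infty((0,\ell))$ and $u^1,u^2\in L^\infty((0,T))$ with $\rho_0\ge 0$ and $u^1\ge0$ almost everywhere. Consider the coupled system on $(0,T)\times(0,\ell)$ $$\partial_t\rho(t,x)+\partial_x\Big(v\big(t,\textstyle\int_0^\ell\rho(t,s)\,ds\big)\rho(t,x)\Big)=0,\quad \rho(0,x)=\rho_0(x),\quad v\big(t,\textstyle\int_0^\ell\rho(t,s)\,ds\big)\rho(t,0)=u^1(t),$$ $$\partial_t q(t,x)+\partial_x\Big(\lambda\big(t,x,\textstyle\int_{b(x)}^{d(x)}\rho(t,s)\,ds\big)q(t,x)\Big)=0,\quad q(0,x)=q_0(x),\quad \lambda\big(t,0,\textstyle\int_{b(0)}^{d(0)}\rho(t,s)\,ds\big)q(t,0)=u^2(t),$$ where solutions $\rho,q\in C([0,T];L^p((0,\ell)))\cap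 L^\infty((0,T)\times(0,\ell))$ are understood in the weak sense: a problem $\partial_t r+\partial_x(wr)=0$, $r(0,\cdot)=r_0$, $w(\cdot,0)r(\cdot,0)=u$ means that $$\int_0^T\!\!\int_0^\ell r\,(\partial_t\varphi+w\,\partial_x\varphi)\,dx\,dt+\int_0^\ell r_0(x)\varphi(0,x)\,dx+\int_0^T u(t)\varphi(t,0)\,dt=0$$ for all $\varphi\in C^1(\mathbb R^2)$ with $\varphi(T,x)=0$ for $x\in[0,\ell]$ and $\varphi(t,\ell)=0$ for $t\in[0,T]$. Let $\Lambda$ be the set of all $\lambda\in C([0,T]\times X\times\mathbb R_{\ge0};\mathbb R)$ such that $\lambda_{\min}\le\lambda\le\lambda_{\max}$ and $$|\lambda(t,x,y)-\lambda(\tilde t,\tilde x,\tilde y)|\le L\,(|x-\tilde x|+|y-\tilde y|+|t-\tilde t|)$$ for all $t,\tilde t\in[0,T]$, $x,\tilde x\in X$, $y,\tilde y\ge0$. Put $$J_1(q,\rho)=\int_0^T\left[\int_0^\ell x^2q(t,x)\,dx-\Big(\int_0^\ell xq(t,x)\,dx\Big)^2\right]dt,$$ $$J_2(q,\rho)=\int_0^T\left[\int_0^\ell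 x^2q(t,x)(1+\rho(t,x))\,dx-\Big(\int_0^\ell xq(t,x)(1+\rho(t,x))\,dx\Big)^2\right]dt.$$ Then for each $i\in\{1,2\}$ the problem of minimizing $J_i(q,\rho)$ over all $\lambda\in\Lambda$ and all weak solutions $(\rho,q)$ of the coupled system with velocity $\lambda$ has a solution: there are $\lambda_*\in\Lambda$ and a weak solution $(\rho_*,q_*)$ for $\lambda_*$ with $J_i(q_*,\rho_*)\le J_i(q,\rho)$ for every $\lambda\in\Lambda$ and every weak solution $(\rho,q)$ for $\lambda$. -/

import Mathlib

open MeasureTheory Set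
open scoped ENNReal

noncomputable section

namespace Platooning

/-- Lebesgue measure on the open road `(0, ℓ)`. -/
abbrev roadMeasure (ℓ : ℝ) : Measure ℝ := volume.restrict (Ioo 0 ℓ)

/-- Membership in `C([0,T]; L^p(0,ℓ)) ∩ L^∞((0,T) × (0,ℓ))`
(values at times outside `[0,T]` play no role). -/
structure IsDensity (T ℓ : ℝ) (p : ℝ≥0∞) [Fact (1 ≤ p)]
    (r : ℝ → Lp ℝ p (roadMeasure ℓ)) : Prop where
  continuousOn : ContinuousOn r (Icc 0 T)
  essBounded : ∃ M : ℝ, ∀ t ∈ Icc 0 T, ∀ᵐ x ∂(roadMeasure ℓ), |r t x| ≤ M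

/-- Weak formulation of the initial-boundary value problem
`∂ₜ r + ∂ₓ (w r) = 0` on `(0,T) × (0,ℓ)`, `r(0,x) = r₀(x)`, `w(t,0) r(t,0) = u(t)`,
tested with `C¹` functions vanishing at the final time and at the exit of the road. -/
def IsWeakSolution (T ℓ : ℝ) (w : ℝ → ℝ → ℝ) (r₀ u : ℝ → ℝ) (r : ℝ → ℝ → ℝ) : Prop :=
  ∀ φ : ℝ × ℝ → ℝ, ContDiff ℝ 1 φ →
    (∀ x ∈ Icc 0 ℓ, φ (T, x) = 0) → (∀ t ∈ Icc 0 T, φ (t, ℓ) = 0) →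
    (∫ t in 0..T, ∫ x in 0..ℓ,
        r t x * (fderiv ℝ φ (t, x) (1, 0) + w t x * fderiv ℝ φ (t, x) (0, 1)))
      + (∫ x in 0..ℓ, r₀ x * φ (0, x)) + (∫ t in 0..T, u t * φ (t, 0)) = 0

/-- The overall traffic density `ρ`: its velocity depends on the total load of the road. -/
def SolvesTraffic (T ℓ : ℝ) (v : ℝ → ℝ → ℝ) (ρ₀ u₁ : ℝ → ℝ) (ρ : ℝ → ℝ → ℝ) : Prop :=
  IsWeakSolution T ℓ (fun t _ => v t (∫ s in 0..ℓ, ρ t s)) ρ₀ u₁ ρ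

/-- The truck density `q`: its velocity is `lam (t, x, ∫_{b(x)}^{d(x)} ρ(t,s) ds)`. -/
def SolvesTruck (T ℓ : ℝ) (b d : ℝ → ℝ) (lam : ℝ → ℝ → ℝ → ℝ) (q₀ u₂ : ℝ → ℝ)
    (ρ q : ℝ → ℝ → ℝ) : Prop :=
  IsWeakSolution T ℓ (fun t x => lam t x (∫ s in (b x)..(d x), ρ t s)) q₀ u₂ q

/-- The set `Λ` of admissible speeds on `[0,T] × [0,ℓ] × [0,∞)`. By continuity it makes no
difference whether the bounds are required for `y ≥ 0` or only for `y > 0`. -/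
structure IsAdmissibleSpeed (T ℓ lmin lmax L : ℝ) (lam : ℝ → ℝ → ℝ → ℝ) : Prop where
  continuousOn : ContinuousOn (fun z : ℝ × ℝ × ℝ => lam z.1 z.2.1 z.2.2)
    (Icc 0 T ×ˢ Icc 0 ℓ ×ˢ Ici 0)
  mem_Icc : ∀ t ∈ Icc 0 T, ∀ x ∈ Icc 0 ℓ, ∀ y, 0 ≤ y → lam t x y ∈ Icc lmin lmax
  lipschitz : ∀ t ∈ Icc 0 T, ∀ t' ∈ Icc 0 T, ∀ x ∈ Icc 0 ℓ, ∀ x' ∈ Icc 0 ℓ,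
    ∀ y y' : ℝ, 0 ≤ y → 0 ≤ y' →
      |lam t x y - lam t' x' y'| ≤ L * (|x - x'| + |y - y'| + |t - t'|)

/-- The variance functional of the truck density. -/
def J₁ (T ℓ : ℝ) (q : ℝ → ℝ → ℝ) : ℝ :=
  ∫ t in 0..T, ((∫ x in 0..ℓ, x ^ 2 * q t x) - (∫ x in 0..ℓ, x * q t x) ^ 2)

/-- The variance functional weighted by the overall traffic density. -/
def J₂ (T ℓ : ℝ) (q ρ : ℝ → ℝ → ℝ) : ℝ :=
  ∫ t in 0..T, ((∫ x in 0..ℓ, x ^ 2 * q t x * (1 + ρ t x))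
    - (∫ x in 0..ℓ, x * q t x * (1 + ρ t x)) ^ 2)

/-- A control together with the two densities that it governs. -/
@[ext]
structure Candidate (ℓ : ℝ) (p : ℝ≥0∞) where
  /-- the truck velocity -/
  lam : ℝ → ℝ → ℝ → ℝ
  /-- the overall traffic density -/
  ρ : ℝ → Lp ℝ p (roadMeasure ℓ)
  /-- the truck density -/
  q : ℝ → Lp ℝ p (roadMeasure ℓ)

/-- Feasible candidates: the control lies in `Λ` and the densities are weak solutions of the
coupled system of partial differential equations. -/
def feasible (T ℓ : ℝ) (p : ℝ≥0∞) [Fact (1 ≤ p)] (v : ℝ → ℝ → ℝ) (b d : ℝ → ℝ)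
    (lmin lmax L : ℝ) (ρ₀ u₁ q₀ u₂ : ℝ → ℝ) : Set (Candidate ℓ p) :=
  {c | IsAdmissibleSpeed T ℓ lmin lmax L c.lam ∧
    IsDensity T ℓ p c.ρ ∧ SolvesTraffic T ℓ v ρ₀ u₁ (fun t => c.ρ t) ∧
    IsDensity T ℓ p c.q ∧
      SolvesTruck T ℓ b d c.lam q₀ u₂ (fun t => c.ρ t) (fun t => c.q t)}

end Platooning

end

namespace Platooning
open Filter Topology
open scoped NNReal BoundedContinuousFunction

/-! ### Densities transported by antilipschitz maps of the line -/

/-! The traffic equation does not contain the control, and its weak solution `ρ` is unique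
(`exists_unique_traffic`). Every feasible candidate therefore carries the same `ρ` on `[0,T]`. Both
functionals then become a second moment of `q` minus the square of a first moment, with fixed
weights, integrated in time. The local load of `ρ` is nonnegative and bounded by some `Y`, so a
speed acts on `q` only through its values on the compact box `[0,T] × [0,ℓ] × [0,Y]`. Restricted to
the box, the admissible speeds form a compact set by Arzelà–Ascoli (`isCompact_boxSpeeds`). It
remains to see that `q` is determined by the speed and that its moments depend continuously on it
(`tendsto_variance`).

Both properties come from a Lagrangian description of linear transport. Initial and boundary data
are merged into one function `f` of a label `y` in `(-T, ℓ)`: labels `y > 0` start on the road at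
`y`, labels `y < 0` enter at time `-y`. The solution at time `t` is the density of the image of `f
dy` under the characteristic map. Since the velocity is bounded below by a positive constant and
Lipschitz in space, this map is antilipschitz with a constant depending only on the bounds for the
velocity. The image therefore has a bounded density, and no differentiability of the flow is needed.
A moment of the solution is the integral of `f` times the weight composed with the characteristics.
If velocities converge uniformly, characteristics converge by Grönwall. The common antilipschitz
constant then allows merely integrable weights, by approximation with continuous ones
(`tendsto_integral_mul_comp`).

Uniqueness for the linear problem is an energy estimate one derivative below the density
(`IsWeakNull.ae_eq_zero`): the primitive `Q` in space of the difference of two solutions satisfies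
`∂ₜ Q + w ∂ₓ Q = 0` with `Q = 0` at the entry, and Grönwall applies to `∫ Q²`. Strong continuity in
time follows from weak continuity together with an upper bound for the `L²` norms
(`tendsto_integral_transported_sub_sq`).

The nonlocal traffic equation reduces to a fixed point for the total load as a function of time. The
load map is a contraction in an exponentially weighted supremum norm (`exists_unique_load`). -/

lemma measurableEmbedding_of_antilipschitz {C : ℝ≥0} {Z : ℝ → ℝ} (hc : Continuous Z)
    (hZ : AntilipschitzWith C Z) : MeasurableEmbedding Z :=
  hc.measurableEmbedding hZ.injective

/-- Lebesgue measure on the line is one-dimensional Hausdorff measure, and preimages under an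
antilipschitz map enlarge the latter by at most the factor `C`. -/
lemma map_volume_le {C : ℝ≥0} {Z : ℝ → ℝ} (hc : Continuous Z) (hZ : AntilipschitzWith C Z) :
    (volume : Measure ℝ).map Z ≤ (C : ℝ≥0∞) • volume := by
  refine Measure.le_iff.2 fun s hs => ?_
  rw [Measure.map_apply hc.measurable hs, Measure.smul_apply, ← hausdorffMeasure_real]
  simpa using hZ.hausdorffMeasure_preimage_le zero_le_one s

lemma map_volume_absolutelyContinuous {C : ℝ≥0} {Z : ℝ → ℝ} (hc : Continuous Z)
    (hZ : AntilipschitzWith C Z) : (volume : Measure ℝ).map Z ≪ volume :=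
  (Measure.absolutelyContinuous_of_le (map_volume_le hc hZ)).trans
    (Measure.smul_absolutelyContinuous)

lemma sigmaFinite_map_volume {C : ℝ≥0} {Z : ℝ → ℝ} (hc : Continuous Z)
    (hZ : AntilipschitzWith C Z) : SigmaFinite ((volume : Measure ℝ).map Z) :=
  (measurableEmbedding_of_antilipschitz hc hZ).sigmaFinite_map

lemma rnDeriv_map_volume_le {C : ℝ≥0} {Z : ℝ → ℝ} (hc : Continuous Z)
    (hZ : AntilipschitzWith C Z) :
    ∀ᵐ x, (((volume : Measure ℝ).map Z).rnDeriv volume x).toReal ≤ C := by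
  have h : ((volume : Measure ℝ).map Z).rnDeriv volume ≤ᵐ[volume] fun _ => (C : ℝ≥0∞) := by
    refine ae_le_of_forall_setLIntegral_le_of_sigmaFinite (Measure.measurable_rnDeriv _ _) ?_
    intro s hs _
    refine (Measure.setLIntegral_rnDeriv_le s).trans ?_
    simpa using map_volume_le hc hZ s
  filter_upwards [h] with x hx
  exact ENNReal.toReal_le_coe_of_le_coe hx

/-- The density of the image under `Z` of the signed measure with density `f`. -/
noncomputable def pushDensity (Z f : ℝ → ℝ) (x : ℝ) : ℝ :=
  (((volume : Measure ℝ).map Z).rnDeriv volume x).toReal * Function.extend Z f 0 x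

/-- On the range of `Z` the factor `Function.extend Z f 0` is `f ∘ Z⁻¹`, the density of the image of
`f dy` relative to the image of Lebesgue measure. The Radon–Nikodym derivative converts the latter
to Lebesgue measure. -/
lemma integral_comp_mul {C : ℝ≥0} {Z : ℝ → ℝ} (hc : Continuous Z)
    (hZ : AntilipschitzWith C Z) (f h : ℝ → ℝ) :
    ∫ x, pushDensity Z f x * h x = ∫ y, f y * h (Z y) := by
  have := sigmaFinite_map_volume hc hZ
  have he := measurableEmbedding_of_antilipschitz hc hZ
  have h1 := integral_rnDeriv_smul (map_volume_absolutelyContinuous hc hZ)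
    (f := fun x => Function.extend Z f 0 x * h x)
  simp only [smul_eq_mul, ← mul_assoc] at h1
  unfold pushDensity
  rw [h1, he.integral_map]
  simp [hZ.injective.extend_apply]

lemma integrable_comp_mul_iff {C : ℝ≥0} {Z : ℝ → ℝ} (hc : Continuous Z)
    (hZ : AntilipschitzWith C Z) (f h : ℝ → ℝ) :
    Integrable (fun x => pushDensity Z f x * h x) ↔ Integrable (fun y => f y * h (Z y)) := by
  have := sigmaFinite_map_volume hc hZ
  have he := measurableEmbedding_of_antilipschitz hc hZ
  have h1 := integrable_rnDeriv_smul_iff (map_volume_absolutelyContinuous hc hZ)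
    (f := fun x => Function.extend Z f 0 x * h x)
  simp only [smul_eq_mul, ← mul_assoc] at h1
  unfold pushDensity
  rw [h1, he.integrable_map_iff]
  simp [Function.comp_def, hZ.injective.extend_apply]

lemma integrable_pushDensity {C : ℝ≥0} {Z f : ℝ → ℝ} (hc : Continuous Z)
    (hZ : AntilipschitzWith C Z) (hf : Integrable f) : Integrable (pushDensity Z f) := by
  simpa using (integrable_comp_mul_iff hc hZ f fun _ => 1).2 (by simpa using hf)

lemma measurable_pushDensity {C : ℝ≥0} {Z f : ℝ → ℝ} (hc : Continuous Z)
    (hZ : AntilipschitzWith C Z) (hf : Measurable f) : Measurable (pushDensity Z f) :=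
  (Measure.measurable_rnDeriv _ _).ennreal_toReal.mul
    ((measurableEmbedding_of_antilipschitz hc hZ).measurable_extend hf measurable_const)

lemma abs_pushDensity_le {C : ℝ≥0} {Z f : ℝ → ℝ} {M : ℝ} (hc : Continuous Z)
    (hZ : AntilipschitzWith C Z) (hM : ∀ y, |f y| ≤ M) : ∀ᵐ x, |pushDensity Z f x| ≤ C * M := by
  have hM0 : 0 ≤ M := (abs_nonneg _).trans (hM 0)
  filter_upwards [rnDeriv_map_volume_le hc hZ] with x hx
  unfold pushDensity
  rw [abs_mul, abs_of_nonneg ENNReal.toReal_nonneg]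
  refine mul_le_mul hx ?_ (abs_nonneg _) C.2
  by_cases h : ∃ y, Z y = x
  · obtain ⟨y, rfl⟩ := h
    rw [hZ.injective.extend_apply]
    exact hM y
  · rw [Function.extend_apply' _ _ _ h]
    simpa using hM0

lemma pushDensity_nonneg {C : ℝ≥0} {Z f : ℝ → ℝ}
    (hZ : AntilipschitzWith C Z) (hf : ∀ y, 0 ≤ f y) (x : ℝ) : 0 ≤ pushDensity Z f x := by
  unfold pushDensity
  refine mul_nonneg ENNReal.toReal_nonneg ?_
  by_cases h : ∃ y, Z y = x
  · obtain ⟨y, rfl⟩ := h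
    rw [hZ.injective.extend_apply]
    exact hf y
  · rw [Function.extend_apply' _ _ _ h]
    rfl

lemma integrable_comp_of_antilipschitz {C : ℝ≥0} {Z h : ℝ → ℝ} (hc : Continuous Z)
    (hZ : AntilipschitzWith C Z) (hh : Integrable h) : Integrable fun y => h (Z y) := by
  have he := measurableEmbedding_of_antilipschitz hc hZ
  refine he.integrable_map_iff.1 ?_
  exact (hh.smul_measure (c := (C : ℝ≥0∞)) ENNReal.coe_ne_top).mono_measure (map_volume_le hc hZ)

lemma integral_comp_le_of_antilipschitz {C : ℝ≥0} {Z h : ℝ → ℝ} (hc : Continuous Z)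
    (hZ : AntilipschitzWith C Z) (hh : Integrable h) (h0 : ∀ x, 0 ≤ h x) :
    ∫ y, h (Z y) ≤ C * ∫ x, h x := by
  have he := measurableEmbedding_of_antilipschitz hc hZ
  rw [← he.integral_map (g := h)]
  refine (integral_mono_measure (map_volume_le hc hZ) (.of_forall h0)
    (hh.smul_measure ENNReal.coe_ne_top)).trans ?_
  rw [integral_smul_measure]
  simp

/-- Weak continuity of transported densities with respect to the transporting map. -/
lemma tendsto_integral_mul_comp {ι : Type*} {l : Filter ι} [l.IsCountablyGenerated] {C : ℝ≥0}
    {Z : ι → ℝ → ℝ} {Z₀ f h : ℝ → ℝ} {M : ℝ}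
    (hc : ∀ᶠ n in l, Continuous (Z n)) (hZ : ∀ᶠ n in l, AntilipschitzWith C (Z n))
    (hc₀ : Continuous Z₀) (hZ₀ : AntilipschitzWith C Z₀)
    (hlim : ∀ y, f y ≠ 0 → Tendsto (fun n => Z n y) l (𝓝 (Z₀ y)))
    (hf : Integrable f) (hM : ∀ y, |f y| ≤ M) (hh : Integrable h) :
    Tendsto (fun n => ∫ y, f y * h (Z n y)) l (𝓝 (∫ y, f y * h (Z₀ y))) := by
  have hM0 : 0 ≤ M := (abs_nonneg _).trans (hM 0)
  -- Replacing `h` by `g` costs a multiple of their `L¹` distance that is the same for all maps `Z`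
  -- involved. This reduces the claim to continuous compactly supported test functions, where
  -- dominated convergence applies.
  have key : ∀ {Z : ℝ → ℝ} {g : ℝ → ℝ}, Continuous Z → AntilipschitzWith C Z → Integrable g →
      |(∫ y, f y * h (Z y)) - ∫ y, f y * g (Z y)| ≤ M * (C * ∫ x, |h x - g x|) := by
    intro Z g hcZ hZZ hg
    have i1 : ∀ {k : ℝ → ℝ}, Integrable k → Integrable fun y => f y * k (Z y) := fun hk =>
      (integrable_comp_of_antilipschitz hcZ hZZ hk).bdd_mul hf.1 (.of_forall hM)
    rw [← integral_sub (i1 hh) (i1 hg)]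
    have i2 : Integrable fun x => |h x - g x| := (hh.sub hg).abs
    calc |∫ y, (f y * h (Z y) - f y * g (Z y))|
        ≤ ∫ y, |f y * h (Z y) - f y * g (Z y)| := abs_integral_le_integral_abs
      _ ≤ ∫ y, M * |h (Z y) - g (Z y)| := by
          refine integral_mono ((i1 hh).sub (i1 hg)).abs
            ((integrable_comp_of_antilipschitz hcZ hZZ i2).const_mul M) fun y => ?_
          simp only
          rw [← mul_sub, abs_mul]
          exact mul_le_mul_of_nonneg_right (hM y) (abs_nonneg _)
      _ ≤ M * (C * ∫ x, |h x - g x|) := by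
          rw [integral_const_mul]
          exact mul_le_mul_of_nonneg_left
            (integral_comp_le_of_antilipschitz hcZ hZZ i2 fun _ => abs_nonneg _) hM0
  rw [Metric.tendsto_nhds]
  intro ε hε
  obtain ⟨δ, hδ, hδε⟩ : ∃ δ > 0, M * (C * δ) < ε / 3 := by
    -- The summand `1` keeps the denominator positive when `M * C = 0`.
    refine ⟨ε / 3 / (M * C + 1), by positivity, ?_⟩
    have : 0 ≤ M * (C : ℝ) := by positivity
    rw [← mul_assoc, mul_div_assoc', div_lt_iff₀ (by positivity)]
    nlinarith
  obtain ⟨g, hgs, hgδ, hgc, hgi⟩ := hh.exists_hasCompactSupport_integral_sub_le hδ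
  simp only [Real.norm_eq_abs] at hgδ
  obtain ⟨B, hB⟩ := hgc.bounded_above_of_compact_support hgs
  have hlimg : Tendsto (fun n => ∫ y, f y * g (Z n y)) l (𝓝 (∫ y, f y * g (Z₀ y))) := by
    refine tendsto_integral_filter_of_dominated_convergence (fun y => |f y| * B) ?_ ?_
      (hf.abs.mul_const B) ?_
    · filter_upwards [hc] with n hn
      exact hf.1.mul (hgc.comp hn).aestronglyMeasurable
    · refine .of_forall fun n => .of_forall fun y => ?_
      rw [norm_mul]
      exact mul_le_mul_of_nonneg_left (hB _) (norm_nonneg _)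
    · refine .of_forall fun y => ?_
      by_cases hy : f y = 0
      · simpa [hy] using tendsto_const_nhds
      · exact ((hgc.tendsto _).comp (hlim y hy)).const_mul _
  have hbd : M * (C * ∫ x, |h x - g x|) < ε / 3 :=
    (mul_le_mul_of_nonneg_left (mul_le_mul_of_nonneg_left hgδ C.2) hM0).trans_lt hδε
  filter_upwards [hc, hZ, Metric.tendsto_nhds.1 hlimg (ε / 3) (by positivity)] with n h1 h2 h3
  rw [Real.dist_eq] at h3 ⊢
  have a1 := (key h1 h2 hgi).trans_lt hbd
  have a2 := (key hc₀ hZ₀ hgi).trans_lt hbd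
  rw [abs_lt] at *
  constructor <;> linarith [a1.1, a1.2, a2.1, a2.2, h3.1, h3.2]

/-! ### Bounded curves in `L¹` of the road -/

lemma intervalIntegral_eq_road {ℓ : ℝ} (hℓ : 0 ≤ ℓ) (f : ℝ → ℝ) :
    ∫ x in 0..ℓ, f x = ∫ x, f x ∂(roadMeasure ℓ) := by
  rw [intervalIntegral.integral_of_le hℓ, integral_Ioc_eq_integral_Ioo]

/-- A curve `[0,T] → L¹(0,ℓ)` that is continuous and uniformly essentially bounded by `M`. -/
structure IsCurve (T ℓ M : ℝ) (r : ℝ → ℝ → ℝ) : Prop where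
  meas : ∀ t ∈ Icc 0 T, AEStronglyMeasurable (r t) (roadMeasure ℓ)
  bound : ∀ t ∈ Icc 0 T, ∀ᵐ x ∂(roadMeasure ℓ), |r t x| ≤ M
  cont : ∀ t ∈ Icc 0 T, Tendsto (fun s => ∫ x, |r s x - r t x| ∂(roadMeasure ℓ))
    (𝓝[Icc 0 T] t) (𝓝 0)

section Curve
variable {T ℓ M M' : ℝ} {r r' : ℝ → ℝ → ℝ}

lemma IsCurve.integrable (h : IsCurve T ℓ M r) {t : ℝ} (ht : t ∈ Icc 0 T) :
    Integrable (r t) (roadMeasure ℓ) :=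
  Integrable.of_bound (h.meas t ht) M (h.bound t ht)

lemma IsCurve.integrable_mul (h : IsCurve T ℓ M r) {t : ℝ} (ht : t ∈ Icc 0 T) {g : ℝ → ℝ} {B : ℝ}
    (hg : AEStronglyMeasurable g (roadMeasure ℓ)) (hB : ∀ x ∈ Ioo 0 ℓ, |g x| ≤ B) :
    Integrable (fun x => r t x * g x) (roadMeasure ℓ) :=
  (h.integrable ht).mul_bdd (c := B) hg ((ae_restrict_mem measurableSet_Ioo).mono fun x hx => hB x hx)

lemma IsCurve.const {g : ℝ → ℝ} (hg : Measurable g) (hM : ∀ x ∈ Ioo 0 ℓ, |g x| ≤ M) :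
    IsCurve T ℓ M fun _ => g where
  meas _ _ := hg.aestronglyMeasurable
  bound _ _ := (ae_restrict_mem measurableSet_Ioo).mono fun x hx => hM x hx
  cont _ _ := by simpa using tendsto_const_nhds

lemma IsCurve.add (h : IsCurve T ℓ M r) (h' : IsCurve T ℓ M' r') :
    IsCurve T ℓ (M + M') fun t x => r t x + r' t x where
  meas t ht := (h.meas t ht).add (h'.meas t ht)
  bound t ht := by
    filter_upwards [h.bound t ht, h'.bound t ht] with x h1 h2
    exact (abs_add_le _ _).trans (add_le_add h1 h2)
  cont t ht := by
    have := (h.cont t ht).add (h'.cont t ht)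
    rw [add_zero] at this
    refine squeeze_zero' (.of_forall fun s => integral_nonneg fun x => abs_nonneg _) ?_ this
    filter_upwards [self_mem_nhdsWithin] with s hs
    have i1 := ((h.integrable hs).sub (h.integrable ht)).abs
    have i2 := ((h'.integrable hs).sub (h'.integrable ht)).abs
    simp only [Pi.sub_apply] at i1 i2
    rw [← integral_add i1 i2]
    refine integral_mono_of_nonneg (.of_forall fun _ => abs_nonneg _) (i1.add i2)
      (.of_forall fun x => ?_)
    beta_reduce
    rw [add_sub_add_comm]
    exact abs_add_le _ _

/-- In `L¹` alone products need not be continuous. Here each factor is essentially bounded, so an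
increment of one factor is always multiplied by a bounded function. This admits weights such as `x²
(1 + ρ)`. -/
lemma IsCurve.mul (h : IsCurve T ℓ M r) (h' : IsCurve T ℓ M' r') :
    IsCurve T ℓ (M * M') fun t x => r t x * r' t x where
  meas t ht := (h.meas t ht).mul (h'.meas t ht)
  bound t ht := by
    filter_upwards [h.bound t ht, h'.bound t ht] with x h1 h2
    rw [abs_mul]
    exact mul_le_mul h1 h2 (abs_nonneg _) ((abs_nonneg _).trans h1)
  cont t ht := by
    have := ((h.cont t ht).mul_const M').add ((h'.cont t ht).const_mul M)
    rw [zero_mul, mul_zero, add_zero] at this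
    refine squeeze_zero' (.of_forall fun s => integral_nonneg fun x => abs_nonneg _) ?_ this
    filter_upwards [self_mem_nhdsWithin] with s hs
    have i1 := (((h.integrable hs).sub (h.integrable ht)).abs).mul_const M'
    have i2 := (((h'.integrable hs).sub (h'.integrable ht)).abs).const_mul M
    simp only [Pi.sub_apply] at i1 i2
    rw [← integral_mul_const, ← integral_const_mul, ← integral_add i1 i2]
    refine integral_mono_of_nonneg (.of_forall fun _ => abs_nonneg _) (i1.add i2) ?_
    filter_upwards [h.bound t ht, h'.bound s hs] with x h1 h2
    rw [show r s x * r' s x - r t x * r' t x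
      = (r s x - r t x) * r' s x + r t x * (r' s x - r' t x) by ring]
    refine (abs_add_le _ _).trans ?_
    rw [abs_mul, abs_mul]
    exact add_le_add (mul_le_mul_of_nonneg_left h2 (abs_nonneg _))
      (mul_le_mul_of_nonneg_right h1 (abs_nonneg _))

lemma IsCurve.sub (h : IsCurve T ℓ M r) (h' : IsCurve T ℓ M' r') :
    IsCurve T ℓ (M + M') fun t x => r t x - r' t x := by
  have := h.add ((IsCurve.const (M := 1) (g := fun _ => -1) measurable_const
    (fun x _ => by simp)).mul h')
  simpa [sub_eq_add_neg] using this

/-- Split `r s * g s` as `r t * g s + (r s - r t) * g s`: the first part converges by dominated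
convergence, the second is at most `B` times the `L¹` distance. -/
lemma IsCurve.continuousOn_integral_mul (h : IsCurve T ℓ M r) {g : ℝ → ℝ → ℝ} {B : ℝ}
    (hg : ∀ t ∈ Icc 0 T, AEStronglyMeasurable (g t) (roadMeasure ℓ))
    (hB : ∀ t ∈ Icc 0 T, ∀ x ∈ Ioo 0 ℓ, |g t x| ≤ B)
    (hc : ∀ x ∈ Ioo 0 ℓ, ContinuousOn (fun t => g t x) (Icc 0 T)) :
    ContinuousOn (fun t => ∫ x, r t x * g t x ∂(roadMeasure ℓ)) (Icc 0 T) := by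
  intro t ht
  have h1 : Tendsto (fun s => ∫ x, r t x * g s x ∂(roadMeasure ℓ)) (𝓝[Icc 0 T] t)
      (𝓝 (∫ x, r t x * g t x ∂(roadMeasure ℓ))) := by
    refine tendsto_integral_filter_of_dominated_convergence (fun x => |r t x| * B) ?_ ?_
      ((h.integrable ht).abs.mul_const B) ?_
    · filter_upwards [self_mem_nhdsWithin] with s hs using (h.meas t ht).mul (hg s hs)
    · filter_upwards [self_mem_nhdsWithin] with s hs
      filter_upwards [ae_restrict_mem measurableSet_Ioo] with x hx
      rw [Real.norm_eq_abs, abs_mul]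
      exact mul_le_mul_of_nonneg_left (hB s hs x hx) (abs_nonneg _)
    · filter_upwards [ae_restrict_mem measurableSet_Ioo] with x hx
      exact (hc x hx t ht).const_mul _
  have h2 : Tendsto (fun s => ∫ x, (r s x - r t x) * g s x ∂(roadMeasure ℓ)) (𝓝[Icc 0 T] t)
      (𝓝 0) := by
    have := (h.cont t ht).mul_const B
    rw [zero_mul] at this
    refine squeeze_zero_norm' ?_ this
    filter_upwards [self_mem_nhdsWithin] with s hs
    rw [← integral_mul_const]
    refine (norm_integral_le_integral_norm _).trans ?_
    refine integral_mono_of_nonneg (.of_forall fun _ => norm_nonneg _)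
      (((h.integrable hs).sub (h.integrable ht)).abs.mul_const B) ?_
    filter_upwards [ae_restrict_mem measurableSet_Ioo] with x hx
    rw [norm_mul]
    exact mul_le_mul_of_nonneg_left (hB s hs x hx) (norm_nonneg _)
  have h3 := h1.add h2
  rw [add_zero] at h3
  refine h3.congr' ?_
  filter_upwards [self_mem_nhdsWithin] with s hs
  have j1 := h.integrable_mul ht (hg s hs) (hB s hs)
  have j2 := h.integrable_mul hs (hg s hs) (hB s hs)
  have j3 : Integrable (fun x => (r s x - r t x) * g s x) (roadMeasure ℓ) := by
    simp only [sub_mul]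
    exact j2.sub j1
  rw [← integral_add j1 j3]
  congr 1 with x
  ring

lemma IsCurve.continuousOn_integral (h : IsCurve T ℓ M r) :
    ContinuousOn (fun t => ∫ x, r t x ∂(roadMeasure ℓ)) (Icc 0 T) := by
  have := h.continuousOn_integral_mul (g := fun _ _ => 1) (B := 1)
    (fun _ _ => aestronglyMeasurable_const) (by simp) (fun _ _ => continuousOn_const)
  simpa only [mul_one] using this

lemma IsCurve.abs_integral_le (h : IsCurve T ℓ M r) {t : ℝ} (ht : t ∈ Icc 0 T) :
    |∫ x, r t x ∂(roadMeasure ℓ)| ≤ M * (roadMeasure ℓ).real univ := by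
  rw [← Real.norm_eq_abs]
  exact norm_integral_le_of_norm_le_const (h.bound t ht)

end Curve

/-- A positive bounded velocity field that is Lipschitz in space and constant to the left of the
road. -/
structure IsSpeed (a B : ℝ) (K : ℝ≥0) (w : ℝ → ℝ → ℝ) : Prop where
  pos : 0 < a
  cont : Continuous fun z : ℝ × ℝ => w z.1 z.2
  lower : ∀ t x, a ≤ w t x
  upper : ∀ t x, w t x ≤ B
  lip : ∀ t, LipschitzWith K (w t)
  left : ∀ t x, x ≤ 0 → w t x = w t 0

lemma IsSpeed.abs_le {a B : ℝ} {K : ℝ≥0} {w : ℝ → ℝ → ℝ} (h : IsSpeed a B K w) (t x : ℝ) :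
    |w t x| ≤ B := by
  rw [abs_of_pos (h.pos.trans_le (h.lower t x))]
  exact h.upper t x

/-! ### Uniqueness of weak solutions -/

/-- If `A' = B` weakly with zero initial value, then `A` is the primitive of `B`. -/
lemma eq_integral_of_forall_test {T : ℝ} (hT : 0 < T) {A B : ℝ → ℝ}
    (hA : ContinuousOn A (Icc 0 T)) (hB : ContinuousOn B (Icc 0 T))
    (h : ∀ α : ℝ → ℝ, ContDiff ℝ 1 α → α T = 0 →
      ∫ t in 0..T, (deriv α t * A t + α t * B t) = 0) :
    ∀ t ∈ Icc 0 T, A t = ∫ s in 0..t, B s := by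
  have huIcc : uIcc 0 T = Icc 0 T := uIcc_of_le hT.le
  -- Continuous extensions to the whole line are needed because the test function built from them
  -- must be `C¹` on all of `ℝ`.
  obtain ⟨A', hA'c, hA'⟩ : ∃ A' : ℝ → ℝ, Continuous A' ∧ ∀ t ∈ Icc 0 T, A' t = A t :=
    ⟨IccExtend hT.le ((Icc 0 T).domRestrict A),
      (continuousOn_iff_continuous_domRestrict.1 hA).Icc_extend',
      fun t ht => by rw [IccExtend_of_mem _ _ ht, domRestrict_apply]⟩
  obtain ⟨B', hB'c, hB'⟩ : ∃ B' : ℝ → ℝ, Continuous B' ∧ ∀ t ∈ Icc 0 T, B' t = B t :=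
    ⟨IccExtend hT.le ((Icc 0 T).domRestrict B),
      (continuousOn_iff_continuous_domRestrict.1 hB).Icc_extend',
      fun t ht => by rw [IccExtend_of_mem _ _ ht, domRestrict_apply]⟩
  have hPd : ∀ t, HasDerivAt (fun t => ∫ s in 0..t, B' s) (B' t) t := fun t =>
    intervalIntegral.integral_hasDerivAt_right (hB'c.intervalIntegrable _ _)
      (hB'c.stronglyMeasurableAtFilter _ _) hB'c.continuousAt
  set P : ℝ → ℝ := fun t => ∫ s in 0..t, B' s with hP
  have hPc : Continuous P := continuous_iff_continuousAt.2 fun t => (hPd t).continuousAt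
  -- The test function is the antiderivative of the defect `D` that vanishes at `T`. Integrating `α
  -- * P'` by parts, with boundary terms killed by `α T = 0` and `P 0 = 0`, turns the hypothesis
  -- into `∫ D² = 0`.
  set D : ℝ → ℝ := fun t => A' t - P t with hD
  have hDc : Continuous D := hA'c.sub hPc
  have hαd : ∀ t, HasDerivAt (fun t => ∫ s in T..t, D s) (D t) t := fun t =>
    intervalIntegral.integral_hasDerivAt_right (hDc.intervalIntegrable _ _)
      (hDc.stronglyMeasurableAtFilter _ _) hDc.continuousAt
  set α : ℝ → ℝ := fun t => ∫ s in T..t, D s with hα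
  have hdα : deriv α = D := funext fun t => (hαd t).deriv
  have hαc : ContDiff ℝ 1 α := contDiff_one_iff_deriv.2
    ⟨fun t => (hαd t).differentiableAt, hdα ▸ hDc⟩
  have hαT : α T = 0 := by simp [hα]
  have e1 := h α hαc hαT
  have e2 : ∫ t in 0..T, (deriv α t * A t + α t * B t) = ∫ t in 0..T, (D t * A' t + α t * B' t) := by
    refine intervalIntegral.integral_congr fun t ht => ?_
    rw [huIcc] at ht
    simp only [hdα, hA' t ht, hB' t ht]
  have e3 := intervalIntegral.integral_mul_deriv_eq_deriv_mul (a := 0) (b := T)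
    (fun t _ => hαd t) (fun t _ => hPd t) (hDc.intervalIntegrable _ _) (hB'c.intervalIntegrable _ _)
  have hP0 : P 0 = 0 := by simp [hP]
  have i1 : IntervalIntegrable (fun t => D t * A' t) volume 0 T := (hDc.mul hA'c).intervalIntegrable _ _
  have i2 : IntervalIntegrable (fun t => D t * P t) volume 0 T := (hDc.mul hPc).intervalIntegrable _ _
  have i3 : IntervalIntegrable (fun t => α t * B' t) volume 0 T :=
    (hαc.continuous.mul hB'c).intervalIntegrable _ _
  rw [hαT, hP0, zero_mul, mul_zero, sub_zero, zero_sub] at e3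
  have e4 : ∫ t in 0..T, D t * D t = 0 := by
    have : ∫ t in 0..T, D t * D t = (∫ t in 0..T, D t * A' t) - ∫ t in 0..T, D t * P t := by
      rw [← intervalIntegral.integral_sub i1 i2]
      congr 1 with t
      simp only [hD]
      ring
    rw [e2, intervalIntegral.integral_add i1 i3] at e1
    linarith
  intro t ht
  have hDt : D t = 0 := by
    by_contra hne
    have : 0 < ∫ t in 0..T, D t * D t :=
      intervalIntegral.integral_pos hT (hDc.mul hDc).continuousOn
        (fun x _ => mul_self_nonneg _) ⟨t, ht, mul_self_pos.2 hne⟩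
    linarith
  rw [← hA' t ht]
  have : A' t = P t := by simpa [hD, sub_eq_zero] using hDt
  rw [this, hP]
  refine intervalIntegral.integral_congr fun s hs => hB' s ?_
  rw [uIcc_of_le ht.1] at hs
  exact ⟨hs.1, hs.2.trans ht.2⟩

/-- The primitive of the density `r` on the road. -/
noncomputable def roadPrimitive (ℓ : ℝ) (r : ℝ → ℝ) (x : ℝ) : ℝ :=
  ∫ y in 0..x, (Ioo 0 ℓ).indicator r y

section Primitive
variable {ℓ M : ℝ} {r : ℝ → ℝ}

lemma continuous_roadPrimitive (hr : Integrable r (roadMeasure ℓ)) :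
    Continuous (roadPrimitive ℓ r) :=
  intervalIntegral.continuous_primitive
    (fun _ _ => ((integrable_indicator_iff measurableSet_Ioo).2 hr).intervalIntegrable) 0

lemma abs_roadPrimitive_le (hr : Integrable r (roadMeasure ℓ)) (x : ℝ) :
    |roadPrimitive ℓ r x| ≤ ∫ y, |r y| ∂(roadMeasure ℓ) := by
  have hi := (integrable_indicator_iff measurableSet_Ioo).2 hr
  calc |roadPrimitive ℓ r x| ≤ ∫ y in uIoc 0 x, ‖(Ioo 0 ℓ).indicator r y‖ :=
        by rw [roadPrimitive, ← Real.norm_eq_abs]; exact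
          intervalIntegral.norm_integral_le_integral_norm_uIoc
    _ ≤ ∫ y, |(Ioo 0 ℓ).indicator r y| :=
        setIntegral_le_integral hi.abs (.of_forall fun _ => abs_nonneg _)
    _ = ∫ y, |r y| ∂(roadMeasure ℓ) := by
        rw [← integral_indicator measurableSet_Ioo]
        congr 1 with y
        by_cases hy : y ∈ Ioo 0 ℓ <;> simp [hy]

lemma absolutelyContinuous_roadPrimitive (hℓ : 0 ≤ ℓ) (hr : Integrable r (roadMeasure ℓ)) :
    AbsolutelyContinuousOnInterval (roadPrimitive ℓ r) 0 ℓ :=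
  IntervalIntegrable.absolutelyContinuousOnInterval_intervalIntegral
    ((integrable_indicator_iff measurableSet_Ioo).2 hr).intervalIntegrable (by simp [hℓ])

lemma ae_hasDerivAt_roadPrimitive (hℓ : 0 ≤ ℓ) (hr : Integrable r (roadMeasure ℓ)) :
    ∀ᵐ x ∂(roadMeasure ℓ), HasDerivAt (roadPrimitive ℓ r) (r x) x := by
  have h := IntervalIntegrable.ae_hasDerivAt_integral (a := 0) (b := ℓ)
    ((integrable_indicator_iff measurableSet_Ioo).2 hr).intervalIntegrable
  rw [ae_restrict_iff' measurableSet_Ioo]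
  filter_upwards [h] with x hx hxm
  have := hx (by rw [uIcc_of_le hℓ]; exact Ioo_subset_Icc_self hxm) 0 (by simp)
  rwa [indicator_of_mem hxm] at this

lemma roadPrimitive_zero : roadPrimitive ℓ r 0 = 0 := by simp [roadPrimitive]

lemma integral_mul_primitive (hℓ : 0 ≤ ℓ) (hr : Integrable r (roadMeasure ℓ)) {β γ : ℝ → ℝ}
    (hβ : ∀ x, HasDerivAt β (γ x) x) (hγ : Continuous γ) (hβℓ : β ℓ = 0) :
    ∫ x, r x * β x ∂(roadMeasure ℓ) = - ∫ x, roadPrimitive ℓ r x * γ x ∂(roadMeasure ℓ) := by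
  have hd : deriv β = γ := funext fun x => (hβ x).deriv
  have hβc : ContDiff ℝ 1 β := contDiff_one_iff_deriv.2
    ⟨fun t => (hβ t).differentiableAt, hd ▸ hγ⟩
  have h := AbsolutelyContinuousOnInterval.integral_mul_deriv_eq_deriv_mul
    (hβc.contDiffOn.absolutelyContinuousOnInterval) (absolutelyContinuous_roadPrimitive hℓ hr)
  rw [hβℓ, roadPrimitive_zero, zero_mul, mul_zero, sub_zero, zero_sub, intervalIntegral_eq_road hℓ,
    intervalIntegral_eq_road hℓ, hd] at h
  calc ∫ x, r x * β x ∂(roadMeasure ℓ)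
      = ∫ x, β x * deriv (roadPrimitive ℓ r) x ∂(roadMeasure ℓ) := by
        refine integral_congr_ae ?_
        filter_upwards [ae_hasDerivAt_roadPrimitive hℓ hr] with x hx
        rw [hx.deriv, mul_comm]
    _ = _ := by
        rw [h]
        simp only [mul_comm]

/-- Since `r = Q'` almost everywhere, the left side is `-∫ w (Q²)'`. Integration by parts gives `∫
w' Q² - w(ℓ) Q(ℓ)²`: the entry term vanishes because `Q 0 = 0`, the exit term has the favourable
sign, and `|w'| ≤ K`. -/
lemma energy_flux_le (hℓ : 0 ≤ ℓ) (hr : Integrable r (roadMeasure ℓ)) {w : ℝ → ℝ} {K : ℝ≥0}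
    (hw : LipschitzWith K w) (hw0 : 0 ≤ w ℓ) :
    -(2 * ∫ x, r x * (w x * roadPrimitive ℓ r x) ∂(roadMeasure ℓ))
      ≤ K * ∫ x, roadPrimitive ℓ r x ^ 2 ∂(roadMeasure ℓ) := by
  set Q := roadPrimitive ℓ r with hQ
  have hQc : Continuous Q := continuous_roadPrimitive hr
  have hac := absolutelyContinuous_roadPrimitive hℓ hr
  have h := AbsolutelyContinuousOnInterval.integral_mul_deriv_eq_deriv_mul
    (hw.lipschitzOnWith.absolutelyContinuousOnInterval (a := 0) (b := ℓ)) (hac.mul hac)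
  simp only [Pi.mul_apply, ← hQ] at h
  rw [intervalIntegral_eq_road hℓ, intervalIntegral_eq_road hℓ,
    show Q 0 = 0 from roadPrimitive_zero, mul_zero, mul_zero, sub_zero] at h
  have e : ∫ x, w x * deriv (Q * Q) x ∂(roadMeasure ℓ)
      = 2 * ∫ x, r x * (w x * Q x) ∂(roadMeasure ℓ) := by
    rw [← integral_const_mul]
    refine integral_congr_ae ?_
    filter_upwards [ae_hasDerivAt_roadPrimitive hℓ hr] with x hx
    rw [(hx.mul hx).deriv]
    simp only [← hQ]
    ring
  rw [← e, h, ← integral_const_mul]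
  have hb : ∫ x, deriv w x * (Q x * Q x) ∂(roadMeasure ℓ)
      ≤ ∫ x, K * Q x ^ 2 ∂(roadMeasure ℓ) := by
    have i2 : Integrable (fun x => K * Q x ^ 2) (roadMeasure ℓ) :=
      (((by fun_prop : Continuous fun x => (K : ℝ) * Q x ^ 2).integrableOn_Icc
        (a := 0) (b := ℓ)).mono_set Ioo_subset_Icc_self)
    have hle : ∀ x, |deriv w x * (Q x * Q x)| ≤ K * Q x ^ 2 := fun x => by
      rw [abs_mul, abs_mul_self, ← pow_two]
      exact mul_le_mul_of_nonneg_right (norm_deriv_le_of_lipschitz hw) (sq_nonneg _)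
    have i1 : Integrable (fun x => deriv w x * (Q x * Q x)) (roadMeasure ℓ) :=
      i2.mono' ((measurable_deriv w).mul (hQc.mul hQc).measurable).aestronglyMeasurable
        (.of_forall hle)
    exact integral_mono i1 i2 fun x => (le_abs_self _).trans (hle x)
  have : 0 ≤ w ℓ * (Q ℓ * Q ℓ) := mul_nonneg hw0 (mul_self_nonneg _)
  linarith

lemma ae_eq_zero_of_roadPrimitive (hℓ : 0 ≤ ℓ) (hr : Integrable r (roadMeasure ℓ))
    (h : ∫ x, roadPrimitive ℓ r x ^ 2 ∂(roadMeasure ℓ) ≤ 0) : ∀ᵐ x ∂(roadMeasure ℓ), r x = 0 := by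
  set Q := roadPrimitive ℓ r with hQ
  have hQc : Continuous Q := continuous_roadPrimitive hr
  have h0 : ∀ x ∈ Icc 0 ℓ, Q x = 0 := by
    intro x hx
    by_contra hne
    have hℓ' : 0 < ℓ := by
      rcases hℓ.lt_or_eq with h | h
      · exact h
      · exfalso
        have : x = 0 := le_antisymm (h ▸ hx.2) hx.1
        exact hne (by rw [this, hQ, roadPrimitive_zero])
    have := intervalIntegral.integral_pos hℓ' (f := fun x => Q x ^ 2) (by fun_prop)
      (fun x _ => sq_nonneg _) ⟨x, hx, by positivity⟩
    rw [intervalIntegral_eq_road hℓ] at this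
    linarith
  filter_upwards [ae_hasDerivAt_roadPrimitive hℓ hr, ae_restrict_mem measurableSet_Ioo] with x h1 h2
  have h3 : HasDerivAt Q 0 x := by
    refine (hasDerivAt_const x (0 : ℝ)).congr_of_eventuallyEq ?_
    filter_upwards [isOpen_Ioo.mem_nhds h2] with y hy using h0 y (Ioo_subset_Icc_self hy)
  exact h1.unique h3

end Primitive

/-- A weak solution with zero data. -/
def IsWeakNull (T ℓ : ℝ) (w r : ℝ → ℝ → ℝ) : Prop :=
  ∀ φ : ℝ × ℝ → ℝ, ContDiff ℝ 1 φ →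
    (∀ x ∈ Icc 0 ℓ, φ (T, x) = 0) → (∀ t ∈ Icc 0 T, φ (t, ℓ) = 0) →
    ∫ t in 0..T, ∫ x in 0..ℓ,
        r t x * (fderiv ℝ φ (t, x) (1, 0) + w t x * fderiv ℝ φ (t, x) (0, 1)) = 0

lemma exists_bound_on_road (ℓ : ℝ) {g : ℝ → ℝ} (hg : Continuous g) :
    ∃ B, ∀ x ∈ Ioo 0 ℓ, |g x| ≤ B := by
  obtain ⟨B, hB⟩ := isCompact_Icc.exists_bound_of_continuousOn (hg.continuousOn (s := Icc 0 ℓ))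
  exact ⟨B, fun x hx => hB x (Ioo_subset_Icc_self hx)⟩

section Uniqueness
variable {T ℓ M a B : ℝ} {K : ℝ≥0} {r w : ℝ → ℝ → ℝ}

lemma IsCurve.continuousOn_flux (hr : IsCurve T ℓ M r) (hw : IsSpeed a B K w) {γ : ℝ → ℝ}
    (hγ : Continuous γ) :
    ContinuousOn (fun t => ∫ x, r t x * (w t x * γ x) ∂(roadMeasure ℓ)) (Icc 0 T) := by
  obtain ⟨G, hG⟩ := exists_bound_on_road ℓ hγ
  have hwt : ∀ t, Continuous (w t) := fun t => (hw.lip t).continuous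
  refine hr.continuousOn_integral_mul (B := B * G)
    (fun t _ => ((hwt t).mul hγ).aestronglyMeasurable) (fun t _ x hx => ?_) fun x _ => ?_
  · rw [abs_mul]
    exact mul_le_mul (hw.abs_le t x) (hG x hx) (abs_nonneg _) ((abs_nonneg _).trans (hw.abs_le t x))
  · have : Continuous fun t => w t x := hw.cont.comp (by fun_prop : Continuous fun t : ℝ => (t, x))
    exact (this.mul continuous_const).continuousOn

lemma IsCurve.integrable_flux (hr : IsCurve T ℓ M r) (hw : IsSpeed a B K w) {γ : ℝ → ℝ}
    (hγ : Continuous γ) {t : ℝ} (ht : t ∈ Icc 0 T) :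
    Integrable (fun x => r t x * (w t x * γ x)) (roadMeasure ℓ) := by
  have hwt : Continuous (w t) := (hw.lip t).continuous
  obtain ⟨G, hG⟩ := exists_bound_on_road ℓ (hwt.mul hγ)
  exact hr.integrable_mul ht (hwt.mul hγ).aestronglyMeasurable hG

/-- Product test functions `α(t) β(x)` reduce the weak equation to a weak ordinary differential
equation for `∫ r β`. No condition on `β` at the entry is needed, because the inflow is zero. -/
lemma IsWeakNull.integral_mul_eq (hT : 0 < T) (hℓ : 0 ≤ ℓ) (hr : IsCurve T ℓ M r)
    (hw : IsSpeed a B K w) (h : IsWeakNull T ℓ w r) {β γ : ℝ → ℝ}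
    (hβ : ∀ x, HasDerivAt β (γ x) x) (hγ : Continuous γ) (hβℓ : β ℓ = 0) :
    ∀ t ∈ Icc 0 T, ∫ x, r t x * β x ∂(roadMeasure ℓ)
      = ∫ s in 0..t, ∫ x, r s x * (w s x * γ x) ∂(roadMeasure ℓ) := by
  have hd : deriv β = γ := funext fun x => (hβ x).deriv
  have hβ1 : ContDiff ℝ 1 β := contDiff_one_iff_deriv.2
    ⟨fun t => (hβ t).differentiableAt, hd ▸ hγ⟩
  obtain ⟨G, hG⟩ := exists_bound_on_road ℓ hβ1.continuous
  refine eq_integral_of_forall_test hT ?_ (hr.continuousOn_flux hw hγ) fun α hα hαT => ?_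
  · exact hr.continuousOn_integral_mul (fun t _ => hβ1.continuous.aestronglyMeasurable)
      (fun t _ => hG) fun x _ => continuousOn_const
  · have hφ : ContDiff ℝ 1 fun z : ℝ × ℝ => α z.1 * β z.2 :=
      (hα.comp contDiff_fst).mul (hβ1.comp contDiff_snd)
    have hf : ∀ t x, HasFDerivAt (fun z : ℝ × ℝ => α z.1 * β z.2)
        (α t • (γ x • ContinuousLinearMap.snd ℝ ℝ ℝ)
          + β x • (deriv α t • ContinuousLinearMap.fst ℝ ℝ ℝ)) (t, x) := by
      intro t x
      have h1 : HasFDerivAt (fun z : ℝ × ℝ => α z.1) (deriv α t • ContinuousLinearMap.fst ℝ ℝ ℝ)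
          (t, x) :=
        ((hα.differentiable one_ne_zero t).hasDerivAt).comp_hasFDerivAt (t, x)
          (hasFDerivAt_fst (𝕜 := ℝ) (p := ((t, x) : ℝ × ℝ)))
      have h2 : HasFDerivAt (fun z : ℝ × ℝ => β z.2) (γ x • ContinuousLinearMap.snd ℝ ℝ ℝ)
          (t, x) := (hβ x).comp_hasFDerivAt (t, x)
          (hasFDerivAt_snd (𝕜 := ℝ) (p := ((t, x) : ℝ × ℝ)))
      exact h1.mul h2
    have := h _ hφ (fun x _ => by simp [hαT]) (fun t _ => by simp [hβℓ])
    refine Eq.trans ?_ this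
    refine intervalIntegral.integral_congr fun t ht => ?_
    rw [uIcc_of_le hT.le] at ht
    simp only [(hf t _).fderiv]
    rw [intervalIntegral_eq_road hℓ, ← integral_const_mul (deriv α t), ← integral_const_mul (α t),
      ← integral_add ((hr.integrable_mul ht hβ1.continuous.aestronglyMeasurable hG).const_mul _)
        ((hr.integrable_flux hw hγ ht).const_mul _)]
    congr 1 with x
    simp
    ring

/-- This is `∂ₜ Q = -w r` in integrated form. Taking for `β` the antiderivative of `γ` vanishing at
`ℓ` frees `γ` from any boundary condition, so that `Q` itself may be used as a test function. -/
lemma IsWeakNull.integral_primitive_mul (hT : 0 < T) (hℓ : 0 ≤ ℓ) (hr : IsCurve T ℓ M r)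
    (hw : IsSpeed a B K w) (h : IsWeakNull T ℓ w r) {γ : ℝ → ℝ} (hγ : Continuous γ) :
    ∀ t ∈ Icc 0 T, ∫ x, roadPrimitive ℓ (r t) x * γ x ∂(roadMeasure ℓ)
      = -∫ s in 0..t, ∫ x, r s x * (w s x * γ x) ∂(roadMeasure ℓ) := by
  intro t ht
  have hβ : ∀ x, HasDerivAt (fun x => ∫ y in ℓ..x, γ y) (γ x) x := fun x =>
    intervalIntegral.integral_hasDerivAt_right (hγ.intervalIntegrable _ _)
      (hγ.stronglyMeasurableAtFilter _ _) hγ.continuousAt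
  rw [← h.integral_mul_eq hT hℓ hr hw hβ hγ (by simp) t ht,
    integral_mul_primitive hℓ (hr.integrable ht) hβ hγ (by simp), neg_neg]

lemma IsCurve.abs_roadPrimitive_sub_le (hr : IsCurve T ℓ M r) {s t : ℝ} (hs : s ∈ Icc 0 T)
    (ht : t ∈ Icc 0 T) (x : ℝ) :
    |roadPrimitive ℓ (r t) x - roadPrimitive ℓ (r s) x|
      ≤ ∫ y, |r t y - r s y| ∂(roadMeasure ℓ) := by
  have := abs_roadPrimitive_le ((hr.integrable ht).sub (hr.integrable hs)) x
  have e : roadPrimitive ℓ (r t - r s) x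
      = roadPrimitive ℓ (r t) x - roadPrimitive ℓ (r s) x := by
    unfold roadPrimitive
    rw [← intervalIntegral.integral_sub]
    · simp only [indicator_sub']
      rfl
    · exact ((integrable_indicator_iff measurableSet_Ioo).2 (hr.integrable ht)).intervalIntegrable
    · exact ((integrable_indicator_iff measurableSet_Ioo).2 (hr.integrable hs)).intervalIntegrable
  rwa [e] at this

lemma IsCurve.abs_flux_le (hr : IsCurve T ℓ M r) (hw : IsSpeed a B K w) {γ : ℝ → ℝ} {δ : ℝ}
    (hδ : ∀ x, |γ x| ≤ δ) {t : ℝ} (ht : t ∈ Icc 0 T) :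
    |∫ x, r t x * (w t x * γ x) ∂(roadMeasure ℓ)| ≤ M * (B * δ) * (roadMeasure ℓ).real univ := by
  rw [← Real.norm_eq_abs]
  refine norm_integral_le_of_norm_le_const ?_
  filter_upwards [hr.bound t ht] with x hx
  rw [norm_mul, norm_mul]
  have hB := hw.abs_le t x
  exact mul_le_mul hx (mul_le_mul hB (hδ x) (abs_nonneg _) ((abs_nonneg _).trans hB))
    (by positivity) ((abs_nonneg _).trans hx)

/-- The test function must not depend on time, so `Q s` is frozen and `∫ Q_t²` is written as `2 ∫
Q_t Q_s - ∫ Q_s² + ∫ (Q_t - Q_s)²`. The first term is differentiable by the fundamental theorem of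
calculus. Testing with `Q_t - Q_s` bounds the last by a constant times `|t - s|` and the `L¹`
distance of `r t` and `r s`, hence it is `o(|t - s|)`. -/
lemma IsWeakNull.hasDerivWithinAt_energy (hT : 0 < T) (hℓ : 0 ≤ ℓ) (hr : IsCurve T ℓ M r)
    (hw : IsSpeed a B K w) (h : IsWeakNull T ℓ w r) {s : ℝ} (hs : s ∈ Icc 0 T) :
    HasDerivWithinAt (fun t => ∫ x, roadPrimitive ℓ (r t) x ^ 2 ∂(roadMeasure ℓ))
      (-(2 * ∫ x, r s x * (w s x * roadPrimitive ℓ (r s) x) ∂(roadMeasure ℓ))) (Icc 0 T) s := by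
  have hQc : ∀ {t}, t ∈ Icc 0 T → Continuous (roadPrimitive ℓ (r t)) := fun ht =>
    continuous_roadPrimitive (hr.integrable ht)
  set Q : ℝ → ℝ → ℝ := fun t => roadPrimitive ℓ (r t) with hQ
  have hint : ∀ {g : ℝ → ℝ}, Continuous g → Integrable g (roadMeasure ℓ) := fun hg =>
    (hg.integrableOn_Icc (a := 0) (b := ℓ)).mono_set Ioo_subset_Icc_self
  set H : ℝ → ℝ := fun τ => ∫ x, r τ x * (w τ x * Q s x) ∂(roadMeasure ℓ) with hH
  have hHc : ContinuousOn H (Icc 0 T) := hr.continuousOn_flux hw (hQc hs)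
  have hF : HasDerivWithinAt (fun t => ∫ τ in 0..t, H τ) (H s) (Icc 0 T) s := by
    have : Fact (s ∈ Icc 0 T) := ⟨hs⟩
    refine intervalIntegral.integral_hasDerivWithinAt_right (t := Icc 0 T) ?_ ?_ (hHc s hs)
    · refine (hHc.mono ?_).intervalIntegrable
      rw [uIcc_of_le hs.1]
      exact Icc_subset_Icc_right hs.2
    · exact hHc.stronglyMeasurableAtFilter_nhdsWithin measurableSet_Icc s
  have hG : HasDerivWithinAt (fun t => ∫ x, (Q t x - Q s x) ^ 2 ∂(roadMeasure ℓ)) 0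
      (Icc 0 T) s := by
    rw [hasDerivWithinAt_iff_isLittleO]
    simp only [sub_self, smul_zero, sub_zero]
    set C := M * B * (roadMeasure ℓ).real univ with hC
    set δ : ℝ → ℝ := fun t => ∫ y, |r t y - r s y| ∂(roadMeasure ℓ) with hδ
    have hδ0 : Tendsto (fun t => C * δ t) (𝓝[Icc 0 T] s) (𝓝 0) := by
      simpa using (hr.cont s hs).const_mul C
    have key : ∀ t ∈ Icc 0 T, |∫ x, (Q t x - Q s x) ^ 2 ∂(roadMeasure ℓ)|
        ≤ C * δ t * |t - s| := by
      intro t ht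
      have hγ : Continuous fun x => Q t x - Q s x := (hQc ht).sub (hQc hs)
      have e : ∫ x, (Q t x - Q s x) ^ 2 ∂(roadMeasure ℓ)
          = -∫ τ in s..t, ∫ x, r τ x * (w τ x * (Q t x - Q s x)) ∂(roadMeasure ℓ) := by
        have e1 := h.integral_primitive_mul hT hℓ hr hw hγ t ht
        have e2 := h.integral_primitive_mul hT hℓ hr hw hγ s hs
        have hc := hr.continuousOn_flux hw hγ
        rw [← intervalIntegral.integral_interval_sub_left (a := 0) (b := t) (c := s), neg_sub]
        · have : ∀ x, (Q t x - Q s x) ^ 2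
            = Q t x * (Q t x - Q s x) - Q s x * (Q t x - Q s x) := fun x => by ring
          simp only [this]
          have i1 : Integrable (fun x => Q t x * (Q t x - Q s x)) (roadMeasure ℓ) :=
            hint ((hQc ht).mul hγ)
          have i2 : Integrable (fun x => Q s x * (Q t x - Q s x)) (roadMeasure ℓ) :=
            hint ((hQc hs).mul hγ)
          rw [integral_sub i1 i2]
          simp only [hQ] at e1 e2 ⊢
          rw [e1, e2]
          ring
        · refine (hc.mono ?_).intervalIntegrable
          rw [uIcc_of_le ht.1]
          exact Icc_subset_Icc_right ht.2
        · refine (hc.mono ?_).intervalIntegrable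
          rw [uIcc_of_le hs.1]
          exact Icc_subset_Icc_right hs.2
      rw [e, abs_neg, ← Real.norm_eq_abs]
      refine intervalIntegral.norm_integral_le_of_norm_le_const fun τ hτ => ?_
      have hτ' : τ ∈ Icc 0 T := by
        have := uIoc_subset_uIcc hτ
        exact (ordConnected_Icc.uIcc_subset hs ht) this
      have := hr.abs_flux_le hw (hr.abs_roadPrimitive_sub_le hs ht) hτ'
      refine this.trans (le_of_eq ?_)
      simp only [hC, hδ]
      ring
    rw [Asymptotics.isLittleO_iff]
    intro c hc
    have hG0 : ∫ x, (Q s x - Q s x) ^ 2 ∂(roadMeasure ℓ) = 0 := by simp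
    filter_upwards [self_mem_nhdsWithin, hδ0.eventually_lt_const hc] with t ht htc
    simp only [ne_eq, OfNat.ofNat_ne_zero, not_false_eq_true, zero_pow, integral_zero,
      sub_zero, Real.norm_eq_abs]
    exact (key t ht).trans (mul_le_mul_of_nonneg_right htc.le (abs_nonneg _))
  have hsum := ((hF.const_mul (-2)).add_const (-∫ x, Q s x ^ 2 ∂(roadMeasure ℓ))).add hG
  have hval : -2 * H s + 0
      = -(2 * ∫ x, r s x * (w s x * Q s x) ∂(roadMeasure ℓ)) := by simp [hH]
  rw [hval] at hsum
  have hE : ∀ t ∈ Icc 0 T, ∫ x, Q t x ^ 2 ∂(roadMeasure ℓ) = -2 * (∫ τ in 0..t, H τ)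
      + -∫ x, Q s x ^ 2 ∂(roadMeasure ℓ) + ∫ x, (Q t x - Q s x) ^ 2 ∂(roadMeasure ℓ) := by
    intro t ht
    have e1 := h.integral_primitive_mul hT hℓ hr hw (hQc hs) t ht
    have e2 : ∫ τ in 0..t, H τ = -∫ x, Q t x * Q s x ∂(roadMeasure ℓ) := by
      rw [hQ, e1, neg_neg]
    rw [e2]
    have : ∀ x, (Q t x - Q s x) ^ 2 = Q t x ^ 2 + Q s x ^ 2 - 2 * (Q t x * Q s x) := fun x => by
      ring
    simp only [this]
    rw [integral_sub, integral_add, integral_const_mul]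
    · ring
    · exact hint ((hQc ht).pow 2)
    · exact hint ((hQc hs).pow 2)
    · exact hint (((hQc ht).pow 2).add ((hQc hs).pow 2))
    · exact hint (((hQc ht).mul (hQc hs)).const_mul 2)
  exact hsum.congr (fun t ht => hE t ht) (hE s hs)

/-- The energy satisfies `E' ≤ K E` with `E 0 = 0`, so Grönwall forces the primitive, and then the
density, to vanish. -/
theorem IsWeakNull.ae_eq_zero (hT : 0 < T) (hℓ : 0 ≤ ℓ) (hr : IsCurve T ℓ M r)
    (hw : IsSpeed a B K w) (h : IsWeakNull T ℓ w r) {t : ℝ} (ht : t ∈ Icc 0 T) :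
    ∀ᵐ x ∂(roadMeasure ℓ), r t x = 0 := by
  set E : ℝ → ℝ := fun t => ∫ x, roadPrimitive ℓ (r t) x ^ 2 ∂(roadMeasure ℓ) with hE
  have hd := fun {s} (hs : s ∈ Icc 0 T) => h.hasDerivWithinAt_energy hT hℓ hr hw hs
  have h0 : E 0 ≤ 0 := by
    -- At time `0` the time integral is empty; testing with the primitive of `r 0` itself shows that
    -- the initial energy is zero.
    have := h.integral_primitive_mul hT hℓ hr hw
      (continuous_roadPrimitive (hr.integrable (left_mem_Icc.2 hT.le))) 0 (left_mem_Icc.2 hT.le)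
    simp only [hE, pow_two]
    rw [this]
    simp
  have hg := le_gronwallBound_of_liminf_deriv_right_le (f := E) (δ := 0) (K := K) (ε := 0)
    (fun s hs => (hd hs).continuousWithinAt) (fun s hs c hc => by
      have h1 := (hd (Ico_subset_Icc_self hs)).mono_of_mem_nhdsWithin
        (Icc_mem_nhdsGE_of_mem hs)
      simpa [slope_def_field, div_eq_inv_mul] using h1.liminf_right_slope_le hc) h0
    (fun s hs => by
      rw [add_zero]
      exact energy_flux_le hℓ (hr.integrable (Ico_subset_Icc_self hs)) (hw.lip s)
        (hw.pos.le.trans (hw.lower s ℓ))) t ht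
  rw [gronwallBound_ε0_δ0] at hg
  exact ae_eq_zero_of_roadPrimitive hℓ (hr.integrable ht) hg

end Uniqueness

/-! ### Characteristics -/

/-- `X` is an integral curve of `w` on `[0,T]`. -/
def IsTrajectory (T : ℝ) (w : ℝ → ℝ → ℝ) (X : ℝ → ℝ) : Prop :=
  ∀ t ∈ Icc 0 T, HasDerivAt X (w t (X t)) t

section Flow
variable {T a B : ℝ} {K : ℝ≥0} {w w' : ℝ → ℝ → ℝ}

lemma IsSpeed.nonneg_upper (hw : IsSpeed a B K w) : 0 ≤ B :=
  (abs_nonneg _).trans (hw.abs_le 0 0)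

lemma IsSpeed.continuous_left (hw : IsSpeed a B K w) (x : ℝ) : Continuous fun t => w t x :=
  hw.cont.comp (by fun_prop : Continuous fun t : ℝ => (t, x))

lemma IsSpeed.exists_trajectory (hw : IsSpeed a B K w) (hT : 0 < T) (y : ℝ) :
    ∃ X : ℝ → ℝ, X 0 = y ∧ IsTrajectory T w X := by
  -- The larger interval `[-1, T+1]` makes the derivatives at `0` and `T` two-sided. No point of it
  -- is further than `T + 1` from time `0`, so the ball of radius `B * (T + 1)` suffices.
  have h0 : (0 : ℝ) ∈ Icc (-1) (T + 1) := ⟨by norm_num, by linarith⟩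
  have hp : IsPicardLindelof w (⟨0, h0⟩ : Icc (-1 : ℝ) (T + 1)) y
      (⟨B * (T + 1), mul_nonneg hw.nonneg_upper (by linarith)⟩ : ℝ≥0) 0 ⟨B, hw.nonneg_upper⟩ K := by
    refine ⟨fun t _ => (hw.lip t).lipschitzOnWith, fun x _ => (hw.continuous_left x).continuousOn,
      fun t _ x _ => hw.abs_le t x, ?_⟩
    simp only [NNReal.coe_zero, sub_zero]
    refine mul_le_mul_of_nonneg_left (max_le le_rfl ?_) hw.nonneg_upper
    linarith
  obtain ⟨X, hX0, hX⟩ := hp.exists_eq_forall_mem_Icc_hasDerivWithinAt (x := y) (by simp)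
  exact ⟨X, hX0, fun t ht => (hX t ⟨by linarith [ht.1], by linarith [ht.2]⟩).hasDerivAt
    (Icc_mem_nhds (by linarith [ht.1]) (by linarith [ht.2]))⟩

lemma IsTrajectory.continuousOn {X : ℝ → ℝ} (h : IsTrajectory T w X) :
    ContinuousOn X (Icc 0 T) := fun t ht => (h t ht).continuousAt.continuousWithinAt

lemma IsTrajectory.dist_le_forward {X X' : ℝ → ℝ} (hw : ∀ t, LipschitzWith K (w t))
    (h : IsTrajectory T w X) (h' : IsTrajectory T w X') {s t : ℝ} (hs : 0 ≤ s) (hst : s ≤ t)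
    (ht : t ≤ T) : |X t - X' t| ≤ |X s - X' s| * Real.exp (K * (t - s)) :=
  dist_le_of_trajectories_ODE hw (h.continuousOn.mono (Icc_subset_Icc hs ht))
    (fun τ hτ => (h τ ⟨hs.trans hτ.1, hτ.2.le.trans ht⟩).hasDerivWithinAt)
    (h'.continuousOn.mono (Icc_subset_Icc hs ht))
    (fun τ hτ => (h' τ ⟨hs.trans hτ.1, hτ.2.le.trans ht⟩).hasDerivWithinAt) le_rfl t
    ⟨hst, le_rfl⟩

/-- Reversing time, `τ ↦ X (t - τ)` follows the field `-w (t - τ)`, which has the same Lipschitz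
constant, so the forward estimate applies. -/
lemma IsTrajectory.dist_le_backward {X X' : ℝ → ℝ} (hw : ∀ t, LipschitzWith K (w t))
    (h : IsTrajectory T w X) (h' : IsTrajectory T w X') {s t : ℝ} (hs : 0 ≤ s) (hst : s ≤ t)
    (ht : t ≤ T) : |X s - X' s| ≤ |X t - X' t| * Real.exp (K * (t - s)) := by
  have hrev : ∀ {Y : ℝ → ℝ}, IsTrajectory T w Y → ∀ τ ∈ Icc 0 (t - s),
      HasDerivAt (fun τ => Y (t - τ)) (-w (t - τ) (Y (t - τ))) τ := by
    intro Y hY τ hτ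
    have hm : t - τ ∈ Icc 0 T := ⟨by linarith [hτ.2], by linarith [hτ.1]⟩
    have := (hY (t - τ) hm).comp τ ((hasDerivAt_id τ).const_sub t)
    simpa [Function.comp_def] using this
  have hlip : ∀ τ, LipschitzWith K (fun x => -w (t - τ) x) := fun τ => (hw (t - τ)).neg
  have := dist_le_of_trajectories_ODE (v := fun τ x => -w (t - τ) x) (a := 0) (b := t - s) hlip
    (fun τ hτ => (hrev h τ hτ).continuousAt.continuousWithinAt)
    (fun τ hτ => (hrev h τ (Ico_subset_Icc_self hτ)).hasDerivWithinAt)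
    (fun τ hτ => (hrev h' τ hτ).continuousAt.continuousWithinAt)
    (fun τ hτ => (hrev h' τ (Ico_subset_Icc_self hτ)).hasDerivWithinAt) le_rfl (t - s)
    ⟨sub_nonneg.2 hst, le_rfl⟩
  simpa [Real.dist_eq] using this

lemma IsTrajectory.dist_le_of_approx {X X' : ℝ → ℝ} {ε : ℝ} (hw : ∀ t, LipschitzWith K (w t))
    (h : IsTrajectory T w X) (h' : IsTrajectory T w' X')
    (hε : ∀ t ∈ Icc 0 T, ∀ x, |w' t x - w t x| ≤ ε) {t : ℝ} (ht : t ∈ Icc 0 T) :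
    |X t - X' t| ≤ gronwallBound |X 0 - X' 0| K ε t := by
  have := dist_le_of_approx_trajectories_ODE (a := 0) (b := T) (εf := 0) (εg := ε)
    (δ := |X 0 - X' 0|) hw h.continuousOn
    (fun τ hτ => (h τ (Ico_subset_Icc_self hτ)).hasDerivWithinAt)
    (fun τ _ => by simp) h'.continuousOn
    (fun τ hτ => (h' τ (Ico_subset_Icc_self hτ)).hasDerivWithinAt)
    (fun τ hτ => hε τ (Ico_subset_Icc_self hτ) _) le_rfl t ht
  simpa [Real.dist_eq] using this

lemma IsTrajectory.sub_mem {X : ℝ → ℝ} (hw : IsSpeed a B K w) (h : IsTrajectory T w X) {s t : ℝ}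
    (hs : 0 ≤ s) (hst : s ≤ t) (ht : t ≤ T) :
    a * (t - s) ≤ X t - X s ∧ X t - X s ≤ B * (t - s) := by
  have hD : ∀ τ ∈ Icc s t, τ ∈ Icc 0 T := fun τ hτ => ⟨hs.trans hτ.1, hτ.2.trans ht⟩
  constructor
  · refine (convex_Icc s t).mul_sub_le_image_sub_of_le_deriv (h.continuousOn.mono hD)
      (fun τ hτ => ?_) (fun τ hτ => ?_) s ⟨le_rfl, hst⟩ t ⟨hst, le_rfl⟩ hst
    · exact (h τ (hD τ (interior_subset hτ))).differentiableAt.differentiableWithinAt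
    · rw [(h τ (hD τ (interior_subset hτ))).deriv]
      exact hw.lower _ _
  · refine (convex_Icc s t).image_sub_le_mul_sub_of_deriv_le (h.continuousOn.mono hD)
      (fun τ hτ => ?_) (fun τ hτ => ?_) s ⟨le_rfl, hst⟩ t ⟨hst, le_rfl⟩ hst
    · exact (h τ (hD τ (interior_subset hτ))).differentiableAt.differentiableWithinAt
    · rw [(h τ (hD τ (interior_subset hτ))).deriv]
      exact hw.upper _ _

/-- The integral curve of `w` on `[0,T]` through `y` at time `0`. -/
noncomputable def flow (T : ℝ) (w : ℝ → ℝ → ℝ) (y : ℝ) : ℝ → ℝ :=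
  open Classical in
  if h : ∃ X : ℝ → ℝ, X 0 = y ∧ IsTrajectory T w X then h.choose else fun _ => y

lemma IsSpeed.flow_zero (hw : IsSpeed a B K w) (hT : 0 < T) (y : ℝ) : flow T w y 0 = y := by
  have h := hw.exists_trajectory hT y
  rw [flow, dif_pos h]
  exact h.choose_spec.1

lemma IsSpeed.isTrajectory_flow (hw : IsSpeed a B K w) (hT : 0 < T) (y : ℝ) :
    IsTrajectory T w (flow T w y) := by
  have h := hw.exists_trajectory hT y
  rw [flow, dif_pos h]
  exact h.choose_spec.2

/-- The position at time `0` of the characteristic with label `y`: labels `y ≥ 0` sit at `y`, a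
label `y < 0` enters the road at time `-y`. -/
noncomputable def startPoint (w : ℝ → ℝ → ℝ) (y : ℝ) : ℝ :=
  max y 0 - ∫ s in 0..max (-y) 0, w s 0

lemma IsSpeed.intervalIntegrable (hw : IsSpeed a B K w) (x s t : ℝ) :
    IntervalIntegrable (fun τ => w τ x) volume s t :=
  (hw.continuous_left x).intervalIntegrable _ _

lemma IsSpeed.integral_mem (hw : IsSpeed a B K w) (x : ℝ) {s t : ℝ} (hst : s ≤ t) :
    a * (t - s) ≤ ∫ τ in s..t, w τ x ∧ ∫ τ in s..t, w τ x ≤ B * (t - s) := by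
  constructor
  · have := intervalIntegral.integral_mono_on hst (intervalIntegrable_const (c := a))
      (hw.intervalIntegrable x s t) (fun τ _ => hw.lower τ x)
    simpa [mul_comm] using this
  · have := intervalIntegral.integral_mono_on hst (hw.intervalIntegrable x s t)
      (intervalIntegrable_const (c := B)) (fun τ _ => hw.upper τ x)
    simpa [mul_comm] using this

lemma IsSpeed.continuous_startPoint (hw : IsSpeed a B K w) : Continuous (startPoint w) := by
  have : Continuous fun s => ∫ τ in 0..s, w τ 0 :=
    intervalIntegral.continuous_primitive (fun s t => hw.intervalIntegrable 0 s t) 0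
  exact (continuous_id.max continuous_const).sub
    (this.comp (continuous_neg.max continuous_const))

/-- For positive labels the start point moves at unit rate, for negative ones at rate `w(-y, 0) ≥
a`. Splitting labels into positive and negative parts treats both at once. -/
lemma IsSpeed.le_startPoint_sub (hw : IsSpeed a B K w) {y y' : ℝ} (h : y ≤ y') :
    min 1 a * (y' - y) ≤ startPoint w y' - startPoint w y := by
  have hn : max (-y') 0 ≤ max (-y) 0 := max_le_max (by linarith) le_rfl
  have hp : max y 0 ≤ max y' 0 := max_le_max h le_rfl
  have e : startPoint w y' - startPoint w y
      = (max y' 0 - max y 0) + ∫ s in (max (-y') 0)..(max (-y) 0), w s 0 := by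
    rw [← intervalIntegral.integral_interval_sub_left (hw.intervalIntegrable 0 0 _)
      (hw.intervalIntegrable 0 0 _)]
    unfold startPoint
    ring
  have hpn : ∀ z : ℝ, z = max z 0 - max (-z) 0 := fun z => by
    rcases le_total z 0 with h | h
    · rw [max_eq_right h, max_eq_left (by linarith)]; ring
    · rw [max_eq_left h, max_eq_right (by linarith)]; ring
  have h1 := (hw.integral_mem 0 hn).1
  rw [e]
  have h2 : min 1 a * (max y' 0 - max y 0) ≤ 1 * (max y' 0 - max y 0) :=
    mul_le_mul_of_nonneg_right (min_le_left _ _) (by linarith)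
  have h3 : min 1 a * (max (-y) 0 - max (-y') 0) ≤ a * (max (-y) 0 - max (-y') 0) :=
    mul_le_mul_of_nonneg_right (min_le_right _ _) (by linarith)
  calc min 1 a * (y' - y)
      = min 1 a * (max y' 0 - max y 0) + min 1 a * (max (-y) 0 - max (-y') 0) := by
        nth_rewrite 1 [hpn y', hpn y]
        ring
    _ ≤ _ := by linarith

lemma abs_startPoint_sub_le (hw : IsSpeed a B K w) {a' B' : ℝ} {K' : ℝ≥0}
    (hw' : IsSpeed a' B' K' w') {ε : ℝ} (hε : ∀ t ∈ Icc 0 T, ∀ x, |w' t x - w t x| ≤ ε) {y : ℝ}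
    (hy : -T ≤ y) (hT : 0 ≤ T) : |startPoint w y - startPoint w' y| ≤ ε * T := by
  have hε0 : 0 ≤ ε := (abs_nonneg _).trans (hε 0 ⟨le_rfl, hT⟩ 0)
  have hm : 0 ≤ max (-y) 0 := le_max_right _ _
  have hmT : max (-y) 0 ≤ T := max_le (by linarith) hT
  have e : startPoint w y - startPoint w' y = ∫ s in 0..max (-y) 0, (w' s 0 - w s 0) := by
    rw [intervalIntegral.integral_sub (hw'.intervalIntegrable 0 0 _) (hw.intervalIntegrable 0 0 _)]
    unfold startPoint
    ring
  rw [e, ← Real.norm_eq_abs]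
  refine (intervalIntegral.norm_integral_le_of_norm_le_const (C := ε) fun s hs => ?_).trans ?_
  · rw [uIoc_of_le hm] at hs
    exact hε s ⟨hs.1.le, hs.2.trans hmT⟩ 0
  · rw [sub_zero, abs_of_nonneg hm]
    exact mul_le_mul_of_nonneg_left hmT hε0

/-- The characteristic with label `y`. -/
noncomputable def characteristic (T : ℝ) (w : ℝ → ℝ → ℝ) (t y : ℝ) : ℝ :=
  flow T w (startPoint w y) t

lemma IsSpeed.isTrajectory_characteristic (hw : IsSpeed a B K w) (hT : 0 < T) (y : ℝ) :
    IsTrajectory T w fun t => characteristic T w t y :=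
  hw.isTrajectory_flow hT _

lemma IsSpeed.continuous_flow (hw : IsSpeed a B K w) (hT : 0 < T) {t : ℝ} (ht : t ∈ Icc 0 T) :
    Continuous fun y => flow T w y t := by
  refine (LipschitzWith.of_dist_le_mul (K := Real.toNNReal (Real.exp (K * t))) fun y y' => ?_).continuous
  have := (hw.isTrajectory_flow hT y).dist_le_forward hw.lip (hw.isTrajectory_flow hT y') le_rfl
    ht.1 ht.2
  rw [hw.flow_zero hT, hw.flow_zero hT, sub_zero] at this
  rw [Real.coe_toNNReal _ (Real.exp_nonneg _), mul_comm]
  exact this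

lemma IsSpeed.continuous_characteristic (hw : IsSpeed a B K w) (hT : 0 < T) {t : ℝ}
    (ht : t ∈ Icc 0 T) : Continuous (characteristic T w t) :=
  (hw.continuous_flow hT ht).comp hw.continuous_startPoint

/-- The antilipschitz constant of the characteristics. -/
noncomputable def charConst (T a : ℝ) (K : ℝ≥0) : ℝ≥0 :=
  Real.toNNReal (Real.exp (K * T) / min 1 a)

/-- Labels are separated at time `0` by the factor `min 1 a`, and the backward Grönwall estimate
limits how much the flow can contract that separation. -/
lemma IsSpeed.antilipschitz_characteristic (hw : IsSpeed a B K w) (hT : 0 < T) {t : ℝ}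
    (ht : t ∈ Icc 0 T) : AntilipschitzWith (charConst T a K) (characteristic T w t) := by
  have hm : 0 < min 1 a := lt_min one_pos hw.pos
  refine AntilipschitzWith.of_le_mul_dist fun y y' => ?_
  rw [charConst, Real.coe_toNNReal _ (by positivity)]
  have h1 := (hw.isTrajectory_flow hT (startPoint w y)).dist_le_backward hw.lip
    (hw.isTrajectory_flow hT (startPoint w y')) le_rfl ht.1 ht.2
  rw [hw.flow_zero hT, hw.flow_zero hT, sub_zero] at h1
  have h2 : min 1 a * |y - y'| ≤ |startPoint w y - startPoint w y'| := by
    rcases le_total y y' with h | h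
    · have := hw.le_startPoint_sub h
      rw [abs_sub_comm, abs_of_nonneg (sub_nonneg.2 h), abs_sub_comm]
      exact this.trans (le_abs_self _)
    · have := hw.le_startPoint_sub h
      rw [abs_of_nonneg (sub_nonneg.2 h)]
      exact this.trans (le_abs_self _)
  have h3 : Real.exp (K * t) ≤ Real.exp (K * T) :=
    Real.exp_le_exp.2 (mul_le_mul_of_nonneg_left ht.2 K.2)
  rw [Real.dist_eq, Real.dist_eq, div_mul_eq_mul_div, le_div_iff₀ hm, mul_comm]
  calc min 1 a * |y - y'| ≤ _ := h2
    _ ≤ _ := h1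
    _ ≤ |characteristic T w t y - characteristic T w t y'| * Real.exp (K * T) :=
      mul_le_mul_of_nonneg_left h3 (abs_nonneg _)
    _ = _ := mul_comm _ _

/-- Points are displaced by an amount between `0` and `B * T`, so the continuous flow map has the
limits of the identity at both ends. -/
lemma IsSpeed.surjective_flow (hw : IsSpeed a B K w) (hT : 0 < T) {t : ℝ} (ht : t ∈ Icc 0 T) :
    Function.Surjective fun y => flow T w y t := by
  have hb : ∀ y, 0 ≤ flow T w y t - y ∧ flow T w y t - y ≤ B * T := fun y => by
    have h := (hw.isTrajectory_flow hT y).sub_mem hw le_rfl ht.1 ht.2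
    rw [hw.flow_zero hT, sub_zero] at h
    exact ⟨(mul_nonneg hw.pos.le ht.1).trans h.1,
      h.2.trans (mul_le_mul_of_nonneg_left ht.2 hw.nonneg_upper)⟩
  refine (hw.continuous_flow hT ht).surjective ?_ ?_
  · exact tendsto_atTop_mono (fun y => sub_nonneg.1 (hb y).1) tendsto_id
  · exact tendsto_atBot_mono (fun y => sub_le_iff_le_add'.1 (hb y).2)
      (tendsto_id.atBot_add (tendsto_const_nhds (x := B * T)))

/-- Characteristics at two times differ by a map which is nearly an isometry. -/
lemma IsSpeed.exists_transition (hw : IsSpeed a B K w) (hT : 0 < T) {s t : ℝ} (hs : s ∈ Icc 0 T)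
    (ht : t ∈ Icc 0 T) : ∃ Y : ℝ → ℝ, Continuous Y ∧
      AntilipschitzWith (Real.toNNReal (Real.exp (K * |t - s|))) Y ∧
      ∀ y, characteristic T w t y = Y (characteristic T w s y) := by
  have hd : ∀ {s t : ℝ}, s ∈ Icc 0 T → t ∈ Icc 0 T → ∀ y y',
      |flow T w y s - flow T w y' s| ≤ Real.exp (K * |t - s|) * |flow T w y t - flow T w y' t| := by
    intro s t hs ht y y'
    rw [mul_comm]
    rcases le_total s t with h | h
    · rw [abs_of_nonneg (sub_nonneg.2 h)]
      exact (hw.isTrajectory_flow hT y).dist_le_backward hw.lip (hw.isTrajectory_flow hT y')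
        hs.1 h ht.2
    · rw [abs_sub_comm t s, abs_of_nonneg (sub_nonneg.2 h)]
      exact (hw.isTrajectory_flow hT y).dist_le_forward hw.lip (hw.isTrajectory_flow hT y')
        ht.1 h hs.2
  have hsurj := hw.surjective_flow hT hs
  set S := Function.surjInv hsurj with hS
  have hSf : ∀ x, flow T w (S x) s = x := Function.surjInv_eq hsurj
  have hnn := Real.exp_nonneg (K * |t - s|)
  refine ⟨fun x => flow T w (S x) t, ?_, ?_, fun y => ?_⟩
  · refine (LipschitzWith.of_dist_le_mul (K := Real.toNNReal (Real.exp (K * |s - t|)))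
      fun x x' => ?_).continuous
    rw [Real.coe_toNNReal _ (Real.exp_nonneg _)]
    have := hd ht hs (S x) (S x')
    rwa [hSf, hSf] at this
  · refine AntilipschitzWith.of_le_mul_dist fun x x' => ?_
    rw [Real.coe_toNNReal _ hnn]
    have := hd hs ht (S x) (S x')
    rwa [hSf, hSf] at this
  -- Two integral curves meeting at time `s` also agree at time `t`, so the choice of preimage made
  -- by `S` is immaterial.
  · unfold characteristic
    have := hd ht hs (startPoint w y) (S (flow T w (startPoint w y) s))
    rw [hSf, sub_self, abs_zero, mul_zero] at this
    exact sub_eq_zero.1 (abs_eq_zero.1 (le_antisymm this (abs_nonneg _)))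

/-- To the left of the road the velocity equals its value at `0`, so there the integral curve is an
explicit primitive of `w(·, 0)`. The start point is chosen so that this primitive reaches `0`
exactly at time `s`; uniqueness identifies it with the characteristic. -/
lemma IsSpeed.characteristic_entry (hw : IsSpeed a B K w) (hT : 0 < T) {s : ℝ}
    (hs : s ∈ Icc 0 T) : characteristic T w s (-s) = 0 := by
  have hst : startPoint w (-s) = -∫ τ in 0..s, w τ 0 := by
    simp [startPoint, hs.1]
  set f : ℝ → ℝ := fun t => startPoint w (-s) + ∫ τ in 0..t, w τ 0 with hf
  have hfd : ∀ t, HasDerivAt f (w t 0) t := fun t =>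
    (intervalIntegral.integral_hasDerivAt_right (hw.intervalIntegrable 0 0 t)
      ((hw.continuous_left 0).stronglyMeasurableAtFilter _ _)
      (hw.continuous_left 0).continuousAt).const_add _
  have hf0 : f 0 = startPoint w (-s) := by simp [hf]
  have hfs : f s = 0 := by simp [hf, hst]
  have hfneg : ∀ t ∈ Icc 0 s, f t ≤ 0 := by
    intro t ht
    have := (hw.integral_mem 0 ht.2).1
    rw [← intervalIntegral.integral_interval_sub_left (hw.intervalIntegrable 0 0 s)
      (hw.intervalIntegrable 0 0 t)] at this
    have h2 := mul_nonneg hw.pos.le (sub_nonneg.2 ht.2)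
    simp only [hf, hst]
    linarith
  have h1 : IsTrajectory s w f := fun t ht => by
    rw [hw.left t _ (hfneg t ht)]
    exact hfd t
  have h2 : IsTrajectory s w fun t => characteristic T w t (-s) := fun t ht =>
    hw.isTrajectory_characteristic hT (-s) t ⟨ht.1, ht.2.trans hs.2⟩
  have := h1.dist_le_forward hw.lip h2 le_rfl hs.1 le_rfl
  rw [hf0, hfs] at this
  simp only [characteristic, hw.flow_zero hT, sub_self, abs_zero, zero_mul, zero_sub,
    abs_neg] at this ⊢
  exact abs_eq_zero.1 (le_antisymm this (abs_nonneg _))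

lemma IsSpeed.characteristic_zero (hw : IsSpeed a B K w) (hT : 0 < T) {y : ℝ} (hy : 0 ≤ y) :
    characteristic T w 0 y = y := by
  rw [characteristic, hw.flow_zero hT]
  simp [startPoint, hy]

/-- Grönwall with two errors: `ε n` in the velocity and `ε n * T` in the start point. The latter
needs `-T ≤ y`, since the velocities are compared only on `[0,T]`. -/
lemma tendsto_characteristic {ι : Type*} {l : Filter ι} {ws : ι → ℝ → ℝ → ℝ} {ε : ι → ℝ}
    (hT : 0 < T) (hw : IsSpeed a B K w) (hws : ∀ n, IsSpeed a B K (ws n))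
    (hε : ∀ n, ∀ t ∈ Icc 0 T, ∀ x, |ws n t x - w t x| ≤ ε n) (hε0 : Tendsto ε l (𝓝 0))
    {t y : ℝ} (ht : t ∈ Icc 0 T) (hy : -T ≤ y) :
    Tendsto (fun n => characteristic T (ws n) t y) l (𝓝 (characteristic T w t y)) := by
  rw [tendsto_iff_dist_tendsto_zero]
  have hlim : Tendsto (fun n => gronwallBound (ε n * T) K (ε n) t) l (𝓝 0) := by
    have hc : Continuous fun e : ℝ => gronwallBound (e * T) K e t := by
      unfold gronwallBound
      split_ifs <;> fun_prop
    have := (hc.tendsto 0).comp hε0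
    simpa [Function.comp_def, gronwallBound_ε0_δ0] using this
  refine squeeze_zero (fun _ => dist_nonneg) (fun n => ?_) hlim
  have h1 := (hw.isTrajectory_characteristic hT y).dist_le_of_approx hw.lip
    ((hws n).isTrajectory_characteristic hT y) (hε n) ht
  have h0 : |characteristic T w 0 y - characteristic T (ws n) 0 y| ≤ ε n * T := by
    rw [characteristic, characteristic, hw.flow_zero hT, (hws n).flow_zero hT]
    exact abs_startPoint_sub_le hw (hws n) (hε n) hy hT.le
  rw [dist_comm, Real.dist_eq]
  refine h1.trans ?_
  unfold gronwallBound
  split_ifs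
  · linarith
  · have := mul_le_mul_of_nonneg_right h0 (Real.exp_nonneg (K * t))
    linarith

end Flow

/-! ### The transported density -/

/-- Initial and boundary data encoded as a function of the label: `f y` is the initial datum at
`y > 0` and `f (-t)` the inflow at time `t`. -/
structure IsLabelData (T ℓ M : ℝ) (f : ℝ → ℝ) : Prop where
  meas : Measurable f
  bound : ∀ y, |f y| ≤ M
  supp : ∀ y, y ∉ Ioo (-T) ℓ → f y = 0

lemma IsLabelData.integrable {T ℓ M : ℝ} {f : ℝ → ℝ} (hf : IsLabelData T ℓ M f) :
    Integrable f := by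
  have h : IntegrableOn f (Ioo (-T) ℓ) :=
    Measure.integrableOn_of_bounded (M := M) measure_Ioo_lt_top.ne hf.meas.aestronglyMeasurable
      (.of_forall hf.bound)
  exact (integrableOn_iff_integrable_of_support_subset fun y hy => by
    by_contra hn
    exact hy (hf.supp y hn)).1 h

/-- The solution of the linear transport problem with label data `f`. -/
noncomputable def transported (T : ℝ) (w : ℝ → ℝ → ℝ) (f : ℝ → ℝ) (t : ℝ) : ℝ → ℝ :=
  pushDensity (characteristic T w t) f

section Transported
variable {T ℓ M a B : ℝ} {K : ℝ≥0} {w : ℝ → ℝ → ℝ} {f : ℝ → ℝ}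

lemma integral_transported_mul (hw : IsSpeed a B K w) (hT : 0 < T) (f h : ℝ → ℝ) {t : ℝ}
    (ht : t ∈ Icc 0 T) :
    ∫ x, transported T w f t x * h x = ∫ y, f y * h (characteristic T w t y) :=
  integral_comp_mul (hw.continuous_characteristic hT ht) (hw.antilipschitz_characteristic hT ht) f h

lemma integral_transported_road (hw : IsSpeed a B K w) (hT : 0 < T) (f h : ℝ → ℝ) {t : ℝ}
    (ht : t ∈ Icc 0 T) : ∫ x, transported T w f t x * h x ∂(roadMeasure ℓ)
      = ∫ y, f y * (Ioo 0 ℓ).indicator h (characteristic T w t y) := by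
  rw [← integral_transported_mul hw hT f ((Ioo 0 ℓ).indicator h) ht,
    ← integral_indicator measurableSet_Ioo]
  congr 1 with x
  by_cases hx : x ∈ Ioo 0 ℓ <;> simp [hx]

lemma measurable_transported (hw : IsSpeed a B K w) (hT : 0 < T) (hf : IsLabelData T ℓ M f) {t : ℝ}
    (ht : t ∈ Icc 0 T) : Measurable (transported T w f t) :=
  measurable_pushDensity (hw.continuous_characteristic hT ht)
    (hw.antilipschitz_characteristic hT ht) hf.meas

lemma integrable_transported (hw : IsSpeed a B K w) (hT : 0 < T) (hf : IsLabelData T ℓ M f) {t : ℝ}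
    (ht : t ∈ Icc 0 T) : Integrable (transported T w f t) :=
  integrable_pushDensity (hw.continuous_characteristic hT ht)
    (hw.antilipschitz_characteristic hT ht) hf.integrable

lemma abs_transported_le (hw : IsSpeed a B K w) (hT : 0 < T) (hf : IsLabelData T ℓ M f) {t : ℝ}
    (ht : t ∈ Icc 0 T) : ∀ᵐ x, |transported T w f t x| ≤ charConst T a K * M :=
  abs_pushDensity_le (hw.continuous_characteristic hT ht)
    (hw.antilipschitz_characteristic hT ht) hf.bound

lemma integrable_transported_mul (hw : IsSpeed a B K w) (hT : 0 < T) (hf : IsLabelData T ℓ M f)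
    {t : ℝ} (ht : t ∈ Icc 0 T) {h : ℝ → ℝ} (hh : Integrable h) :
    Integrable fun x => transported T w f t x * h x :=
  hh.bdd_mul (measurable_transported hw hT hf ht).aestronglyMeasurable
    (abs_transported_le hw hT hf ht)

/-- With the transition map `Y` from time `s` to `t` one has `∫ q_t² = ∫ q_s (q_t ∘ Y)`. Young's
inequality with weight `e = exp (K |t - s|)` bounds this by `e/2 ∫ q_s² + 1/(2e) ∫ (q_t ∘ Y)²`, and
the antilipschitz bound for `Y` makes the last term at most `1/2 ∫ q_t²`, which is absorbed. -/
lemma integral_transported_sq_le (hw : IsSpeed a B K w) (hT : 0 < T) (hf : IsLabelData T ℓ M f)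
    {s t : ℝ} (hs : s ∈ Icc 0 T) (ht : t ∈ Icc 0 T) :
    ∫ x, transported T w f t x * transported T w f t x
      ≤ Real.exp (K * |t - s|) * ∫ x, transported T w f s x * transported T w f s x := by
  obtain ⟨Y, hYc, hYa, hY⟩ := hw.exists_transition hT hs ht
  set e := Real.exp (K * |t - s|) with he
  have he0 : 0 < e := Real.exp_pos _
  set q := transported T w f with hq
  have hqs := integrable_transported hw hT hf hs
  have hqt := integrable_transported hw hT hf ht
  have hss := integrable_transported_mul hw hT hf hs hqs
  have htt := integrable_transported_mul hw hT hf ht hqt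
  have hYt := integrable_comp_of_antilipschitz hYc hYa hqt
  have hYtt := integrable_comp_of_antilipschitz hYc hYa htt
  simp only [← hq] at hqs hqt hss htt hYt hYtt
  have e1 : ∫ x, q t x * q t x = ∫ x, q s x * q t (Y x) := by
    rw [hq, integral_transported_mul hw hT f _ ht,
      integral_transported_mul hw hT f (fun x => transported T w f t (Y x)) hs]
    simp only [hY]
  have e2 : ∫ x, q s x * q t (Y x) ≤ ∫ x, (e / 2 * (q s x * q s x)
      + e⁻¹ / 2 * (q t (Y x) * q t (Y x))) := by
    refine integral_mono (integrable_transported_mul hw hT hf hs hYt)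
      ((hss.const_mul _).add (hYtt.const_mul _)) fun x => ?_
    simp only
    have h0 : 0 ≤ e⁻¹ / 2 * (e * q s x - q t (Y x)) ^ 2 := by positivity
    have h1 : e⁻¹ / 2 * (e * q s x - q t (Y x)) ^ 2 = e / 2 * (q s x * q s x)
      + e⁻¹ / 2 * (q t (Y x) * q t (Y x)) - q s x * q t (Y x) := by
      field_simp
      ring
    linarith
  have e3 := integral_comp_le_of_antilipschitz hYc hYa htt fun x => mul_self_nonneg _
  rw [Real.coe_toNNReal _ he0.le] at e3
  rw [integral_add (hss.const_mul _) (hYtt.const_mul _), integral_const_mul,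
    integral_const_mul] at e2
  have e4 : e⁻¹ / 2 * ∫ x, q t (Y x) * q t (Y x) ≤ 1 / 2 * ∫ x, q t x * q t x := by
    calc e⁻¹ / 2 * ∫ x, q t (Y x) * q t (Y x) ≤ e⁻¹ / 2 * (e * ∫ x, q t x * q t x) :=
          mul_le_mul_of_nonneg_left e3 (by positivity)
      _ = _ := by field_simp
  rw [← e1] at e2
  linarith

lemma tendsto_characteristic_time (hw : IsSpeed a B K w) (hT : 0 < T) {t : ℝ} (ht : t ∈ Icc 0 T)
    (y : ℝ) : Tendsto (fun s => characteristic T w s y) (𝓝[Icc 0 T] t)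
      (𝓝 (characteristic T w t y)) :=
  (hw.isTrajectory_characteristic hT y).continuousOn t ht

/-- Weak convergence becomes strong once the norms do not jump up. Expanding the square, the cross
term converges by weak continuity tested against `q t` itself, and `∫ q_s²` is at most `exp (K |s -
t|) ∫ q_t²`. -/
lemma tendsto_integral_transported_sub_sq (hw : IsSpeed a B K w) (hT : 0 < T)
    (hf : IsLabelData T ℓ M f) {t : ℝ} (ht : t ∈ Icc 0 T) :
    Tendsto (fun s => ∫ x, (transported T w f s x - transported T w f t x) ^ 2) (𝓝[Icc 0 T] t)
      (𝓝 0) := by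
  set q := transported T w f with hq
  have hqt := integrable_transported hw hT hf ht
  have hweak : Tendsto (fun s => ∫ x, q s x * q t x) (𝓝[Icc 0 T] t) (𝓝 (∫ x, q t x * q t x)) := by
    have := tendsto_integral_mul_comp (l := 𝓝[Icc 0 T] t) (C := charConst T a K)
      (eventually_mem_nhdsWithin.mono fun s hs => hw.continuous_characteristic hT hs)
      (eventually_mem_nhdsWithin.mono fun s hs => hw.antilipschitz_characteristic hT hs)
      (hw.continuous_characteristic hT ht) (hw.antilipschitz_characteristic hT ht)
      (fun y _ => tendsto_characteristic_time hw hT ht y) hf.integrable hf.bound hqt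
    rw [← integral_transported_mul hw hT f _ ht] at this
    refine this.congr' ?_
    filter_upwards [self_mem_nhdsWithin] with s hs
    rw [← integral_transported_mul hw hT f _ hs]
  have hexp : Tendsto (fun s => Real.exp (K * |s - t|)) (𝓝[Icc 0 T] t) (𝓝 1) := by
    have : Continuous fun s => Real.exp (K * |s - t|) := by fun_prop
    have h := this.tendsto t
    simp only [sub_self, abs_zero, mul_zero, Real.exp_zero] at h
    exact h.mono_left nhdsWithin_le_nhds
  have hlim : Tendsto (fun s => (Real.exp (K * |s - t|) + 1) * (∫ x, q t x * q t x)
      - 2 * ∫ x, q s x * q t x) (𝓝[Icc 0 T] t) (𝓝 0) := by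
    have := ((hexp.add_const 1).mul_const (∫ x, q t x * q t x)).sub (hweak.const_mul 2)
    convert this using 2
    ring
  refine squeeze_zero' (.of_forall fun s => integral_nonneg fun x => sq_nonneg _) ?_ hlim
  filter_upwards [self_mem_nhdsWithin] with s hs
  have hqs := integrable_transported hw hT hf hs
  have hss := integrable_transported_mul hw hT hf hs hqs
  have hst := integrable_transported_mul hw hT hf hs hqt
  have htt := integrable_transported_mul hw hT hf ht hqt
  simp only [← hq] at hss hst htt
  have h1 := integral_transported_sq_le hw hT hf ht hs
  simp only [← hq] at h1
  have e : ∀ x, (q s x - q t x) ^ 2 = q s x * q s x + q t x * q t x - 2 * (q s x * q t x) :=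
    fun x => by ring
  simp only [e]
  have hadd : Integrable fun x => q s x * q s x + q t x * q t x := hss.add htt
  rw [integral_sub hadd (hst.const_mul 2), integral_add hss htt, integral_const_mul]
  linarith

lemma transported_nonneg (hw : IsSpeed a B K w) (hT : 0 < T) {t : ℝ} (ht : t ∈ Icc 0 T)
    (hf : ∀ y, 0 ≤ f y) (x : ℝ) : 0 ≤ transported T w f t x :=
  pushDensity_nonneg (hw.antilipschitz_characteristic hT ht) hf x

end Transported

/-! ### The transported density is a weak solution -/

section Weak
variable {T ℓ M a B : ℝ} {K : ℝ≥0} {w : ℝ → ℝ → ℝ} {f : ℝ → ℝ}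

/-- The derivative of a test function along the flow. -/
noncomputable def materialDeriv (w : ℝ → ℝ → ℝ) (φ : ℝ × ℝ → ℝ) (t x : ℝ) : ℝ :=
  fderiv ℝ φ (t, x) (1, 0) + w t x * fderiv ℝ φ (t, x) (0, 1)

lemma IsSpeed.continuous_materialDeriv (hw : IsSpeed a B K w) {φ : ℝ × ℝ → ℝ}
    (hφ : ContDiff ℝ 1 φ) : Continuous fun z : ℝ × ℝ => materialDeriv w φ z.1 z.2 := by
  have h := hφ.continuous_fderiv one_ne_zero
  exact (h.clm_apply continuous_const).add (hw.cont.mul (h.clm_apply continuous_const))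

lemma IsTrajectory.hasDerivAt_comp {X : ℝ → ℝ} (hX : IsTrajectory T w X) {φ : ℝ × ℝ → ℝ}
    (hφ : ContDiff ℝ 1 φ) {t : ℝ} (ht : t ∈ Icc 0 T) :
    HasDerivAt (fun t => φ (t, X t)) (materialDeriv w φ t (X t)) t := by
  have h1 : HasFDerivAt φ (fderiv ℝ φ (t, X t)) (t, X t) :=
    (hφ.differentiable one_ne_zero (t, X t)).hasFDerivAt
  have h2 : HasDerivAt (fun t => (t, X t)) (1, w t (X t)) t := (hasDerivAt_id t).prodMk (hX t ht)
  have h3 := h1.comp_hasDerivAt t h2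
  have e : ((1, w t (X t)) : ℝ × ℝ) = (1, 0) + w t (X t) • (0, 1) := by simp
  rw [e, map_add, map_smul, smul_eq_mul] at h3
  exact h3

/-- A trajectory moves strictly to the right, so it is on the road during a single time interval
starting at `e`. The interval ends at time `T` or at the exit `ℓ`, and the test function vanishes at
either end; the fundamental theorem of calculus leaves only the entry value. -/
lemma IsTrajectory.integral_materialDeriv (hw : IsSpeed a B K w) {X : ℝ → ℝ}
    (hX : IsTrajectory T w X) {φ : ℝ × ℝ → ℝ} (hφ : ContDiff ℝ 1 φ)
    (hφT : ∀ x ∈ Icc 0 ℓ, φ (T, x) = 0) (hφℓ : ∀ t ∈ Icc 0 T, φ (t, ℓ) = 0) {e : ℝ}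
    (he : e ∈ Icc 0 T) (hXe : X e ∈ Ico 0 ℓ) (hbefore : ∀ t ∈ Ico 0 e, X t ≤ 0) :
    ∫ t in 0..T, (Ioo 0 ℓ).indicator (materialDeriv w φ t) (X t) = -φ (e, X e) := by
  have hmono : ∀ {s t : ℝ}, 0 ≤ s → s < t → t ≤ T → X s < X t := fun {s t} hs hst ht => by
    have h1 := (hX.sub_mem hw hs hst.le ht).1
    have h2 := mul_pos hw.pos (sub_pos.2 hst)
    linarith
  -- `τ` is `T` if the trajectory has not passed `ℓ` by then, and otherwise the time at which it
  -- reaches `ℓ`.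
  obtain ⟨τ, hτ, hφτ, hin, hout⟩ : ∃ τ ∈ Icc e T, φ (τ, X τ) = 0 ∧
      (∀ t ∈ Ioo e τ, X t ∈ Ioo 0 ℓ) ∧ ∀ t ∈ Ioc τ T, X t ∉ Ioo 0 ℓ := by
    rcases le_or_gt (X T) ℓ with h | h
    · have heT : X e ≤ X T := by
        rcases he.2.eq_or_lt with h | h
        · rw [h]
        · exact (hmono he.1 h le_rfl).le
      refine ⟨T, ⟨he.2, le_rfl⟩, hφT _ ⟨hXe.1.trans heT, h⟩, fun t ht => ⟨?_, ?_⟩, fun t ht => ?_⟩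
      · exact hXe.1.trans_lt (hmono he.1 ht.1 ht.2.le)
      · exact (hmono (he.1.trans ht.1.le) ht.2 le_rfl).trans_le h
      · exact absurd ht.1 (not_lt.2 ht.2)
    · obtain ⟨τ, hτ, hτℓ⟩ := intermediate_value_Icc he.2
        (hX.continuousOn.mono (Icc_subset_Icc_left he.1)) ⟨hXe.2.le, h.le⟩
      refine ⟨τ, hτ, ?_, fun t ht => ⟨?_, ?_⟩, fun t ht hm => ?_⟩
      · rw [hτℓ]; exact hφℓ _ ⟨he.1.trans hτ.1, hτ.2⟩
      · exact hXe.1.trans_lt (hmono he.1 ht.1 (ht.2.le.trans hτ.2))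
      · rw [← hτℓ]; exact hmono (he.1.trans ht.1.le) ht.2 hτ.2
      · have := hmono (he.1.trans hτ.1) ht.1 ht.2
        rw [hτℓ] at this
        exact lt_asymm this hm.2
  have hT0 : 0 ≤ T := he.1.trans he.2
  have hsub : Icc e τ ⊆ Icc 0 T := Icc_subset_Icc he.1 hτ.2
  have h1 : ∫ t in 0..T, (Ioo 0 ℓ).indicator (materialDeriv w φ t) (X t)
      = ∫ t in e..τ, materialDeriv w φ t (X t) := by
    rw [intervalIntegral.integral_of_le hT0, intervalIntegral.integral_of_le hτ.1,
      integral_Ioc_eq_integral_Ioo (x := e)]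
    have hs : Ioo e τ = Ioc 0 T ∩ Ioo e τ := by
      rw [inter_eq_right.2]
      exact fun t ht => ⟨he.1.trans_lt ht.1, ht.2.le.trans hτ.2⟩
    rw [hs, ← setIntegral_indicator measurableSet_Ioo]
    refine setIntegral_congr_ae measurableSet_Ioc ?_
    have hne : ∀ c : ℝ, ∀ᵐ t : ℝ, t ≠ c := fun c => by
      simp [ae_iff]
    filter_upwards [hne e, hne τ] with t hte htτ htm
    by_cases ht : t ∈ Ioo e τ
    · rw [indicator_of_mem ht, indicator_of_mem (hin t ht)]
    · rw [indicator_of_notMem ht, indicator_of_notMem]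
      rcases lt_or_gt_of_ne hte with h | h
      · exact fun hm => absurd hm.1 (not_lt.2 (hbefore t ⟨htm.1.le, h⟩))
      · refine hout t ⟨?_, htm.2⟩
        by_contra hn
        exact ht ⟨h, lt_of_le_of_ne (not_lt.1 hn) htτ⟩
  rw [h1, intervalIntegral.integral_eq_sub_of_hasDerivAt (f := fun t => φ (t, X t)), hφτ, zero_sub]
  · intro t ht
    rw [uIcc_of_le hτ.1] at ht
    exact hX.hasDerivAt_comp hφ (hsub ht)
  · refine ContinuousOn.intervalIntegrable ?_
    rw [uIcc_of_le hτ.1]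
    exact (hw.continuous_materialDeriv hφ).comp_continuousOn
      (continuousOn_id.prodMk (hX.continuousOn.mono hsub))

lemma IsSpeed.integral_materialDeriv_characteristic (hw : IsSpeed a B K w) (hT : 0 < T)
    (hℓ : 0 < ℓ) {φ : ℝ × ℝ → ℝ} (hφ : ContDiff ℝ 1 φ)
    (hφT : ∀ x ∈ Icc 0 ℓ, φ (T, x) = 0) (hφℓ : ∀ t ∈ Icc 0 T, φ (t, ℓ) = 0) {y : ℝ}
    (hy : y ∈ Ioo (-T) ℓ) :
    ∫ t in 0..T, (Ioo 0 ℓ).indicator (materialDeriv w φ t) (characteristic T w t y)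
      = -φ (max (-y) 0, max y 0) := by
  have hX := hw.isTrajectory_characteristic hT y
  rcases le_total 0 y with h | h
  · rw [max_eq_right (by linarith), max_eq_left h,
      hX.integral_materialDeriv hw hφ hφT hφℓ (e := 0) ⟨le_rfl, hT.le⟩
      (by rw [hw.characteristic_zero hT h]; exact ⟨h, hy.2⟩)
      (fun t ht => absurd ht.2 (not_lt.2 ht.1)), hw.characteristic_zero hT h]
  · have hyT : -y ∈ Icc 0 T := ⟨by linarith, by linarith [hy.1]⟩
    have h0 : characteristic T w (-y) y = 0 := by
      simpa using hw.characteristic_entry hT hyT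
    rw [max_eq_left (by linarith), max_eq_right h,
      hX.integral_materialDeriv hw hφ hφT hφℓ (e := -y) hyT (by rw [h0]; exact ⟨le_rfl, hℓ⟩)
      (fun t ht => ?_), h0]
    have h1 := (hX.sub_mem hw ht.1 ht.2.le hyT.2).1
    have h2 := mul_nonneg hw.pos.le (sub_nonneg.2 ht.2.le)
    rw [h0] at h1
    linarith

/-- Continuity in the label and a Lipschitz bound `B` in time give joint continuity. It provides the
joint measurability for Fubini in `isWeakSolution_transported`; clamping the time makes it a
statement on the whole plane. -/
lemma IsSpeed.continuous_characteristic_projIcc (hw : IsSpeed a B K w) (hT : 0 < T) :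
    Continuous fun z : ℝ × ℝ => characteristic T w (projIcc 0 T hT.le z.1) z.2 := by
  refine continuous_prod_of_continuous_lipschitzWith _ (⟨B, hw.nonneg_upper⟩ : ℝ≥0)
    (fun t => hw.continuous_characteristic hT (projIcc 0 T hT.le t).2) fun y => ?_
  refine LipschitzWith.of_dist_le_mul fun t t' => ?_
  have key : ∀ s s' : ℝ, s ∈ Icc 0 T → s' ∈ Icc 0 T →
      |characteristic T w s y - characteristic T w s' y| ≤ B * |s - s'| := by
    intro s s' hs hs'
    wlog h : s' ≤ s generalizing s s'
    · rw [abs_sub_comm, abs_sub_comm s]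
      exact this s' s hs' hs (not_le.1 h).le
    have := (hw.isTrajectory_characteristic hT y).sub_mem hw hs'.1 h hs.2
    rw [abs_of_nonneg (sub_nonneg.2 h), abs_of_nonneg]
    · exact this.2
    · exact (mul_nonneg hw.pos.le (sub_nonneg.2 h)).trans this.1
  refine (key _ _ (projIcc 0 T hT.le t).2 (projIcc 0 T hT.le t').2).trans ?_
  refine mul_le_mul_of_nonneg_left ?_ hw.nonneg_upper
  exact abs_projIcc_sub_projIcc hT.le

/-- After a change to labels and Fubini, the inner time integral is that of the material derivative
of `φ` along one characteristic, which equals minus `φ` at its entry point. Splitting the label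
integral at `0` recovers the boundary and initial terms. -/
theorem isWeakSolution_transported (hw : IsSpeed a B K w) (hT : 0 < T) (hℓ : 0 < ℓ)
    (hf : IsLabelData T ℓ M f) :
    IsWeakSolution T ℓ w f (fun t => f (-t)) (transported T w f) := by
  intro φ hφ hφT hφℓ
  set g := materialDeriv w φ with hg
  have hgc := hw.continuous_materialDeriv hφ
  obtain ⟨G, hG⟩ := (isCompact_Icc.prod isCompact_Icc).exists_bound_of_continuousOn
    (hgc.continuousOn (s := Icc 0 T ×ˢ Icc 0 ℓ))
  have hGnn : 0 ≤ G := (norm_nonneg _).trans (hG (0, 0) ⟨⟨le_rfl, hT.le⟩, ⟨le_rfl, hℓ.le⟩⟩)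
  have h1 : ∀ t ∈ Icc 0 T, ∫ x in 0..ℓ, transported T w f t x * g t x
      = ∫ y, f y * (Ioo 0 ℓ).indicator (g t) (characteristic T w t y) := by
    intro t ht
    rw [intervalIntegral_eq_road hℓ.le, integral_transported_road hw hT f (g t) ht]
  have h2 : ∫ t in 0..T, ∫ x in 0..ℓ, transported T w f t x * g t x
      = ∫ y, ∫ t in 0..T, f y * (Ioo 0 ℓ).indicator (g t) (characteristic T w t y) := by
    have : ∫ t in 0..T, ∫ x in 0..ℓ, transported T w f t x * g t x
        = ∫ t in 0..T, ∫ y, f y * (Ioo 0 ℓ).indicator (g t) (characteristic T w t y) :=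
      intervalIntegral.integral_congr fun t ht => by
        rw [uIcc_of_le hT.le] at ht
        exact h1 t ht
    rw [this]
    simp only [intervalIntegral.integral_of_le hT.le]
    refine integral_integral_swap ?_
    have hmeas : Measurable fun z : ℝ × ℝ => f z.2 * (Ioo 0 ℓ).indicator (g z.1)
        (characteristic T w (projIcc 0 T hT.le z.1) z.2) := by
      have hZ := (hw.continuous_characteristic_projIcc hT).measurable
      have : Measurable fun z : ℝ × ℝ => ({z : ℝ × ℝ | z.2 ∈ Ioo 0 ℓ}).indicator
          (fun z : ℝ × ℝ => g z.1 z.2) (z.1, characteristic T w (projIcc 0 T hT.le z.1) z.2) :=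
        (hgc.measurable.indicator (measurable_snd measurableSet_Ioo)).comp
          (measurable_fst.prodMk hZ)
      exact (hf.meas.comp measurable_snd).mul this
    have hae : ∀ᵐ z ∂((volume.restrict (Ioc 0 T)).prod (volume : Measure ℝ)), z.1 ∈ Ioc 0 T := by
      have := (Measure.quasiMeasurePreserving_fst
        (μ := volume.restrict (Ioc 0 T)) (ν := (volume : Measure ℝ))).ae
        (ae_restrict_mem (measurableSet_Ioc (a := 0) (b := T)))
      exact this
    have hdom : Integrable (fun z : ℝ × ℝ => G * |f z.2|)
        ((volume.restrict (Ioc 0 T)).prod (volume : Measure ℝ)) :=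
      (integrable_const (G : ℝ)).mul_prod hf.integrable.abs
    refine hdom.mono' ?_ ?_
    · refine hmeas.aestronglyMeasurable.congr ?_
      filter_upwards [hae] with z hz
      rw [projIcc_of_mem hT.le (Ioc_subset_Icc_self hz)]
      rfl
    · filter_upwards [hae] with z hz
      simp only [Function.uncurry]
      rw [norm_mul, mul_comm]
      refine mul_le_mul_of_nonneg_right ?_ (norm_nonneg _)
      by_cases hx : characteristic T w z.1 z.2 ∈ Ioo 0 ℓ
      · rw [indicator_of_mem hx]
        exact hG (z.1, characteristic T w z.1 z.2) ⟨Ioc_subset_Icc_self hz, hx.1.le, hx.2.le⟩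
      · rw [indicator_of_notMem hx, norm_zero]
        exact hGnn
  have h3 : ∀ y, ∫ t in 0..T, f y * (Ioo 0 ℓ).indicator (g t) (characteristic T w t y)
      = -(f y * φ (max (-y) 0, max y 0)) := by
    intro y
    rw [intervalIntegral.integral_const_mul]
    by_cases hy : y ∈ Ioo (-T) ℓ
    · rw [hw.integral_materialDeriv_characteristic hT hℓ hφ hφT hφℓ hy]
      ring
    · rw [hf.supp y hy]
      ring
  have hc : Continuous fun y : ℝ => φ (max (-y) 0, max y 0) :=
    hφ.continuous.comp (by fun_prop)
  have hii : ∀ c d : ℝ, IntervalIntegrable (fun y => f y * φ (max (-y) 0, max y 0)) volume c d :=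
    fun c d => hf.integrable.intervalIntegrable.mul_continuousOn hc.continuousOn
  have h4 : ∫ y, f y * φ (max (-y) 0, max y 0)
      = (∫ t in 0..T, f (-t) * φ (t, 0)) + ∫ x in 0..ℓ, f x * φ (0, x) := by
    have e0 : ∫ y, f y * φ (max (-y) 0, max y 0) = ∫ y in (-T)..ℓ, f y * φ (max (-y) 0, max y 0) := by
      rw [intervalIntegral.integral_of_le (by linarith), setIntegral_eq_integral_of_forall_compl_eq_zero]
      intro y hy
      rw [hf.supp y fun h => hy (Ioo_subset_Ioc_self h), zero_mul]
    rw [e0, ← intervalIntegral.integral_add_adjacent_intervals (hii (-T) 0) (hii 0 ℓ)]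
    congr 1
    · have := intervalIntegral.integral_comp_neg (a := 0) (b := T)
        (fun y => f y * φ (max (-y) 0, max y 0))
      rw [neg_zero] at this
      rw [← this]
      refine intervalIntegral.integral_congr fun t ht => ?_
      rw [uIcc_of_le hT.le] at ht
      simp only [neg_neg]
      rw [max_eq_left ht.1, max_eq_right (neg_nonpos.2 ht.1)]
    · refine intervalIntegral.integral_congr fun x hx => ?_
      rw [uIcc_of_le hℓ.le] at hx
      rw [max_eq_left hx.1, max_eq_right (neg_nonpos.2 hx.1)]
  have h5 : ∫ t in 0..T, ∫ x in 0..ℓ, transported T w f t x * g t x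
      = -∫ y, f y * φ (max (-y) 0, max y 0) := by
    rw [h2, ← integral_neg]
    exact integral_congr_ae (.of_forall h3)
  change (∫ t in 0..T, ∫ x in 0..ℓ, transported T w f t x * g t x) + _ + _ = 0
  rw [h5, h4]
  ring

end Weak

/-! ### Linear transport in the class of densities -/

/-- With `q = max p 2`, the pointwise bound `|g|^q ≤ N^(q-2) g²` passes from `L²` up to `L^q`, and
finiteness of the measure passes from `L^q` down to `L^p`. -/
lemma tendsto_eLpNorm_of_integral_sq {α ι : Type*} {mα : MeasurableSpace α} {μ : Measure α}
    [IsFiniteMeasure μ] {l : Filter ι} {g : ι → α → ℝ} {N : ℝ} {p : ℝ≥0∞} (hp : p ≠ ∞)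
    (hm : ∀ᶠ i in l, AEStronglyMeasurable (g i) μ) (hN : ∀ᶠ i in l, ∀ᵐ x ∂μ, |g i x| ≤ N)
    (h : Tendsto (fun i => ∫ x, g i x ^ 2 ∂μ) l (𝓝 0)) :
    Tendsto (fun i => eLpNorm (g i) p μ) l (𝓝 0) := by
  -- The zero measure gives no sign for `N`, and `μ univ` raised to a negative power, as occurs for
  -- `p = 0`, would be infinite.
  rcases eq_or_ne μ 0 with rfl | hμ
  · simpa using tendsto_const_nhds
  set q := max p 2 with hq
  have hqt : q ≠ ∞ := by simp [hq, hp]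
  have h2q : (2 : ℝ≥0∞) ≤ q := le_max_right _ _
  have hq0 : q ≠ 0 := (lt_of_lt_of_le (by norm_num) h2q).ne'
  have hq2 : 2 ≤ q.toReal := by simpa using ENNReal.toReal_mono hqt h2q
  have hqpos : 0 < q.toReal := by linarith
  have h1 : Tendsto (fun i => ENNReal.ofReal (N ^ (q.toReal - 2) * ∫ x, g i x ^ 2 ∂μ)
      ^ (1 / q.toReal)) l (𝓝 0) := by
    have a1 := h.const_mul (N ^ (q.toReal - 2))
    rw [mul_zero] at a1
    have a2 := (ENNReal.continuous_rpow_const (y := 1 / q.toReal)).tendsto _ |>.comp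
      ((ENNReal.continuous_ofReal.tendsto _).comp a1)
    simpa [Function.comp_def, hqpos] using a2
  have h2 : Tendsto (fun i => ENNReal.ofReal (N ^ (q.toReal - 2) * ∫ x, g i x ^ 2 ∂μ)
      ^ (1 / q.toReal) * μ univ ^ (1 / p.toReal - 1 / q.toReal)) l (𝓝 0) := by
    have hne : μ univ ^ (1 / p.toReal - 1 / q.toReal) ≠ ∞ := by
      refine ENNReal.rpow_ne_top_of_ne_zero ?_ (measure_ne_top _ _)
      simpa using hμ
    simpa using ENNReal.Tendsto.mul_const h1 (Or.inr hne)
  refine tendsto_of_tendsto_of_tendsto_of_le_of_le' tendsto_const_nhds h2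
    (.of_forall fun _ => bot_le) ?_
  filter_upwards [hm, hN] with i him hiN
  refine (eLpNorm_le_eLpNorm_mul_rpow_measure_univ (le_max_left p 2) him).trans ?_
  refine mul_le_mul_left ?_ _
  rw [eLpNorm_eq_lintegral_rpow_enorm_toReal hq0 hqt]
  refine ENNReal.rpow_le_rpow ?_ (by positivity)
  have hint : Integrable (fun x => g i x ^ 2) μ := by
    refine Integrable.of_bound (him.pow 2) (N ^ 2) ?_
    filter_upwards [hiN] with x hx
    rw [norm_pow]
    exact pow_le_pow_left₀ (norm_nonneg _) hx 2
  rw [← integral_const_mul]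
  have hN0 : 0 ≤ N := by
    have : (ae μ).NeBot := ae_neBot.2 hμ
    obtain ⟨x, hx⟩ := hiN.exists
    exact (abs_nonneg _).trans hx
  rw [ofReal_integral_eq_lintegral_ofReal (hint.const_mul _)
    (.of_forall fun x => by positivity)]
  refine lintegral_mono_ae ?_
  filter_upwards [hiN] with x hx
  rw [← ofReal_norm, ENNReal.ofReal_rpow_of_nonneg (norm_nonneg _) hqpos.le]
  refine ENNReal.ofReal_le_ofReal ?_
  rw [Real.norm_eq_abs]
  calc |g i x| ^ q.toReal = |g i x| ^ (q.toReal - 2) * |g i x| ^ (2 : ℝ) := by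
        rw [← Real.rpow_add_of_nonneg (abs_nonneg _) (by linarith) (by norm_num)]
        ring_nf
    _ ≤ N ^ (q.toReal - 2) * g i x ^ 2 := by
        rw [Real.rpow_two, sq_abs]
        exact mul_le_mul_of_nonneg_right
          (Real.rpow_le_rpow (abs_nonneg _) hx (by linarith)) (sq_nonneg _)

section Density
variable {T ℓ M a B : ℝ} {K : ℝ≥0} {w : ℝ → ℝ → ℝ} {f : ℝ → ℝ} {p : ℝ≥0∞}

lemma IsDensity.exists_isCurve [Fact (1 ≤ p)] {r : ℝ → Lp ℝ p (roadMeasure ℓ)}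
    (h : IsDensity T ℓ p r) : ∃ M, IsCurve T ℓ M fun t => r t := by
  obtain ⟨M, hM⟩ := h.essBounded
  refine ⟨M, fun t _ => Lp.aestronglyMeasurable (r t), hM, fun t ht => ?_⟩
  have h1 : Tendsto (fun s => edist (r s) (r t)) (𝓝[Icc 0 T] t) (𝓝 0) :=
    tendsto_iff_edist_tendsto_0.1 (h.continuousOn t ht)
  set c := (roadMeasure ℓ) univ ^ (1 / (1 : ℝ≥0∞).toReal - 1 / p.toReal) with hc
  have h2 : Tendsto (fun s => edist (r s) (r t) * c) (𝓝[Icc 0 T] t) (𝓝 0) := by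
    have hne : c ≠ ∞ := by
      refine ENNReal.rpow_ne_top_of_nonneg ?_ (measure_ne_top _ _)
      rcases eq_or_ne p ∞ with rfl | hp
      · simp
      have h1p : 1 ≤ p.toReal := by simpa using ENNReal.toReal_mono hp (Fact.out : 1 ≤ p)
      have := inv_le_one_of_one_le₀ h1p
      simpa using this
    simpa using ENNReal.Tendsto.mul_const h1 (Or.inr hne)
  have h3 : Tendsto (fun s => eLpNorm (⇑(r s) - ⇑(r t)) 1 (roadMeasure ℓ)) (𝓝[Icc 0 T] t)
      (𝓝 0) := by
    refine tendsto_of_tendsto_of_tendsto_of_le_of_le tendsto_const_nhds h2 (fun _ => bot_le)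
      fun s => ?_
    rw [Lp.edist_def]
    exact eLpNorm_le_eLpNorm_mul_rpow_measure_univ Fact.out
      ((Lp.aestronglyMeasurable _).sub (Lp.aestronglyMeasurable _))
  have h4 := (ENNReal.tendsto_toReal ENNReal.zero_ne_top).comp h3
  rw [ENNReal.toReal_zero] at h4
  refine h4.congr fun s => ?_
  simp only [Function.comp_apply]
  rw [eLpNorm_one_eq_lintegral_enorm]
  exact (integral_norm_eq_lintegral_enorm
    ((Lp.aestronglyMeasurable (r s)).sub (Lp.aestronglyMeasurable (r t)))).symm

lemma memLp_transported (p : ℝ≥0∞) (hw : IsSpeed a B K w) (hT : 0 < T) (hf : IsLabelData T ℓ M f)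
    {t : ℝ} (ht : t ∈ Icc 0 T) : MemLp (transported T w f t) p (roadMeasure ℓ) :=
  MemLp.of_bound (measurable_transported hw hT hf ht).aestronglyMeasurable (charConst T a K * M)
    (ae_restrict_of_ae (abs_transported_le hw hT hf ht))

/-- The transported density as a curve in `L^p` of the road. -/
noncomputable def transportedLp (T ℓ : ℝ) (p : ℝ≥0∞) (w : ℝ → ℝ → ℝ) (f : ℝ → ℝ) (t : ℝ) :
    Lp ℝ p (roadMeasure ℓ) :=
  open Classical in
  if h : MemLp (transported T w f t) p (roadMeasure ℓ) then h.toLp else 0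

lemma coeFn_transportedLp (hw : IsSpeed a B K w) (hT : 0 < T) (hf : IsLabelData T ℓ M f)
    {t : ℝ} (ht : t ∈ Icc 0 T) :
    transportedLp T ℓ p w f t =ᵐ[roadMeasure ℓ] transported T w f t := by
  rw [transportedLp, dif_pos (memLp_transported p hw hT hf ht)]
  exact MemLp.coeFn_toLp _

lemma isDensity_transportedLp [Fact (1 ≤ p)] (hp : p ≠ ∞) (hw : IsSpeed a B K w) (hT : 0 < T)
    (hf : IsLabelData T ℓ M f) : IsDensity T ℓ p (transportedLp T ℓ p w f) := by
  refine ⟨fun t ht => ?_, charConst T a K * M, fun t ht => ?_⟩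
  · rw [ContinuousWithinAt, tendsto_iff_edist_tendsto_0]
    have hlim : Tendsto (fun s => ∫ x, (transported T w f s x - transported T w f t x) ^ 2
        ∂(roadMeasure ℓ)) (𝓝[Icc 0 T] t) (𝓝 0) := by
      refine squeeze_zero' (.of_forall fun s => integral_nonneg fun x => sq_nonneg _) ?_
        (tendsto_integral_transported_sub_sq hw hT hf ht)
      filter_upwards [self_mem_nhdsWithin] with s hs
      refine setIntegral_le_integral ?_ (.of_forall fun x => sq_nonneg _)
      have hi : Integrable fun x => transported T w f s x - transported T w f t x :=
        (integrable_transported hw hT hf hs).sub (integrable_transported hw hT hf ht)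
      have := (integrable_transported_mul hw hT hf hs hi).sub
        (integrable_transported_mul hw hT hf ht hi)
      refine this.congr (.of_forall fun x => ?_)
      simp only [Pi.sub_apply]
      ring
    have := tendsto_eLpNorm_of_integral_sq (p := p) (N := charConst T a K * M + charConst T a K * M)
      (g := fun s x => transported T w f s x - transported T w f t x) hp
      (by
        filter_upwards [self_mem_nhdsWithin] with s hs
        exact ((measurable_transported hw hT hf hs).sub
          (measurable_transported hw hT hf ht)).aestronglyMeasurable)
      (by
        filter_upwards [self_mem_nhdsWithin] with s hs
        filter_upwards [ae_restrict_of_ae (abs_transported_le hw hT hf hs),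
          ae_restrict_of_ae (abs_transported_le hw hT hf ht)] with x h1 h2
        exact (abs_sub _ _).trans (add_le_add h1 h2)) hlim
    refine this.congr' ?_
    filter_upwards [self_mem_nhdsWithin] with s hs
    rw [transportedLp, transportedLp, dif_pos (memLp_transported p hw hT hf hs),
      dif_pos (memLp_transported p hw hT hf ht), Lp.edist_toLp_toLp]
    rfl
  · filter_upwards [coeFn_transportedLp (p := p) hw hT hf ht,
      ae_restrict_of_ae (abs_transported_le hw hT hf ht)] with x h1 h2
    rwa [h1]

lemma IsCurve.congr {r r' : ℝ → ℝ → ℝ} (h : IsCurve T ℓ M r)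
    (he : ∀ t ∈ Icc 0 T, r' t =ᵐ[roadMeasure ℓ] r t) : IsCurve T ℓ M r' where
  meas t ht := (h.meas t ht).congr (he t ht).symm
  bound t ht := by
    filter_upwards [h.bound t ht, he t ht] with x h1 h2
    rwa [h2]
  cont t ht := by
    refine (h.cont t ht).congr' ?_
    filter_upwards [self_mem_nhdsWithin] with s hs
    refine integral_congr_ae ?_
    filter_upwards [he s hs, he t ht] with x h1 h2
    rw [h1, h2]

lemma isCurve_transported (hw : IsSpeed a B K w) (hT : 0 < T) (hf : IsLabelData T ℓ M f) :
    IsCurve T ℓ (charConst T a K * M) (transported T w f) where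
  meas t ht := (measurable_transported hw hT hf ht).aestronglyMeasurable
  bound t ht := ae_restrict_of_ae (abs_transported_le hw hT hf ht)
  cont := by
    -- Continuity in `L¹` is the case `p = 1` of `isDensity_transportedLp`.
    have : Fact ((1 : ℝ≥0∞) ≤ 1) := ⟨le_rfl⟩
    obtain ⟨M', hM'⟩ := (isDensity_transportedLp ENNReal.one_ne_top hw hT hf).exists_isCurve
    exact (hM'.congr fun t ht => (coeFn_transportedLp hw hT hf ht).symm).cont

lemma ae_uIoc_of_road {ℓ : ℝ} (hℓ : 0 ≤ ℓ) {P : ℝ → Prop} (h : ∀ᵐ x ∂(roadMeasure ℓ), P x) :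
    ∀ᵐ x ∂(volume.restrict (uIoc 0 ℓ)), P x := by
  rwa [uIoc_of_le hℓ, ← restrict_Ioo_eq_restrict_Ioc]

lemma IsWeakSolution.congr (hT : 0 ≤ T) (hℓ : 0 ≤ ℓ) {w w' r r' : ℝ → ℝ → ℝ} {r₀ r₀' u u' : ℝ → ℝ}
    (h : IsWeakSolution T ℓ w r₀ u r)
    (hw : ∀ t ∈ Icc 0 T, ∀ x ∈ Icc 0 ℓ, w' t x = w t x)
    (hr : ∀ t ∈ Icc 0 T, ∀ᵐ x ∂(roadMeasure ℓ), r' t x = r t x)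
    (hr₀ : ∀ᵐ x ∂(roadMeasure ℓ), r₀' x = r₀ x)
    (hu : ∀ᵐ t ∂(volume.restrict (Ioo 0 T)), u' t = u t) :
    IsWeakSolution T ℓ w' r₀' u' r' := by
  intro φ hφ hφT hφℓ
  refine Eq.trans ?_ (h φ hφ hφT hφℓ)
  congr 1
  · congr 1
    · refine intervalIntegral.integral_congr fun t ht => ?_
      rw [uIcc_of_le hT] at ht
      refine intervalIntegral.integral_congr_ae_restrict ?_
      filter_upwards [ae_uIoc_of_road hℓ (hr t ht),
        ae_restrict_mem measurableSet_uIoc] with x hx hxm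
      rw [uIoc_of_le hℓ] at hxm
      rw [hx, hw t ht x (Ioc_subset_Icc_self hxm)]
    · refine intervalIntegral.integral_congr_ae_restrict ?_
      filter_upwards [ae_uIoc_of_road hℓ hr₀] with x hx
      rw [hx]
  · refine intervalIntegral.integral_congr_ae_restrict ?_
    filter_upwards [ae_uIoc_of_road hT hu] with x hx
    rw [hx]

/-- The data cancel in the difference of two solutions. Subtracting the double integrals needs
integrability in time of each, which follows from their continuity. -/
theorem IsWeakSolution.ae_eq (hT : 0 < T) (hℓ : 0 < ℓ) {M' : ℝ} {r r' : ℝ → ℝ → ℝ} {r₀ u : ℝ → ℝ}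
    (hw : IsSpeed a B K w) (hr : IsCurve T ℓ M r) (hr' : IsCurve T ℓ M' r')
    (h : IsWeakSolution T ℓ w r₀ u r) (h' : IsWeakSolution T ℓ w r₀ u r') {t : ℝ}
    (ht : t ∈ Icc 0 T) : ∀ᵐ x ∂(roadMeasure ℓ), r t x = r' t x := by
  have hnull : IsWeakNull T ℓ w fun t x => r t x - r' t x := by
    intro φ hφ hφT hφℓ
    have hgc := hw.continuous_materialDeriv hφ
    obtain ⟨G, hG⟩ := (isCompact_Icc.prod isCompact_Icc).exists_bound_of_continuousOn
      (hgc.continuousOn (s := Icc 0 T ×ˢ Icc 0 ℓ))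
    have hgm : ∀ t ∈ Icc 0 T, AEStronglyMeasurable (materialDeriv w φ t) (roadMeasure ℓ) :=
      fun t _ => (hgc.comp (by fun_prop : Continuous fun x : ℝ => (t, x))).aestronglyMeasurable
    have hgB : ∀ t ∈ Icc 0 T, ∀ x ∈ Ioo 0 ℓ, |materialDeriv w φ t x| ≤ G := fun t ht x hx =>
      hG (t, x) ⟨ht, Ioo_subset_Icc_self hx⟩
    have hgt : ∀ x ∈ Ioo 0 ℓ, ContinuousOn (fun t => materialDeriv w φ t x) (Icc 0 T) :=
      fun x _ => (hgc.comp (by fun_prop : Continuous fun t : ℝ => (t, x))).continuousOn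
    have hi : ∀ {N : ℝ} {r : ℝ → ℝ → ℝ}, IsCurve T ℓ N r → IntervalIntegrable
        (fun t => ∫ x, r t x * materialDeriv w φ t x ∂(roadMeasure ℓ)) volume 0 T := fun hr => by
      refine ContinuousOn.intervalIntegrable ?_
      rw [uIcc_of_le hT.le]
      exact hr.continuousOn_integral_mul hgm hgB hgt
    have e1 := h φ hφ hφT hφℓ
    have e2 := h' φ hφ hφT hφℓ
    change (∫ t in 0..T, ∫ x in 0..ℓ, r t x * materialDeriv w φ t x) + _ + _ = 0 at e1
    change (∫ t in 0..T, ∫ x in 0..ℓ, r' t x * materialDeriv w φ t x) + _ + _ = 0 at e2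
    change ∫ t in 0..T, ∫ x in 0..ℓ, (r t x - r' t x) * materialDeriv w φ t x = 0
    have e3 : ∫ t in 0..T, ∫ x in 0..ℓ, (r t x - r' t x) * materialDeriv w φ t x
        = (∫ t in 0..T, ∫ x in 0..ℓ, r t x * materialDeriv w φ t x)
          - ∫ t in 0..T, ∫ x in 0..ℓ, r' t x * materialDeriv w φ t x := by
      simp only [intervalIntegral_eq_road hℓ.le]
      rw [← intervalIntegral.integral_sub (hi hr) (hi hr')]
      refine intervalIntegral.integral_congr fun t ht => ?_
      rw [uIcc_of_le hT.le] at ht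
      simp only [sub_mul]
      exact integral_sub (hr.integrable_mul ht (hgm t ht) (hgB t ht))
        (hr'.integrable_mul ht (hgm t ht) (hgB t ht))
    rw [e3]
    linarith
  filter_upwards [hnull.ae_eq_zero hT hℓ.le (hr.sub hr') hw ht] with x hx
  linarith

/-- A pair of data for the initial-boundary value problem is encoded by a function of labels. -/
lemma exists_labelData (hT : 0 < T) (hℓ : 0 < ℓ) {m M : ℝ} (hm : m ≤ 0) (hM : 0 ≤ M) {r₀ u : ℝ → ℝ}
    (hr₀ : AEMeasurable r₀ (roadMeasure ℓ)) (hu : AEMeasurable u (volume.restrict (Ioo 0 T)))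
    (hr₀b : ∀ᵐ x ∂(roadMeasure ℓ), r₀ x ∈ Icc m M)
    (hub : ∀ᵐ t ∂(volume.restrict (Ioo 0 T)), u t ∈ Icc m M) :
    ∃ f, IsLabelData T ℓ (max (-m) M) f ∧ (∀ y, m ≤ f y) ∧
      (∀ᵐ x ∂(roadMeasure ℓ), r₀ x = f x) ∧
      ∀ᵐ t ∂(volume.restrict (Ioo 0 T)), u t = f (-t) := by
  -- Clipping measurable representatives to `[m, M]` makes the almost everywhere bounds hold
  -- everywhere. The choice `m = 0` preserves nonnegativity for the traffic, `m = -M` serves the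
  -- signed truck data.
  set clip : ℝ → ℝ := fun z => max m (min M z) with hclip
  have hclipm : ∀ z, m ≤ clip z := fun z => le_max_left _ _
  have hclipM : ∀ z, clip z ≤ M := fun z => max_le (hm.trans hM) (min_le_left _ _)
  have hclipid : ∀ z ∈ Icc m M, clip z = z := fun z hz => by
    simp [hclip, hz.1, hz.2]
  have hclipmeas : Measurable clip := by fun_prop
  set f : ℝ → ℝ := (Ioo 0 ℓ).piecewise (fun y => clip (hr₀.mk r₀ y))
    ((Ioo (-T) 0).indicator fun y => clip (hu.mk u (-y))) with hf
  have hfb : ∀ y, m ≤ f y ∧ f y ≤ M := by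
    intro y
    by_cases h1 : y ∈ Ioo 0 ℓ
    · rw [hf, piecewise_eq_of_mem _ _ _ h1]
      exact ⟨hclipm _, hclipM _⟩
    · rw [hf, piecewise_eq_of_notMem _ _ _ h1]
      by_cases h2 : y ∈ Ioo (-T) 0
      · rw [indicator_of_mem h2]
        exact ⟨hclipm _, hclipM _⟩
      · rw [indicator_of_notMem h2]
        exact ⟨hm, hM⟩
  refine ⟨f, ⟨?_, fun y => ?_, fun y hy => ?_⟩, fun y => (hfb y).1, ?_, ?_⟩
  · exact Measurable.piecewise measurableSet_Ioo (hclipmeas.comp hr₀.measurable_mk)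
      ((hclipmeas.comp (hu.measurable_mk.comp measurable_neg)).indicator measurableSet_Ioo)
  · exact abs_le.2 ⟨by linarith [le_max_left (-m) M, (hfb y).1],
      (hfb y).2.trans (le_max_right _ _)⟩
  · have h1 : y ∉ Ioo 0 ℓ := fun h => hy ⟨by linarith [h.1], h.2⟩
    rw [hf, piecewise_eq_of_notMem _ _ _ h1]
    by_cases h2 : y ∈ Ioo (-T) 0
    · rcases lt_or_ge y ℓ with h | h
      · exact absurd ⟨h2.1, h⟩ hy
      · exact absurd (h2.2.trans hℓ) (not_lt.2 h)
    · rw [indicator_of_notMem h2]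
  · filter_upwards [hr₀.ae_eq_mk, hr₀b, ae_restrict_mem measurableSet_Ioo] with x h1 h2 h3
    rw [hf, piecewise_eq_of_mem _ _ _ h3, ← h1, hclipid _ h2]
  · filter_upwards [hu.ae_eq_mk, hub, ae_restrict_mem measurableSet_Ioo] with t h1 h2 h3
    have h4 : -t ∉ Ioo 0 ℓ := fun h => by linarith [h.1, h3.1]
    have h5 : -t ∈ Ioo (-T) 0 := ⟨by linarith [h3.2], by linarith [h3.1]⟩
    rw [hf, piecewise_eq_of_notMem _ _ _ h4, indicator_of_mem h5, neg_neg, ← h1, hclipid _ h2]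

lemma exists_ae_bound {α : Type*} {mα : MeasurableSpace α} {μ : Measure α} {g : α → ℝ}
    (hg : MemLp g ∞ μ) : ∃ M, 0 ≤ M ∧ ∀ᵐ x ∂μ, |g x| ≤ M := by
  refine ⟨(eLpNorm g ∞ μ).toReal, ENNReal.toReal_nonneg, ?_⟩
  have h := hg.2
  rw [eLpNorm_exponent_top] at h ⊢
  filter_upwards [ae_le_eLpNormEssSup (f := g) (μ := μ)] with x hx
  have := ENNReal.toReal_mono h.ne hx
  simpa using this

end Density

/-! ### The traffic density -/

section Traffic
variable {T ℓ M a B : ℝ} {K : ℝ≥0} {f : ℝ → ℝ}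

/-- The extension of a function on `[0,T]` that is constant to both sides. -/
noncomputable def clampTime (hT : 0 < T) (g : ℝ → ℝ) (t : ℝ) : ℝ := g (projIcc 0 T hT.le t)

lemma clampTime_of_mem (hT : 0 < T) (g : ℝ → ℝ) {t : ℝ} (ht : t ∈ Icc 0 T) :
    clampTime hT g t = g t := by
  rw [clampTime, projIcc_of_mem hT.le ht]

lemma continuous_clampTime (hT : 0 < T) {g : ℝ → ℝ} (hg : ContinuousOn g (Icc 0 T)) :
    Continuous (clampTime hT g) :=
  (continuousOn_iff_continuous_domRestrict.1 hg).comp continuous_projIcc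

lemma isSpeed_of_time {g : ℝ → ℝ} (ha : 0 < a) (hg : Continuous g) (hB : ∀ t, g t ∈ Icc a B) :
    IsSpeed a B 0 fun t _ => g t where
  pos := ha
  cont := hg.comp continuous_fst
  lower t _ := (hB t).1
  upper t _ := (hB t).2
  lip _ := LipschitzWith.const _
  left _ _ _ := rfl

/-- The mass on the road at time `t` when data `f` are transported with velocity `w`. -/
noncomputable def roadMass (T ℓ : ℝ) (f : ℝ → ℝ) (w : ℝ → ℝ → ℝ) (t : ℝ) : ℝ :=
  ∫ x, transported T w f t x ∂(roadMeasure ℓ)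

lemma roadMass_eq {w : ℝ → ℝ → ℝ} (hw : IsSpeed a B K w) (hT : 0 < T) {t : ℝ}
    (ht : t ∈ Icc 0 T) :
    roadMass T ℓ f w t = ∫ y, f y * (Ioo 0 ℓ).indicator (fun _ => 1) (characteristic T w t y) := by
  rw [← integral_transported_road hw hT f (fun _ => 1) ht]
  simp [roadMass]

lemma integrable_mul_indicator {w : ℝ → ℝ → ℝ} (hw : IsSpeed a B K w) (hT : 0 < T)
    (hf : IsLabelData T ℓ M f) {t : ℝ} (ht : t ∈ Icc 0 T) : Integrable fun y =>
      f y * (Ioo 0 ℓ).indicator (fun _ => (1 : ℝ)) (characteristic T w t y) := by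
  refine hf.integrable.mul_bdd (c := 1) ?_ (.of_forall fun y => ?_)
  · exact ((measurable_const.indicator measurableSet_Ioo).comp
      (hw.continuous_characteristic hT ht).measurable).aestronglyMeasurable
  · by_cases h : characteristic T w t y ∈ Ioo 0 ℓ <;> simp [h]

lemma roadMass_mem {w : ℝ → ℝ → ℝ} (hw : IsSpeed a B K w) (hT : 0 < T)
    (hf : IsLabelData T ℓ M f) (hf0 : ∀ y, 0 ≤ f y) {t : ℝ} (ht : t ∈ Icc 0 T) :
    roadMass T ℓ f w t ∈ Icc 0 (∫ y, f y) := by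
  rw [roadMass_eq hw hT ht]
  constructor
  · exact integral_nonneg fun y => mul_nonneg (hf0 y)
      (indicator_nonneg (fun _ _ => zero_le_one) _)
  · refine integral_mono (integrable_mul_indicator hw hT hf ht) hf.integrable fun y => ?_
    exact mul_le_of_le_one_right (hf0 y)
      (indicator_le' (fun _ _ => le_rfl) (fun _ _ => zero_le_one) _)

lemma continuousOn_roadMass {w : ℝ → ℝ → ℝ} (hw : IsSpeed a B K w) (hT : 0 < T)
    (hf : IsLabelData T ℓ M f) : ContinuousOn (roadMass T ℓ f w) (Icc 0 T) :=
  (isCurve_transported hw hT hf).continuousOn_integral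

lemma IsSpeed.characteristic_nonpos {w : ℝ → ℝ → ℝ} (hw : IsSpeed a B K w) (hT : 0 < T) {t y : ℝ}
    (ht : t ∈ Icc 0 T) (hy : -T ≤ y) (hty : y ≤ -t) : characteristic T w t y ≤ 0 := by
  have hyT : -y ∈ Icc 0 T := ⟨by linarith [ht.1], by linarith⟩
  have h0 : characteristic T w (-y) y = 0 := by simpa using hw.characteristic_entry hT hyT
  have h1 := ((hw.isTrajectory_characteristic hT y).sub_mem hw ht.1 (by linarith : t ≤ -y) hyT.2).1
  have h2 := mul_nonneg hw.pos.le (by linarith : 0 ≤ -y - t)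
  rw [h0] at h1
  linarith

lemma IsSpeed.characteristic_start {w : ℝ → ℝ → ℝ} (hw : IsSpeed a B K w) (hT : 0 < T) {y : ℝ}
    (hy : -T ≤ y) : characteristic T w (max (-y) 0) y = max y 0 := by
  rcases le_total 0 y with h | h
  · rw [max_eq_right (by linarith), max_eq_left h, hw.characteristic_zero hT h]
  · rw [max_eq_left (by linarith), max_eq_right h]
    simpa using hw.characteristic_entry hT (s := -y) ⟨by linarith, by linarith⟩

lemma IsSpeed.characteristic_pos {w : ℝ → ℝ → ℝ} (hw : IsSpeed a B K w) (hT : 0 < T) {t y : ℝ}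
    (ht : t ∈ Icc 0 T) (hy : -T ≤ y) (hty : -t < y) : 0 < characteristic T w t y := by
  have he : max (-y) 0 ≤ t := max_le (by linarith) ht.1
  have h1 := ((hw.isTrajectory_characteristic hT y).sub_mem hw (le_max_right _ _) he ht.2).1
  simp only [hw.characteristic_start hT hy] at h1
  rcases le_or_gt y 0 with h | h
  · have h2 : 0 < a * (t - max (-y) 0) := by
      refine mul_pos hw.pos ?_
      rw [max_eq_left (by linarith)]
      linarith
    linarith [le_max_right y 0]
  · have h2 := mul_nonneg hw.pos.le (sub_nonneg.2 he)
    linarith [le_max_left y 0]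

/-- Both characteristics are at the same point at the entry time `max (-y) 0`, so the comparison
starts there with error zero. Integrating the exponential bound on the velocities gains the factor
`1 / lam`, the source of the contraction. -/
lemma abs_characteristic_sub_le_exp {g g' : ℝ → ℝ} (hT : 0 < T) (hw : IsSpeed a B 0 fun t _ => g t)
    (hw' : IsSpeed a B 0 fun t _ => g' t) {D lam : ℝ} (hlam : 0 < lam) (hD : 0 ≤ D)
    (h : ∀ t ∈ Icc 0 T, |g t - g' t| ≤ D * Real.exp (lam * t)) {t y : ℝ} (ht : t ∈ Icc 0 T)
    (hy : -T ≤ y) (hty : -t < y) :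
    |characteristic T (fun t _ => g t) t y - characteristic T (fun t _ => g' t) t y|
      ≤ D / lam * Real.exp (lam * t) := by
  have he : max (-y) 0 ≤ t := max_le (by linarith) ht.1
  have he0 : 0 ≤ max (-y) 0 := le_max_right _ _
  have hX := hw.isTrajectory_characteristic hT y
  have hX' := hw'.isTrajectory_characteristic hT y
  have hs : ∀ s ∈ Icc (max (-y) 0) t, s ∈ Icc 0 T := fun s hs => ⟨he0.trans hs.1, hs.2.trans ht.2⟩
  refine image_norm_le_of_norm_deriv_right_le_deriv_boundary (a := max (-y) 0) (b := t)
    (f := fun s => characteristic T (fun t _ => g t) s y - characteristic T (fun t _ => g' t) s y)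
    (f' := fun s => g s - g' s) (B := fun s => D / lam * Real.exp (lam * s))
    (B' := fun s => D * Real.exp (lam * s)) ?_ ?_ ?_ ?_ ?_ ⟨he, le_rfl⟩
  · exact (hX.continuousOn.mono hs).sub (hX'.continuousOn.mono hs)
  · intro s hsm
    exact ((hX s (hs s (Ico_subset_Icc_self hsm))).sub
      (hX' s (hs s (Ico_subset_Icc_self hsm)))).hasDerivWithinAt
  · simp only [hw.characteristic_start hT hy, hw'.characteristic_start hT hy, sub_self, norm_zero]
    positivity
  · intro s
    have := (((hasDerivAt_id s).const_mul lam).exp).const_mul (D / lam)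
    simp only [id, mul_one] at this
    have e : D / lam * (Real.exp (lam * s) * lam) = D * Real.exp (lam * s) := by field_simp
    rwa [e] at this
  · intro s hsm
    exact h s (hs s (Ico_subset_Icc_self hsm))

/-- Labels `y > -t` have entered for both velocities and labels `y ≤ -t` for neither. The masses can
thus differ only through labels that have passed the exit for one velocity and not for the other;
these land within `δ` of `ℓ`, and the antilipschitz bound controls the preimage of that strip. -/
lemma abs_roadMass_sub_le {w w' : ℝ → ℝ → ℝ} (hT : 0 < T) (hw : IsSpeed a B K w)
    (hw' : IsSpeed a B K w') (hf : IsLabelData T ℓ M f) {t δ : ℝ} (ht : t ∈ Icc 0 T) (hδ : 0 ≤ δ)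
    (h : ∀ y, -T ≤ y → -t < y → |characteristic T w t y - characteristic T w' t y| ≤ δ) :
    |roadMass T ℓ f w t - roadMass T ℓ f w' t| ≤ M * (charConst T a K * (2 * δ)) := by
  have hM0 : 0 ≤ M := (abs_nonneg _).trans (hf.bound 0)
  set χ : ℝ → ℝ := (Icc (ℓ - δ) (ℓ + δ)).indicator fun _ => 1 with hχ
  have hχi : Integrable χ := (integrable_indicator_iff measurableSet_Icc).2
    (integrableOn_const (by simp))
  have hχint : ∫ x, χ x = 2 * δ := by
    rw [hχ, integral_indicator measurableSet_Icc, setIntegral_const, smul_eq_mul, mul_one,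
      Real.volume_real_Icc_of_le (by linarith)]
    ring
  have hχ0 : ∀ x, 0 ≤ χ x := indicator_nonneg fun _ _ => zero_le_one
  have hZc := hw.continuous_characteristic hT ht
  have hZa := hw.antilipschitz_characteristic hT ht
  have i1 := integrable_mul_indicator hw hT hf ht
  have i2 := integrable_mul_indicator hw' hT hf ht
  rw [roadMass_eq hw hT ht, roadMass_eq hw' hT ht, ← integral_sub i1 i2]
  refine (abs_integral_le_integral_abs).trans ?_
  have key : ∀ y, |f y * (Ioo 0 ℓ).indicator (fun _ => (1 : ℝ)) (characteristic T w t y)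
      - f y * (Ioo 0 ℓ).indicator (fun _ => (1 : ℝ)) (characteristic T w' t y)|
      ≤ M * χ (characteristic T w t y) := by
    intro y
    have hR := mul_nonneg hM0 (hχ0 (characteristic T w t y))
    by_cases hy : y ∈ Ioo (-T) ℓ
    swap
    · rw [hf.supp y hy]
      simpa using hR
    rcases le_or_gt y (-t) with hyt | hyt
    · rw [indicator_of_notMem fun hm => absurd hm.1
        (not_lt.2 (hw.characteristic_nonpos hT ht hy.1.le hyt)),
        indicator_of_notMem fun hm => absurd hm.1
        (not_lt.2 (hw'.characteristic_nonpos hT ht hy.1.le hyt))]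
      simpa using hR
    have p1 := hw.characteristic_pos hT ht hy.1.le hyt
    have p2 := hw'.characteristic_pos hT ht hy.1.le hyt
    have hd := abs_le.1 (h y hy.1.le hyt)
    have hfy := hf.bound y
    rcases lt_or_ge (characteristic T w t y) ℓ with h1 | h1 <;>
      rcases lt_or_ge (characteristic T w' t y) ℓ with h2 | h2
    · rw [indicator_of_mem (mem_Ioo.2 ⟨p1, h1⟩), indicator_of_mem (mem_Ioo.2 ⟨p2, h2⟩)]
      simpa using hR
    · have : χ (characteristic T w t y) = 1 :=
        indicator_of_mem (mem_Icc.2 ⟨by linarith [hd.1], by linarith⟩) _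
      rw [indicator_of_mem (mem_Ioo.2 ⟨p1, h1⟩), indicator_of_notMem fun hm => absurd hm.2 (not_lt.2 h2), this]
      simpa using hfy
    · have : χ (characteristic T w t y) = 1 :=
        indicator_of_mem (mem_Icc.2 ⟨by linarith, by linarith [hd.2]⟩) _
      rw [indicator_of_notMem fun hm => absurd hm.2 (not_lt.2 h1), indicator_of_mem (mem_Ioo.2 ⟨p2, h2⟩), this]
      simpa using hfy
    · rw [indicator_of_notMem fun hm => absurd hm.2 (not_lt.2 h1),
        indicator_of_notMem fun hm => absurd hm.2 (not_lt.2 h2)]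
      simpa using hR
  calc _ ≤ ∫ y, M * χ (characteristic T w t y) :=
        integral_mono (i1.sub i2).abs
          ((integrable_comp_of_antilipschitz hZc hZa hχi).const_mul M) key
    _ ≤ M * (charConst T a K * (2 * δ)) := by
        rw [integral_const_mul, ← hχint]
        exact mul_le_mul_of_nonneg_left
          (integral_comp_le_of_antilipschitz hZc hZa hχi hχ0) hM0

/-- The load `W` for which `W` is the mass transported with velocity `vc (t, W t)` exists and is
unique. -/
theorem exists_unique_load (hT : 0 < T) (hf : IsLabelData T ℓ M f) {vc : ℝ → ℝ → ℝ} (ha : 0 < a)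
    (hvc : Continuous fun z : ℝ × ℝ => vc z.1 z.2) (hvb : ∀ t y, vc t y ∈ Icc a B)
    (hvl : ∀ t, LipschitzWith K (vc t)) :
    ∃ W : ℝ → ℝ, Continuous W ∧ (∀ t ∈ Icc 0 T, W t = roadMass T ℓ f (fun t _ => vc t (W t)) t) ∧
      ∀ W' : ℝ → ℝ, ContinuousOn W' (Icc 0 T) →
        (∀ t ∈ Icc 0 T, W' t = roadMass T ℓ f (fun t _ => vc t (clampTime hT W' t)) t) →
        W = clampTime hT W' := by
  have hM0 : 0 ≤ M := (abs_nonneg _).trans (hf.bound 0)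
  have hspeed : ∀ {W : ℝ → ℝ}, Continuous W → IsSpeed a B 0 fun t _ => vc t (W t) := fun {W} hW =>
    isSpeed_of_time ha (hvc.comp (continuous_id.prodMk hW)) fun t => hvb t _
  -- `C / lam` will be the Lipschitz constant of the load map, and `lam = 2 C + 1` makes it at most
  -- `1/2`.
  set C : ℝ := M * charConst T a 0 * 2 * K with hC
  have hC0 : 0 ≤ C := by positivity
  set lam : ℝ := 2 * C + 1 with hlam
  have hlam0 : 0 < lam := by positivity
  -- The iteration runs on `V = exp (-lam t) W`, so the plain supremum distance of `V` is the
  -- weighted distance of loads.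
  set load : C(Icc 0 T, ℝ) → ℝ → ℝ := fun V t =>
    Real.exp (lam * projIcc 0 T hT.le t) * V (projIcc 0 T hT.le t) with hload
  have hloadc : ∀ V, Continuous (load V) := fun V => by
    have h1 : Continuous fun t : ℝ => (projIcc 0 T hT.le t : ℝ) :=
      continuous_subtype_val.comp continuous_projIcc
    exact (Real.continuous_exp.comp (continuous_const.mul h1)).mul
      (V.continuous.comp continuous_projIcc)
  have hloadm : ∀ V, ∀ t, ∀ ht : t ∈ Icc 0 T, load V t = Real.exp (lam * t) * V ⟨t, ht⟩ :=
    fun V t ht => by simp only [hload, projIcc_of_mem hT.le ht]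
  set Φ : C(Icc 0 T, ℝ) → C(Icc 0 T, ℝ) := fun V =>
    ⟨fun t => Real.exp (-(lam * t)) * roadMass T ℓ f (fun t _ => vc t (load V t)) t, by
      have h1 := continuousOn_iff_continuous_domRestrict.1
        (continuousOn_roadMass (hspeed (hloadc V)) hT hf)
      exact (by fun_prop : Continuous fun t : Icc 0 T => Real.exp (-(lam * t))).mul h1⟩ with hΦ
  have hcontr : ContractingWith (1 / 2 : ℝ≥0) Φ := by
    refine ⟨by norm_num [← NNReal.coe_lt_coe], LipschitzWith.of_dist_le_mul fun V V' => ?_⟩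
    rw [ContinuousMap.dist_le (by positivity)]
    intro ⟨t, ht⟩
    have hD : ∀ s ∈ Icc 0 T, |vc s (load V s) - vc s (load V' s)|
        ≤ K * dist V V' * Real.exp (lam * s) := by
      intro s hs
      refine ((hvl s).dist_le_mul _ _).trans ?_
      rw [mul_assoc, Real.dist_eq, hloadm V s hs, hloadm V' s hs, ← mul_sub, abs_mul,
        abs_of_pos (Real.exp_pos _), mul_comm (dist V V')]
      refine mul_le_mul_of_nonneg_left (mul_le_mul_of_nonneg_left ?_ (Real.exp_nonneg _)) K.2
      exact ContinuousMap.dist_apply_le_dist (f := V) (g := V') ⟨s, hs⟩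
    have h1 := abs_roadMass_sub_le hT (hspeed (hloadc V)) (hspeed (hloadc V')) hf ht
      (δ := K * dist V V' / lam * Real.exp (lam * t)) (by positivity)
      fun y hy hty => abs_characteristic_sub_le_exp hT (hspeed (hloadc V)) (hspeed (hloadc V'))
        hlam0 (by positivity) hD ht hy hty
    have h2 : dist (Φ V ⟨t, ht⟩) (Φ V' ⟨t, ht⟩) = Real.exp (-(lam * t))
        * |roadMass T ℓ f (fun t _ => vc t (load V t)) t
          - roadMass T ℓ f (fun t _ => vc t (load V' t)) t| := by
      rw [Real.dist_eq]
      simp only [hΦ, ContinuousMap.coe_mk]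
      rw [← mul_sub, abs_mul, abs_of_pos (Real.exp_pos _)]
    rw [h2]
    have hee : Real.exp (-(lam * t)) * Real.exp (lam * t) = 1 := by
      rw [← Real.exp_add]; simp
    calc _ ≤ Real.exp (-(lam * t)) * (M * (charConst T a 0
          * (2 * (K * dist V V' / lam * Real.exp (lam * t))))) :=
          mul_le_mul_of_nonneg_left h1 (Real.exp_nonneg _)
      _ = (Real.exp (-(lam * t)) * Real.exp (lam * t)) * (C / lam * dist V V') := by
          rw [hC]; ring
      _ ≤ (1 / 2 : ℝ≥0) * dist V V' := by
          rw [hee, one_mul]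
          refine mul_le_mul_of_nonneg_right ?_ dist_nonneg
          rw [div_le_iff₀ hlam0, hlam]
          push_cast
          linarith
  have hfix : Function.IsFixedPt Φ (hcontr.fixedPoint Φ) := hcontr.fixedPoint_isFixedPt
  set V := hcontr.fixedPoint Φ with hV
  have hexp : ∀ s x : ℝ, Real.exp s * (Real.exp (-s) * x) = x := fun s x => by
    rw [← mul_assoc, ← Real.exp_add]; simp
  refine ⟨load V, hloadc V, fun t ht => ?_, fun W' hW' hW'm => ?_⟩
  · have h1 : Φ V ⟨t, ht⟩ = V ⟨t, ht⟩ := by rw [hfix]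
    rw [hloadm V t ht, ← h1]
    simp only [hΦ, ContinuousMap.coe_mk]
    exact hexp _ _
  · set V' : C(Icc 0 T, ℝ) := ⟨fun t => Real.exp (-(lam * t)) * W' t, by
      have h1 := continuousOn_iff_continuous_domRestrict.1 hW'
      exact (by fun_prop : Continuous fun t : Icc 0 T => Real.exp (-(lam * t))).mul h1⟩ with hV'
    have hl : load V' = clampTime hT W' := by
      funext t
      simp only [hload, hV', ContinuousMap.coe_mk, clampTime]
      exact hexp _ _
    have hfix' : Function.IsFixedPt Φ V' := by
      ext ⟨t, ht⟩
      simp only [hΦ, ContinuousMap.coe_mk, hl]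
      rw [← hW'm t ht]
      rfl
    rw [hV, ← hcontr.fixedPoint_unique hfix', hl]

end Traffic

/-- Transport of nonnegative data keeps the mass between `0` and the total mass `m` of the data.
Hence `v` may be cut off to `[0,T] × [0,m]`, where compactness gives positive bounds and a Lipschitz
constant. A competitor solves a linear problem once its own velocity is frozen, so linear uniqueness
makes it a transported density and its mass a solution of the same fixed point equation. -/
theorem exists_unique_traffic {T ℓ : ℝ} (hT : 0 < T) (hℓ : 0 < ℓ) {p : ℝ≥0∞} [Fact (1 ≤ p)]
    (hp : p ≠ ∞) {v : ℝ → ℝ → ℝ}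
    (hv : ContDiffOn ℝ 1 (fun z : ℝ × ℝ => v z.1 z.2) (Icc 0 T ×ˢ univ))
    (hv_pos : ∀ t ∈ Icc 0 T, ∀ y, 0 < v t y) {ρ₀ u₁ : ℝ → ℝ}
    (hρ₀ : MemLp ρ₀ ∞ (roadMeasure ℓ)) (hρ₀_nonneg : ∀ᵐ x ∂(roadMeasure ℓ), 0 ≤ ρ₀ x)
    (hu₁ : MemLp u₁ ∞ (volume.restrict (Ioo 0 T)))
    (hu₁_nonneg : ∀ᵐ t ∂(volume.restrict (Ioo 0 T)), 0 ≤ u₁ t) :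
    ∃ ρ : ℝ → Lp ℝ p (roadMeasure ℓ), IsDensity T ℓ p ρ ∧
      SolvesTraffic T ℓ v ρ₀ u₁ (fun t => ρ t) ∧
      (∀ t ∈ Icc 0 T, ∀ᵐ x ∂(roadMeasure ℓ), 0 ≤ ρ t x) ∧
      ∀ ρ' : ℝ → Lp ℝ p (roadMeasure ℓ), IsDensity T ℓ p ρ' →
        SolvesTraffic T ℓ v ρ₀ u₁ (fun t => ρ' t) → ∀ t ∈ Icc 0 T, ρ' t = ρ t := by
  obtain ⟨M₁, hM₁, hb₁⟩ := exists_ae_bound hρ₀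
  obtain ⟨M₂, hM₂, hb₂⟩ := exists_ae_bound hu₁
  obtain ⟨f, hf, hf0, hfρ, hfu⟩ := exists_labelData hT hℓ (le_refl 0) (le_max_of_le_left hM₁)
    hρ₀.1.aemeasurable hu₁.1.aemeasurable
    (by
      filter_upwards [hb₁, hρ₀_nonneg] with x h1 h2
      exact ⟨h2, (le_abs_self _).trans (h1.trans (le_max_left M₁ M₂))⟩)
    (by
      filter_upwards [hb₂, hu₁_nonneg] with x h1 h2
      exact ⟨h2, (le_abs_self _).trans (h1.trans (le_max_right M₁ M₂))⟩)
  set m : ℝ := ∫ y, f y with hm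
  have hm0 : 0 ≤ m := integral_nonneg hf0
  have hvc : ContinuousOn (fun z : ℝ × ℝ => v z.1 z.2) (Icc 0 T ×ˢ univ) := hv.continuousOn
  have hcomp : IsCompact (Icc 0 T ×ˢ Icc 0 m) := isCompact_Icc.prod isCompact_Icc
  have hsub : Icc 0 T ×ˢ Icc 0 m ⊆ Icc 0 T ×ˢ univ := prod_mono le_rfl (subset_univ _)
  have hne : (Icc 0 T ×ˢ Icc 0 m).Nonempty := ⟨(0, 0), ⟨le_rfl, hT.le⟩, ⟨le_rfl, hm0⟩⟩
  obtain ⟨z₀, hz₀, hmin⟩ := hcomp.exists_isMinOn hne (hvc.mono hsub)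
  obtain ⟨z₁, hz₁, hmax⟩ := hcomp.exists_isMaxOn hne (hvc.mono hsub)
  obtain ⟨K, hK⟩ := (hv.mono hsub).exists_lipschitzOnWith one_ne_zero
    ((convex_Icc 0 T).prod (convex_Icc 0 m)) hcomp
  set vc : ℝ → ℝ → ℝ := fun t y => v (projIcc 0 T hT.le t) (projIcc 0 m hm0 y) with hvcdef
  have hpm : ∀ t y : ℝ, ((projIcc 0 T hT.le t : ℝ), (projIcc 0 m hm0 y : ℝ))
      ∈ Icc 0 T ×ˢ Icc 0 m := fun t y => ⟨(projIcc 0 T hT.le t).2, (projIcc 0 m hm0 y).2⟩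
  have hvcc : Continuous fun z : ℝ × ℝ => vc z.1 z.2 := by
    refine hvc.comp_continuous (f := fun z : ℝ × ℝ =>
      ((projIcc 0 T hT.le z.1 : ℝ), (projIcc 0 m hm0 z.2 : ℝ))) ?_ fun z => hsub (hpm _ _)
    exact ((continuous_subtype_val.comp continuous_projIcc).comp continuous_fst).prodMk
      ((continuous_subtype_val.comp continuous_projIcc).comp continuous_snd)
  have hvcb : ∀ t y, vc t y ∈ Icc (v z₀.1 z₀.2) (v z₁.1 z₁.2) := fun t y =>
    ⟨hmin (hpm t y), hmax (hpm t y)⟩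
  have hvcl : ∀ t, LipschitzWith K (vc t) := fun t => by
    refine LipschitzWith.of_dist_le_mul fun y y' => ?_
    refine (hK.dist_le_mul _ (hpm t y) _ (hpm t y')).trans
      (mul_le_mul_of_nonneg_left ?_ K.2)
    rw [dist_prod_same_left]
    exact abs_projIcc_sub_projIcc hm0
  have ha : 0 < v z₀.1 z₀.2 := hv_pos _ hz₀.1 _
  have hvid : ∀ t ∈ Icc 0 T, ∀ y ∈ Icc 0 m, vc t y = v t y := fun t ht y hy => by
    simp only [hvcdef, projIcc_of_mem hT.le ht, projIcc_of_mem hm0 hy]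
  obtain ⟨W, hWc, hW, hWuniq⟩ := exists_unique_load hT hf ha hvcc hvcb hvcl
  have hs : IsSpeed (v z₀.1 z₀.2) (v z₁.1 z₁.2) 0 fun t _ => vc t (W t) :=
    isSpeed_of_time ha (hvcc.comp (continuous_id.prodMk hWc)) fun t => hvcb t _
  refine ⟨transportedLp T ℓ p (fun t _ => vc t (W t)) f, isDensity_transportedLp hp hs hT hf, ?_,
    fun t ht => ?_, fun ρ' hρ' hsol t ht => ?_⟩
  · refine (isWeakSolution_transported hs hT hℓ hf).congr hT.le hℓ.le (fun t ht x _ => ?_)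
      (fun t ht => coeFn_transportedLp hs hT hf ht) hfρ hfu
    have h1 : ∫ s in 0..ℓ, transportedLp T ℓ p (fun t _ => vc t (W t)) f t s = W t := by
      rw [intervalIntegral_eq_road hℓ.le, hW t ht]
      exact integral_congr_ae (coeFn_transportedLp hs hT hf ht)
    rw [h1, hvid t ht]
    rw [hW t ht]
    exact roadMass_mem hs hT hf hf0 ht
  · filter_upwards [coeFn_transportedLp (p := p) hs hT hf ht] with x hx
    rw [hx]
    exact transported_nonneg hs hT ht hf0 x
  · obtain ⟨N, hN⟩ := hρ'.exists_isCurve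
    set W' : ℝ → ℝ := fun t => ∫ x, ρ' t x ∂(roadMeasure ℓ) with hW'
    have hW'c : ContinuousOn W' (Icc 0 T) := hN.continuousOn_integral
    set g : ℝ → ℝ := clampTime hT fun t => v t (W' t) with hg
    have hg0 : ContinuousOn (fun t => v t (W' t)) (Icc 0 T) :=
      hvc.comp (continuousOn_id.prodMk hW'c) fun t ht => ⟨ht, mem_univ _⟩
    have hgc : Continuous g := continuous_clampTime hT hg0
    obtain ⟨t₀, ht₀, hgmin⟩ := isCompact_Icc.exists_isMinOn (nonempty_Icc.2 hT.le) hg0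
    obtain ⟨t₁, ht₁, hgmax⟩ := isCompact_Icc.exists_isMaxOn (nonempty_Icc.2 hT.le) hg0
    have hgs : IsSpeed (v t₀ (W' t₀)) (v t₁ (W' t₁)) 0 fun t _ => g t :=
      isSpeed_of_time (hv_pos _ ht₀ _) hgc fun t =>
        ⟨hgmin (projIcc 0 T hT.le t).2, hgmax (projIcc 0 T hT.le t).2⟩
    have hsol' : IsWeakSolution T ℓ (fun t _ => g t) f (fun t => f (-t)) fun t => ρ' t := by
      refine IsWeakSolution.congr hT.le hℓ.le hsol (fun t ht x _ => ?_)
        (fun _ _ => .of_forall fun _ => rfl) (hfρ.mono fun _ h => h.symm)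
        (hfu.mono fun _ h => h.symm)
      rw [hg, clampTime_of_mem hT _ ht, intervalIntegral_eq_road hℓ.le]
    have hae : ∀ t ∈ Icc 0 T, ρ' t =ᵐ[roadMeasure ℓ] transported T (fun t _ => g t) f t :=
      fun t ht => hsol'.ae_eq hT hℓ hgs hN (isCurve_transported hgs hT hf)
        (isWeakSolution_transported hgs hT hℓ hf) ht
    have hmass : ∀ t ∈ Icc 0 T, W' t = roadMass T ℓ f (fun t _ => g t) t := fun t ht =>
      integral_congr_ae (hae t ht)
    -- The competitor is not assumed nonnegative. Its mass is known to lie in `[0, m]`, where the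
    -- cut-off is invisible, only because it has been identified as transported from nonnegative
    -- data.
    have hgv : (fun t (_ : ℝ) => g t) = fun t _ => vc t (clampTime hT W' t) := by
      funext t _
      have ht := (projIcc 0 T hT.le t).2
      have h1 : W' (projIcc 0 T hT.le t) ∈ Icc 0 m := by
        rw [hmass _ ht]
        exact roadMass_mem hgs hT hf hf0 ht
      simp only [hg, hvcdef, clampTime, projIcc_of_mem hm0 h1]
    have hWeq := hWuniq W' hW'c fun t ht => by rw [hmass t ht, hgv]
    have hfin : (fun t (_ : ℝ) => g t) = fun t _ => vc t (W t) := by rw [hgv, hWeq]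
    refine Lp.ext ((hae t ht).trans ?_)
    rw [hfin]
    exact (coeFn_transportedLp hs hT hf ht).symm

/-! ### The local traffic load -/

section LocalLoad
variable {T ℓ M : ℝ} {r : ℝ → ℝ → ℝ}

lemma abs_roadPrimitive_sub_le_mul {r : ℝ → ℝ} (hr : Integrable r (roadMeasure ℓ)) (hM : 0 ≤ M)
    (hb : ∀ᵐ x ∂(roadMeasure ℓ), |r x| ≤ M) (x x' : ℝ) :
    |roadPrimitive ℓ r x - roadPrimitive ℓ r x'| ≤ M * |x - x'| := by
  have hi := (integrable_indicator_iff measurableSet_Ioo).2 hr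
  unfold roadPrimitive
  rw [intervalIntegral.integral_interval_sub_left hi.intervalIntegrable hi.intervalIntegrable,
    ← Real.norm_eq_abs]
  refine intervalIntegral.norm_integral_le_of_norm_le_const_ae ?_
  rw [ae_restrict_iff' measurableSet_Ioo] at hb
  filter_upwards [hb] with y hy _
  by_cases h : y ∈ Ioo 0 ℓ
  · rw [indicator_of_mem h]
    exact hy h
  · rw [indicator_of_notMem h, norm_zero]
    exact hM

lemma integral_eq_roadPrimitive_sub {r : ℝ → ℝ} (hr : Integrable r (roadMeasure ℓ)) {x x' : ℝ}
    (hx : x ∈ Icc 0 ℓ) (hx' : x' ∈ Icc 0 ℓ) :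
    ∫ s in x..x', r s = roadPrimitive ℓ r x' - roadPrimitive ℓ r x := by
  have hi := (integrable_indicator_iff measurableSet_Ioo).2 hr
  unfold roadPrimitive
  rw [intervalIntegral.integral_interval_sub_left hi.intervalIntegrable hi.intervalIntegrable]
  refine intervalIntegral.integral_congr_ae ?_
  have hne : ∀ c : ℝ, ∀ᵐ t : ℝ, t ≠ c := fun c => by simp [ae_iff]
  filter_upwards [hne 0, hne ℓ] with y h0 hℓ hy
  have := (ordConnected_Icc.uIcc_subset hx hx') (uIoc_subset_uIcc hy)
  rw [indicator_of_mem (mem_Ioo.2 ⟨lt_of_le_of_ne this.1 h0.symm, lt_of_le_of_ne this.2 hℓ⟩)]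

lemma IsCurve.continuousOn_roadPrimitive (hr : IsCurve T ℓ M r) (hM : 0 ≤ M) :
    ContinuousOn (fun z : ℝ × ℝ => roadPrimitive ℓ (r z.1) z.2) (Icc 0 T ×ˢ univ) := by
  rintro ⟨t, x⟩ ⟨ht, -⟩
  rw [ContinuousWithinAt, tendsto_iff_dist_tendsto_zero, nhdsWithin_prod_eq]
  have h1 : Tendsto (fun z : ℝ × ℝ => (∫ y, |r z.1 y - r t y| ∂(roadMeasure ℓ)) + M * |z.2 - x|)
      (𝓝[Icc 0 T] t ×ˢ 𝓝[univ] x) (𝓝 0) := by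
    have a1 := (hr.cont t ht).comp (tendsto_fst (g := 𝓝[univ] x))
    have a2 : Tendsto (fun z : ℝ => M * |z - x|) (𝓝[univ] x) (𝓝 0) := by
      have : Continuous fun z : ℝ => M * |z - x| := by fun_prop
      have := this.tendsto x
      simpa using this
    simpa using a1.add (a2.comp (tendsto_snd (f := 𝓝[Icc 0 T] t)))
  refine squeeze_zero' (.of_forall fun _ => dist_nonneg) ?_ h1
  have hev : ∀ᶠ z : ℝ × ℝ in 𝓝[Icc 0 T] t ×ˢ 𝓝[univ] x, z.1 ∈ Icc 0 T :=
    tendsto_fst.eventually self_mem_nhdsWithin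
  filter_upwards [hev] with z hz
  refine (dist_triangle _ (roadPrimitive ℓ (r t) z.2) _).trans (add_le_add ?_ ?_)
  · exact hr.abs_roadPrimitive_sub_le ht hz z.2
  · exact abs_roadPrimitive_sub_le_mul (hr.integrable ht) hM (hr.bound t ht) _ _

end LocalLoad

/-! ### Admissible speeds on a compact box -/

/-- The compact part of `[0,T] × [0,ℓ] × [0,∞)` on which the truck speed is evaluated. -/
abbrev SpeedBox (T ℓ Y : ℝ) : Type := ↥(Icc (0 : ℝ) T) × ↥(Icc (0 : ℝ) ℓ) × ↥(Icc (0 : ℝ) Y)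

/-- Admissible speeds on the box. -/
def boxSpeeds (T ℓ Y lmin lmax L : ℝ) : Set (SpeedBox T ℓ Y →ᵇ ℝ) :=
  {g | (∀ z, g z ∈ Icc lmin lmax) ∧ ∀ z z', |g z - g z'|
    ≤ L * (|(z.2.1 : ℝ) - z'.2.1| + |(z.2.2 : ℝ) - z'.2.2| + |(z.1 : ℝ) - z'.1|)}

/-- The extension of a function on the box which is constant outside. -/
noncomputable def boxExtend {T ℓ Y : ℝ} (hT : 0 ≤ T) (hℓ : 0 ≤ ℓ) (hY : 0 ≤ Y)
    (g : SpeedBox T ℓ Y → ℝ) (t x y : ℝ) : ℝ :=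
  g (projIcc 0 T hT t, projIcc 0 ℓ hℓ x, projIcc 0 Y hY y)

section Box
variable {T ℓ Y lmin lmax L : ℝ}

lemma isCompact_boxSpeeds (hL : 0 ≤ L) : IsCompact (boxSpeeds T ℓ Y lmin lmax L) := by
  refine BoundedContinuousFunction.arzela_ascoli₂ (Icc lmin lmax) isCompact_Icc _ ?_
    (fun g z hg => hg.1 z) ?_
  · have hev : ∀ z, Continuous fun g : SpeedBox T ℓ Y →ᵇ ℝ => g z := fun z =>
      (BoundedContinuousFunction.lipschitz_eval_const z).continuous
    simp only [boxSpeeds, ofPred_and, ofPred_forall]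
    refine IsClosed.inter (isClosed_iInter fun z => isClosed_Icc.preimage (hev z))
      (isClosed_iInter fun z => isClosed_iInter fun z' => ?_)
    exact isClosed_le ((hev z).sub (hev z')).abs continuous_const
  -- Each of the three coordinate differences is at most the product distance, hence the modulus `3
  -- * L * d`.
  · refine Metric.equicontinuous_of_continuity_modulus (fun d => 3 * L * d) ?_ _ ?_
    · have : Continuous fun d : ℝ => 3 * L * d := by fun_prop
      simpa using this.tendsto 0
    · intro z z' g
      refine (g.2.2 z z').trans ?_
      have h1 : |(z.1 : ℝ) - z'.1| ≤ dist z z' := le_max_left _ _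
      have h2 : |(z.2.1 : ℝ) - z'.2.1| ≤ dist z z' := (le_max_left _ _).trans (le_max_right _ _)
      have h3 : |(z.2.2 : ℝ) - z'.2.2| ≤ dist z z' := (le_max_right _ _).trans (le_max_right _ _)
      nlinarith

lemma nonempty_boxSpeeds (hl : lmin ≤ lmax) (hL : 0 ≤ L) :
    (boxSpeeds T ℓ Y lmin lmax L).Nonempty :=
  ⟨BoundedContinuousFunction.const _ lmin, fun _ => ⟨le_rfl, hl⟩, fun z z' => by
    simp only [BoundedContinuousFunction.const_apply, sub_self, abs_zero]
    positivity⟩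

/-- Projections onto intervals do not increase distances, so extending by projection keeps the
bounds and the constant `L`. An optimum found on the box thus becomes an element of `Λ`. -/
lemma isAdmissibleSpeed_boxExtend (hT : 0 ≤ T) (hℓ : 0 ≤ ℓ) (hY : 0 ≤ Y) (hL : 0 ≤ L)
    {g : SpeedBox T ℓ Y →ᵇ ℝ} (hg : g ∈ boxSpeeds T ℓ Y lmin lmax L) :
    IsAdmissibleSpeed T ℓ lmin lmax L (boxExtend hT hℓ hY g) where
  continuousOn := by
    refine Continuous.continuousOn (g.continuous.comp ?_)
    exact (continuous_projIcc.comp continuous_fst).prodMk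
      ((continuous_projIcc.comp (continuous_fst.comp continuous_snd)).prodMk
        (continuous_projIcc.comp (continuous_snd.comp continuous_snd)))
  mem_Icc _ _ _ _ _ _ := hg.1 _
  lipschitz t _ t' _ x _ x' _ y y' _ _ := by
    refine (hg.2 _ _).trans (mul_le_mul_of_nonneg_left ?_ hL)
    exact add_le_add (add_le_add (abs_projIcc_sub_projIcc hℓ) (abs_projIcc_sub_projIcc hY))
      (abs_projIcc_sub_projIcc hT)

lemma exists_boxSpeed {lam : ℝ → ℝ → ℝ → ℝ}
    (h : IsAdmissibleSpeed T ℓ lmin lmax L lam) :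
    ∃ g ∈ boxSpeeds T ℓ Y lmin lmax L, ∀ z : SpeedBox T ℓ Y, g z = lam z.1 z.2.1 z.2.2 := by
  have hc : Continuous fun z : SpeedBox T ℓ Y => lam z.1 z.2.1 z.2.2 :=
    h.continuousOn.comp_continuous (f := fun z : SpeedBox T ℓ Y =>
      ((z.1 : ℝ), (z.2.1 : ℝ), (z.2.2 : ℝ))) (by fun_prop)
      fun z => ⟨z.1.2, z.2.1.2, z.2.2.2.1⟩
  refine ⟨BoundedContinuousFunction.mkOfCompact ⟨_, hc⟩, ⟨fun z => ?_, fun z z' => ?_⟩,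
    fun z => rfl⟩
  · exact h.mem_Icc _ z.1.2 _ z.2.1.2 _ z.2.2.2.1
  · exact h.lipschitz _ z.1.2 _ z'.1.2 _ z.2.1.2 _ z'.2.1.2 _ _ z.2.2.2.1 z'.2.2.2.1

/-- The truck velocity for a speed on the box and a local load `P`. -/
noncomputable def truckSpeed (hT : 0 ≤ T) (hℓ : 0 ≤ ℓ) (hY : 0 ≤ Y) (P : ℝ → ℝ → ℝ)
    (g : SpeedBox T ℓ Y → ℝ) (t x : ℝ) : ℝ :=
  boxExtend hT hℓ hY g t x (P (projIcc 0 T hT t) (projIcc 0 ℓ hℓ x))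

/-- The position enters directly and through the local load, hence the constant `L * (1 + N)`. It is
the same for all speeds on the box, which makes the estimates for the characteristics uniform. -/
lemma isSpeed_truckSpeed (hT : 0 ≤ T) (hℓ : 0 ≤ ℓ) (hY : 0 ≤ Y) (hL : 0 ≤ L) (hlmin : 0 < lmin)
    {P : ℝ → ℝ → ℝ} {N : ℝ≥0}
    (hP : ContinuousOn (fun z : ℝ × ℝ => P z.1 z.2) (Icc 0 T ×ˢ Icc 0 ℓ))
    (hPl : ∀ t ∈ Icc 0 T, LipschitzOnWith N (P t) (Icc 0 ℓ))
    {g : SpeedBox T ℓ Y →ᵇ ℝ} (hg : g ∈ boxSpeeds T ℓ Y lmin lmax L) :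
    IsSpeed lmin lmax (Real.toNNReal (L * (1 + N))) (truckSpeed hT hℓ hY P g) where
  pos := hlmin
  cont := by
    have h1 : Continuous fun z : ℝ × ℝ => projIcc 0 T hT z.1 := continuous_projIcc.comp continuous_fst
    have h2 : Continuous fun z : ℝ × ℝ => projIcc 0 ℓ hℓ z.2 := continuous_projIcc.comp continuous_snd
    have h3 : Continuous fun z : ℝ × ℝ => P (projIcc 0 T hT z.1) (projIcc 0 ℓ hℓ z.2) :=
      hP.comp_continuous (f := fun z : ℝ × ℝ =>
        ((projIcc 0 T hT z.1 : ℝ), (projIcc 0 ℓ hℓ z.2 : ℝ)))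
        ((continuous_subtype_val.comp h1).prodMk (continuous_subtype_val.comp h2))
        fun z => ⟨(projIcc 0 T hT z.1).2, (projIcc 0 ℓ hℓ z.2).2⟩
    exact g.continuous.comp (h1.prodMk (h2.prodMk (continuous_projIcc.comp h3)))
  lower _ _ := (hg.1 _).1
  upper _ _ := (hg.1 _).2
  lip t := by
    refine LipschitzWith.of_dist_le_mul fun x x' => ?_
    rw [Real.coe_toNNReal _ (by positivity), mul_assoc]
    refine (hg.2 _ _).trans (mul_le_mul_of_nonneg_left ?_ hL)
    have h1 : |(projIcc 0 ℓ hℓ x : ℝ) - projIcc 0 ℓ hℓ x'| ≤ |x - x'| := abs_projIcc_sub_projIcc hℓ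
    have h2 := (hPl _ (projIcc 0 T hT t).2).dist_le_mul _ (projIcc 0 ℓ hℓ x).2 _
      (projIcc 0 ℓ hℓ x').2
    rw [Real.dist_eq, Real.dist_eq] at h2
    have h3 := (abs_projIcc_sub_projIcc hY (c := P (projIcc 0 T hT t) (projIcc 0 ℓ hℓ x))
      (d := P (projIcc 0 T hT t) (projIcc 0 ℓ hℓ x'))).trans h2
    have h4 := mul_le_mul_of_nonneg_left h1 N.2
    simp only [sub_self, abs_zero, add_zero, Real.dist_eq, add_mul, one_mul]
    exact add_le_add h1 (h3.trans h4)
  left t x hx := by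
    rw [truckSpeed, truckSpeed, boxExtend, boxExtend, projIcc_of_le_left hℓ hx,
      projIcc_of_le_left hℓ le_rfl]

lemma truckSpeed_of_mem (hT : 0 ≤ T) (hℓ : 0 ≤ ℓ) (hY : 0 ≤ Y) {P : ℝ → ℝ → ℝ}
    (g : SpeedBox T ℓ Y → ℝ) {t x : ℝ} (ht : t ∈ Icc 0 T) (hx : x ∈ Icc 0 ℓ) :
    truckSpeed hT hℓ hY P g t x = boxExtend hT hℓ hY g t x (P t x) := by
  rw [truckSpeed, projIcc_of_mem hT ht, projIcc_of_mem hℓ hx]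

lemma boxExtend_of_mem (hT : 0 ≤ T) (hℓ : 0 ≤ ℓ) (hY : 0 ≤ Y) {g : SpeedBox T ℓ Y → ℝ}
    {lam : ℝ → ℝ → ℝ → ℝ} (h : ∀ z : SpeedBox T ℓ Y, g z = lam z.1 z.2.1 z.2.2) {t x y : ℝ}
    (ht : t ∈ Icc 0 T) (hx : x ∈ Icc 0 ℓ) (hy : y ∈ Icc 0 Y) :
    boxExtend hT hℓ hY g t x y = lam t x y := by
  rw [boxExtend, h, projIcc_of_mem hT ht, projIcc_of_mem hℓ hx, projIcc_of_mem hY hy]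

end Box

/-! ### Continuity of the cost and existence of optimizers -/

/-- The variance of `q` with weights `m₁` and `m₂` for the second and the first moment. -/
noncomputable def variance (T ℓ : ℝ) (m₁ m₂ q : ℝ → ℝ → ℝ) : ℝ :=
  ∫ t in 0..T, ((∫ x, q t x * m₁ t x ∂(roadMeasure ℓ))
    - (∫ x, q t x * m₂ t x ∂(roadMeasure ℓ)) ^ 2)

lemma variance_congr {T ℓ : ℝ} (hT : 0 ≤ T) {m₁ m₂ q q' : ℝ → ℝ → ℝ}
    (h : ∀ t ∈ Icc 0 T, q t =ᵐ[roadMeasure ℓ] q' t) :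
    variance T ℓ m₁ m₂ q = variance T ℓ m₁ m₂ q' := by
  refine intervalIntegral.integral_congr fun t ht => ?_
  rw [uIcc_of_le hT] at ht
  have e : ∀ m : ℝ → ℝ, ∫ x, q t x * m x ∂(roadMeasure ℓ) = ∫ x, q' t x * m x ∂(roadMeasure ℓ) :=
    fun m => integral_congr_ae ((h t ht).mono fun x hx => by simp only [hx])
  simp only [e]

/-- At each time the moments converge by `tendsto_integral_mul_comp`, the weight cut off to the road
being merely integrable. The common constants `a`, `B`, `K` bound the moments uniformly, so
dominated convergence in time finishes. -/
lemma tendsto_variance {ι : Type*} {l : Filter ι} [l.IsCountablyGenerated] {T ℓ M N₁ N₂ a B : ℝ}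
    {K : ℝ≥0} (hT : 0 < T) {w : ℝ → ℝ → ℝ} {ws : ι → ℝ → ℝ → ℝ} {ε : ι → ℝ}
    {m₁ m₂ : ℝ → ℝ → ℝ} {f : ℝ → ℝ} (hf : IsLabelData T ℓ M f) (hw : IsSpeed a B K w)
    (hws : ∀ n, IsSpeed a B K (ws n))
    (hε : ∀ n, ∀ t ∈ Icc 0 T, ∀ x, |ws n t x - w t x| ≤ ε n) (hε0 : Tendsto ε l (𝓝 0))
    (hm₁ : IsCurve T ℓ N₁ m₁) (hm₂ : IsCurve T ℓ N₂ m₂) :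
    Tendsto (fun n => variance T ℓ m₁ m₂ (transported T (ws n) f)) l
      (𝓝 (variance T ℓ m₁ m₂ (transported T w f))) := by
  have hmom : ∀ {N : ℝ} {m : ℝ → ℝ → ℝ}, IsCurve T ℓ N m → ∀ t ∈ Icc 0 T,
      Tendsto (fun n => ∫ x, transported T (ws n) f t x * m t x ∂(roadMeasure ℓ)) l
        (𝓝 (∫ x, transported T w f t x * m t x ∂(roadMeasure ℓ))) := by
    intro N m hm t ht
    rw [integral_transported_road hw hT f (m t) ht]
    simp only [fun n => integral_transported_road (ℓ := ℓ) (hws n) hT f (m t) ht]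
    exact tendsto_integral_mul_comp
      (.of_forall fun n => (hws n).continuous_characteristic hT ht)
      (.of_forall fun n => (hws n).antilipschitz_characteristic hT ht)
      (hw.continuous_characteristic hT ht) (hw.antilipschitz_characteristic hT ht)
      (fun y hy => tendsto_characteristic hT hw hws hε hε0 ht
        (by by_contra hn; exact hy (hf.supp y fun hm => hn hm.1.le)))
      hf.integrable hf.bound
      ((integrable_indicator_iff measurableSet_Ioo).2 (hm.integrable ht))
  have hcur : ∀ {N : ℝ} {m : ℝ → ℝ → ℝ}, IsCurve T ℓ N m → ∀ n,
      IsCurve T ℓ (charConst T a K * M * N) fun t x => transported T (ws n) f t x * m t x :=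
    fun hm n => (isCurve_transported (hws n) hT hf).mul hm
  refine intervalIntegral.tendsto_integral_filter_of_dominated_convergence
    (fun _ => charConst T a K * M * N₁ * (roadMeasure ℓ).real univ
      + (charConst T a K * M * N₂ * (roadMeasure ℓ).real univ) ^ 2) ?_ ?_
    intervalIntegrable_const ?_
  · refine .of_forall fun n => ?_
    rw [uIoc_of_le hT.le]
    refine ContinuousOn.aestronglyMeasurable ?_ measurableSet_Ioc
    exact ((hcur hm₁ n).continuousOn_integral.sub ((hcur hm₂ n).continuousOn_integral.pow 2)).mono
      Ioc_subset_Icc_self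
  · refine .of_forall fun n => .of_forall fun t ht => ?_
    rw [uIoc_of_le hT.le] at ht
    have ht' := Ioc_subset_Icc_self ht
    refine (norm_sub_le _ _).trans (add_le_add ((hcur hm₁ n).abs_integral_le ht') ?_)
    rw [norm_pow]
    exact pow_le_pow_left₀ (norm_nonneg _) ((hcur hm₂ n).abs_integral_le ht') 2
  · refine .of_forall fun t ht => ?_
    rw [uIoc_of_le hT.le] at ht
    exact (hmom hm₁ t (Ioc_subset_Icc_self ht)).sub ((hmom hm₂ t (Ioc_subset_Icc_self ht)).pow 2)

lemma exists_optimal_boxSpeed {T ℓ Y lmin lmax L M N₁ N₂ : ℝ} (hT : 0 < T) (hℓ : 0 ≤ ℓ)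
    (hY : 0 ≤ Y) (hL : 0 ≤ L) (hlmin : 0 < lmin) (hl : lmin ≤ lmax) {P : ℝ → ℝ → ℝ} {N : ℝ≥0}
    (hP : ContinuousOn (fun z : ℝ × ℝ => P z.1 z.2) (Icc 0 T ×ˢ Icc 0 ℓ))
    (hPl : ∀ t ∈ Icc 0 T, LipschitzOnWith N (P t) (Icc 0 ℓ)) {f : ℝ → ℝ}
    (hf : IsLabelData T ℓ M f) {m₁ m₂ : ℝ → ℝ → ℝ}
    (hm₁ : IsCurve T ℓ N₁ m₁) (hm₂ : IsCurve T ℓ N₂ m₂) :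
    ∃ g ∈ boxSpeeds T ℓ Y lmin lmax L, ∀ g' ∈ boxSpeeds T ℓ Y lmin lmax L,
      variance T ℓ m₁ m₂ (transported T (truckSpeed hT.le hℓ hY P g) f)
        ≤ variance T ℓ m₁ m₂ (transported T (truckSpeed hT.le hℓ hY P g') f) := by
  have hs : ∀ g : boxSpeeds T ℓ Y lmin lmax L,
      IsSpeed lmin lmax (Real.toNNReal (L * (1 + N))) (truckSpeed hT.le hℓ hY P g) := fun g =>
    isSpeed_truckSpeed hT.le hℓ hY hL hlmin hP hPl g.2
  refine (isCompact_boxSpeeds hL).exists_isMinOn (nonempty_boxSpeeds hl hL)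
    (f := fun g => variance T ℓ m₁ m₂ (transported T (truckSpeed hT.le hℓ hY P g) f)) ?_
  rw [continuousOn_iff_continuous_domRestrict, continuous_iff_continuousAt]
  intro g
  -- The supremum distance of two speeds on the box bounds the difference of the resulting truck
  -- velocities at every point.
  refine tendsto_variance (ε := fun g' => dist g' g) hT hf (hs g) hs (fun g' t _ x => ?_) ?_ hm₁ hm₂
  · exact BoundedContinuousFunction.dist_coe_le_dist (f := g'.1) (g := g.1) _
  · exact tendsto_iff_dist_tendsto_zero.1 tendsto_id

/-- All candidates share `ρ`, so the weights may depend on it and one statement covers both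
functionals. The truck density of any competitor is, by linear uniqueness, the one transported by
its speed restricted to the box, so minimality there is minimality over all candidates. -/
theorem exists_optimal_candidate {T ℓ : ℝ} (hT : 0 < T) (hℓ : 0 < ℓ) {p : ℝ≥0∞} [Fact (1 ≤ p)]
    (hp : p ≠ ∞) {v : ℝ → ℝ → ℝ} {b d : ℝ → ℝ}
    (hb : ContDiffOn ℝ 1 b (Icc 0 ℓ)) (hb_maps : MapsTo b (Icc 0 ℓ) (Icc 0 ℓ))
    (hd : ContDiffOn ℝ 1 d (Icc 0 ℓ)) (hd_maps : MapsTo d (Icc 0 ℓ) (Icc 0 ℓ))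
    (hbd : ∀ x ∈ Icc 0 ℓ, b x ≤ d x) {lmin lmax L : ℝ} (hlmin : 0 < lmin) (hl : lmin ≤ lmax)
    (hL : 0 ≤ L) {ρ₀ u₁ q₀ u₂ : ℝ → ℝ} (hq₀ : MemLp q₀ ∞ (roadMeasure ℓ))
    (hu₂ : MemLp u₂ ∞ (volume.restrict (Ioo 0 T))) {ρ : ℝ → Lp ℝ p (roadMeasure ℓ)}
    (hρ : IsDensity T ℓ p ρ) (hρsol : SolvesTraffic T ℓ v ρ₀ u₁ fun t => ρ t)
    (hρ0 : ∀ t ∈ Icc 0 T, ∀ᵐ x ∂(roadMeasure ℓ), 0 ≤ ρ t x)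
    (huniq : ∀ ρ' : ℝ → Lp ℝ p (roadMeasure ℓ), IsDensity T ℓ p ρ' →
        SolvesTraffic T ℓ v ρ₀ u₁ (fun t => ρ' t) → ∀ t ∈ Icc 0 T, ρ' t = ρ t)
    {N₁ N₂ : ℝ} {m₁ m₂ : ℝ → ℝ → ℝ} (hm₁ : IsCurve T ℓ N₁ m₁) (hm₂ : IsCurve T ℓ N₂ m₂) :
    ∃ c ∈ feasible T ℓ p v b d lmin lmax L ρ₀ u₁ q₀ u₂,
      (∀ t ∈ Icc 0 T, c.ρ t = ρ t) ∧
      ∀ c' ∈ feasible T ℓ p v b d lmin lmax L ρ₀ u₁ q₀ u₂, (∀ t ∈ Icc 0 T, c'.ρ t = ρ t) ∧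
        variance T ℓ m₁ m₂ (fun t => c.q t) ≤ variance T ℓ m₁ m₂ (fun t => c'.q t) := by
  obtain ⟨M₁, hM₁, hb₁⟩ := exists_ae_bound hq₀
  obtain ⟨M₂, hM₂, hb₂⟩ := exists_ae_bound hu₂
  have hM : 0 ≤ max M₁ M₂ := le_max_of_le_left hM₁
  obtain ⟨f, hf, -, hfq, hfu⟩ := exists_labelData hT hℓ (neg_nonpos.2 hM) hM
    hq₀.1.aemeasurable hu₂.1.aemeasurable
    (hb₁.mono fun x hx => abs_le.1 (hx.trans (le_max_left M₁ M₂)))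
    (hb₂.mono fun x hx => abs_le.1 (hx.trans (le_max_right M₁ M₂)))
  obtain ⟨R', hR'⟩ := hρ.exists_isCurve
  set R : ℝ≥0 := Real.toNNReal R' with hRdef
  have hcur : IsCurve T ℓ R fun t => ρ t :=
    ⟨hR'.meas, fun t ht => (hR'.bound t ht).mono fun x hx => hx.trans (Real.le_coe_toNNReal R'),
      hR'.cont⟩
  set P : ℝ → ℝ → ℝ := fun t x => roadPrimitive ℓ (ρ t) (d x) - roadPrimitive ℓ (ρ t) (b x)
    with hP
  have hPint : ∀ t ∈ Icc 0 T, ∀ x ∈ Icc 0 ℓ, ∫ s in (b x)..(d x), ρ t s = P t x :=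
    fun t ht x hx => integral_eq_roadPrimitive_sub (hcur.integrable ht) (hb_maps hx) (hd_maps hx)
  have hPc : ContinuousOn (fun z : ℝ × ℝ => P z.1 z.2) (Icc 0 T ×ˢ Icc 0 ℓ) := by
    have h := hcur.continuousOn_roadPrimitive R.2
    refine ContinuousOn.sub ?_ ?_
    · exact h.comp (continuousOn_fst.prodMk (hd.continuousOn.comp continuousOn_snd fun z hz => hz.2))
        fun z hz => ⟨hz.1, mem_univ _⟩
    · exact h.comp (continuousOn_fst.prodMk (hb.continuousOn.comp continuousOn_snd fun z hz => hz.2))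
        fun z hz => ⟨hz.1, mem_univ _⟩
  obtain ⟨Kb, hKb⟩ := hb.exists_lipschitzOnWith one_ne_zero (convex_Icc 0 ℓ) isCompact_Icc
  obtain ⟨Kd, hKd⟩ := hd.exists_lipschitzOnWith one_ne_zero (convex_Icc 0 ℓ) isCompact_Icc
  have hPl : ∀ t ∈ Icc 0 T, LipschitzOnWith (R * Kd + R * Kb) (P t) (Icc 0 ℓ) := by
    intro t ht
    have h1 : LipschitzWith R (roadPrimitive ℓ (ρ t)) := LipschitzWith.of_dist_le_mul fun x x' =>
      abs_roadPrimitive_sub_le_mul (hcur.integrable ht) R.2 (hcur.bound t ht) x x'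
    exact (h1.comp_lipschitzOnWith hKd).sub (h1.comp_lipschitzOnWith hKb)
  -- With `ρ` bounded by `R` on a road of length `ℓ`, no local load exceeds `R * ℓ`. Together with
  -- `ρ ≥ 0` and `b ≤ d` this keeps the third argument of the speed inside the box.
  set Y : ℝ := R * ℓ with hY
  have hY0 : 0 ≤ Y := by positivity
  have hPm : ∀ t ∈ Icc 0 T, ∀ x ∈ Icc 0 ℓ, P t x ∈ Icc 0 Y := by
    intro t ht x hx
    constructor
    · rw [← hPint t ht x hx]
      refine intervalIntegral.integral_nonneg_of_ae_restrict (hbd x hx) ?_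
      have h1 : ∀ᵐ s ∂(volume.restrict (Icc 0 ℓ)), 0 ≤ ρ t s := by
        rw [← restrict_Ioo_eq_restrict_Icc]
        exact hρ0 t ht
      exact ae_restrict_of_ae_restrict_of_subset
        (Icc_subset_Icc (hb_maps hx).1 (hd_maps hx).2) h1
    · refine (le_abs_self _).trans ((abs_roadPrimitive_sub_le_mul (hcur.integrable ht) R.2
        (hcur.bound t ht) (d x) (b x)).trans (mul_le_mul_of_nonneg_left ?_ R.2))
      exact abs_le.2 ⟨by linarith [(hd_maps hx).1, (hb_maps hx).2],
        by linarith [(hd_maps hx).2, (hb_maps hx).1]⟩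
  have hs : ∀ {g : SpeedBox T ℓ Y →ᵇ ℝ}, g ∈ boxSpeeds T ℓ Y lmin lmax L → IsSpeed lmin lmax
      (Real.toNNReal (L * (1 + (R * Kd + R * Kb : ℝ≥0)))) (truckSpeed hT.le hℓ.le hY0 P g) :=
    fun hg => isSpeed_truckSpeed hT.le hℓ.le hY0 hL hlmin hPc hPl hg
  obtain ⟨g, hg, hmin⟩ := exists_optimal_boxSpeed hT hℓ.le hY0 hL hlmin hl hPc hPl hf hm₁ hm₂
  refine ⟨⟨boxExtend hT.le hℓ.le hY0 g, ρ, transportedLp T ℓ p (truckSpeed hT.le hℓ.le hY0 P g) f⟩,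
    ⟨isAdmissibleSpeed_boxExtend hT.le hℓ.le hY0 hL hg, hρ, hρsol,
      isDensity_transportedLp hp (hs hg) hT hf, ?_⟩, fun _ _ => rfl, fun c' hc' => ?_⟩
  · refine (isWeakSolution_transported (hs hg) hT hℓ hf).congr hT.le hℓ.le (fun t ht x hx => ?_)
      (fun t ht => coeFn_transportedLp (hs hg) hT hf ht) hfq hfu
    simp only
    rw [hPint t ht x hx, truckSpeed_of_mem hT.le hℓ.le hY0 _ ht hx]
  · obtain ⟨hlam, hcρ, hcρsol, hcq, hcqsol⟩ := hc'
    have hρeq := huniq c'.ρ hcρ hcρsol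
    refine ⟨hρeq, ?_⟩
    obtain ⟨g', hg', hgl⟩ := exists_boxSpeed (Y := Y) hlam
    obtain ⟨Q, hQ⟩ := hcq.exists_isCurve
    have hsol : IsWeakSolution T ℓ (truckSpeed hT.le hℓ.le hY0 P g') f (fun t => f (-t))
        fun t => c'.q t := by
      refine IsWeakSolution.congr hT.le hℓ.le hcqsol (fun t ht x hx => ?_)
        (fun _ _ => .of_forall fun _ => rfl) (hfq.mono fun _ h => h.symm)
        (hfu.mono fun _ h => h.symm)
      rw [truckSpeed_of_mem hT.le hℓ.le hY0 _ ht hx,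
        boxExtend_of_mem hT.le hℓ.le hY0 hgl ht hx (hPm t ht x hx)]
      beta_reduce
      rw [hρeq t ht, hPint t ht x hx]
    have e1 := variance_congr (m₁ := m₁) (m₂ := m₂) hT.le fun t ht =>
      coeFn_transportedLp (p := p) (hs hg) hT hf ht
    have e2 := variance_congr (m₁ := m₁) (m₂ := m₂) hT.le fun t ht =>
      hsol.ae_eq hT hℓ (hs hg') hQ (isCurve_transported (hs hg') hT hf)
        (isWeakSolution_transported (hs hg') hT hℓ hf) ht
    simp only
    rw [e1, e2]
    exact hmin g' hg'

/-! ### The two functionals as weighted variances, and the conclusion -/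

lemma isCurve_pow {T ℓ : ℝ} (n : ℕ) : IsCurve T ℓ (ℓ ^ n) fun _ x => x ^ n :=
  IsCurve.const (measurable_id.pow_const n) fun x hx => by
    rw [abs_pow, abs_of_pos hx.1]
    exact pow_le_pow_left₀ hx.1.le hx.2.le n

lemma J₁_eq_variance {T ℓ : ℝ} (hℓ : 0 ≤ ℓ) (q : ℝ → ℝ → ℝ) :
    J₁ T ℓ q = variance T ℓ (fun _ x => x ^ 2) (fun _ x => x ^ 1) q := by
  simp only [J₁, variance, intervalIntegral_eq_road hℓ, pow_one, mul_comm]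

lemma J₂_eq_variance {T ℓ : ℝ} (hT : 0 ≤ T) (hℓ : 0 ≤ ℓ) (q ρ ρ' : ℝ → ℝ → ℝ)
    (h : ∀ t ∈ Icc 0 T, ρ t = ρ' t) :
    J₂ T ℓ q ρ = variance T ℓ (fun t x => x ^ 2 * (1 + ρ' t x)) (fun t x => x ^ 1 * (1 + ρ' t x))
      q := by
  refine intervalIntegral.integral_congr fun t ht => ?_
  rw [uIcc_of_le hT] at ht
  simp only [intervalIntegral_eq_road hℓ, h t ht, pow_one]
  have e : ∀ n : ℕ, ∀ x, x ^ n * q t x * (1 + ρ' t x) = q t x * (x ^ n * (1 + ρ' t x)) :=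
    fun n x => by ring
  have e' : ∀ x, x * q t x * (1 + ρ' t x) = q t x * (x * (1 + ρ' t x)) := fun x => by ring
  simp only [e, e']

end Platooning

theorem mainTheorem6 (T ℓ : ℝ) (hT : 0 < T) (hℓ : 0 < ℓ)
    (p : ℝ≥0∞) [Fact (1 ≤ p)] (hp : p ≠ ∞)
    (v : ℝ → ℝ → ℝ)
    (hv : ContDiffOn ℝ 1 (fun z : ℝ × ℝ => v z.1 z.2) (Icc 0 T ×ˢ univ))
    (hv_pos : ∀ t ∈ Icc 0 T, ∀ y, 0 < v t y)
    (b d : ℝ → ℝ)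
    (hb : ContDiffOn ℝ 1 b (Icc 0 ℓ)) (hb_maps : MapsTo b (Icc 0 ℓ) (Icc 0 ℓ))
    (hd : ContDiffOn ℝ 1 d (Icc 0 ℓ)) (hd_maps : MapsTo d (Icc 0 ℓ) (Icc 0 ℓ))
    (hbd : ∀ x ∈ Icc 0 ℓ, b x ≤ d x)
    (lmin lmax L : ℝ) (hlmin : 0 < lmin) (hlmax : lmin ≤ lmax) (hL : 0 ≤ L)
    (ρ₀ u₁ q₀ u₂ : ℝ → ℝ)
    (hρ₀ : MemLp ρ₀ ∞ (volume.restrict (Ioo 0 ℓ)))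
    (hρ₀_nonneg : ∀ᵐ x ∂(volume.restrict (Ioo 0 ℓ)), 0 ≤ ρ₀ x)
    (hu₁ : MemLp u₁ ∞ (volume.restrict (Ioo 0 T)))
    (hu₁_nonneg : ∀ᵐ t ∂(volume.restrict (Ioo 0 T)), 0 ≤ u₁ t)
    (hq₀ : MemLp q₀ ∞ (volume.restrict (Ioo 0 ℓ)))
    (hu₂ : MemLp u₂ ∞ (volume.restrict (Ioo 0 T))) :
    (∃ c ∈ Platooning.feasible T ℓ p v b d lmin lmax L ρ₀ u₁ q₀ u₂,
      IsMinOn (fun c => Platooning.J₁ T ℓ (fun t => c.q t))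
        (Platooning.feasible T ℓ p v b d lmin lmax L ρ₀ u₁ q₀ u₂) c) ∧
    (∃ c ∈ Platooning.feasible T ℓ p v b d lmin lmax L ρ₀ u₁ q₀ u₂,
      IsMinOn (fun c => Platooning.J₂ T ℓ (fun t => c.q t) (fun t => c.ρ t))
        (Platooning.feasible T ℓ p v b d lmin lmax L ρ₀ u₁ q₀ u₂) c) := by
  open Platooning in
  obtain ⟨ρ, hρ, hρsol, hρ0, huniq⟩ := exists_unique_traffic (p := p) hT hℓ hp hv hv_pos hρ₀
    hρ₀_nonneg hu₁ hu₁_nonneg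
  constructor
  · obtain ⟨c, hc, -, hmin⟩ := exists_optimal_candidate hT hℓ hp hb hb_maps hd hd_maps hbd hlmin
      hlmax hL hq₀ hu₂ hρ hρsol hρ0 huniq (isCurve_pow 2) (isCurve_pow 1)
    refine ⟨c, hc, fun c' hc' => ?_⟩
    simp only [mem_ofPred_eq, J₁_eq_variance hℓ.le]
    exact (hmin c' hc').2
  · obtain ⟨N, hN⟩ := hρ.exists_isCurve
    -- For `J₂` the factor `1 + ρ` is moved from the density into the weights, where it is fixed
    -- because `ρ` is the same for all candidates.
    have h1 : IsCurve T ℓ (1 + N) fun t x => 1 + ρ t x :=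
      (IsCurve.const (M := 1) (g := fun _ => 1) measurable_const fun x _ => by simp).add hN
    obtain ⟨c, hc, hcρ, hmin⟩ := exists_optimal_candidate hT hℓ hp hb hb_maps hd hd_maps hbd hlmin
      hlmax hL hq₀ hu₂ hρ hρsol hρ0 huniq ((isCurve_pow 2).mul h1) ((isCurve_pow 1).mul h1)
    refine ⟨c, hc, fun c' hc' => ?_⟩
    obtain ⟨hcρ', hle⟩ := hmin c' hc'
    have e : ∀ c : Candidate ℓ p, (∀ t ∈ Icc 0 T, c.ρ t = ρ t) →
        J₂ T ℓ (fun t => c.q t) (fun t => c.ρ t) = variance T ℓ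
          (fun t x => x ^ 2 * (1 + ρ t x)) (fun t x => x ^ 1 * (1 + ρ t x)) fun t => c.q t :=
      fun c h => J₂_eq_variance hT.le hℓ.le _ _ _ fun t ht => by rw [h t ht]
    simp only [mem_ofPred_eq, e c hcρ, e c' hcρ']
    exact hle
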